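/- **Setting.** There are $K$ arms and $T\ge K\ge 1$ rounds. In round $t$ the environment picks a (possibly random, possibly history-dependent) loss vector $\ell^t\in[0,1]^K$ while the learner simultaneously draws an arm $i^t$ from a distribution $p^t$ that depends only on her past observations; she then suffers and observes $\ell^t_{i^t}$. Let $\mathrm{Reg}^T=\mathbb E\big[\sum_{t=1}^T \ell^t_{i^t}-\sum_{t=1}^T\ell^t_{i^\star}\big]$, where $i^\star\in\arg\min_i \mathbb E\big[\sum_{t=1}^T\ell^t_i\big]$ is any best fixed arm, and let $\mathbb E^t$ denote conditional expectation given the history before round $t$. **Algorithm.** Fix $\beta\in(0,1)$ and put $C_{\log}=\frac{162\beta}{1-\beta}$ and $\theta=\sqrt{(1-\beta)/\beta}$. In round $t$ the learner uses $$p^t=\arg\min_{p}\Big\{\Big\langle p,\sum_{\tau<t}\widehat\ell^\tau\Big\rangle-C_{\log}\sum_{i=1}^K\log p_i-\frac1{1-\beta}\sum_{i=1}^K\gamma^t_i\,p_i^\beta\Big\},\qquad \gamma^t_i=\theta\sqrt{1+\sum_{\tau<t}\max\{p^\tau_i,1/T\}^{1-2\beta}},$$ the minimum being over the probability simplex on $K$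 arms, with the importance-weighted estimators $\widehat\ell^\tau_i=\mathbf 1\{i^\tau=i\}\,\ell^\tau_i/p^\tau_i$. **Theorem.** There is a universal constant $c>0$ such that for all $\beta\in(0,1)$, all $T\ge K\ge1$ and every environment the following hold simultaneously for this algorithm. 1. Always, $$\mathrm{Reg}^T\le c\,\sqrt{\frac{1}{\beta(1-\beta)}\,K\,T\,(\log T)^{\mathbb I\{\beta\ne 1/2\}}}.$$ 2. Let $\Delta\in[0,1]^K$, $C\ge0$ and $D$ be such that $\mathrm{Reg}^T\ge\mathbb E\big[\sum_{t=1}^T\sum_{i=1}^K p^t_i\Delta_i\big]-C$ and $\mathbb E\big[\sum_{t=1}^T\max_{i\in U}\mathbb E^t[\ell^t_i-\ell^t_{i^\star}]\big]\le D$, where $U=\{i:\Delta_i=0\}$. Put $V=\{i:\Delta_i>0\}$, $\Delta_{\min}=\min_{i\in V}\Delta_i$ and $\mathbb G=\frac{|U|}{\Delta_{\min}}+\sum_{i\in V}\frac1{\Delta_i}$ (with $\mathbb G=0$ if $V=\emptyset$, and with the maximum over $U$ read as $0$ if $U=\emptyset$). Then, with no assumption that the optimal arm is unique, $$\mathrm{Reg}^T\le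 c\left(\frac{\mathbb G\log T}{\beta(1-\beta)}+\sqrt{\frac{C\,\mathbb G\log T}{\beta(1-\beta)}}+D+\frac{K^2\sqrt\beta}{(1-\beta)^{3/2}}+\frac{\beta K\log T}{1-\beta}\right).$$ -/

import Mathlib

open MeasureTheory

noncomputable section

namespace BOBW

/-- The distributions over `K` arms with full support (the relative interior of the simplex).
A log-barrier with positive coefficient is `+∞` at every distribution with a zero coordinate, so
minimizing a regularized objective over the simplex means minimizing it over this set. -/
def posSimplex (K : ℕ) : Set (Fin K → ℝ) :=
  {x | (∀ i, 0 < x i) ∧ ∑ i, x i = 1}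

/-- The β-Tsallis entropy with arm-dependent learning rates `γ`, plus the extra log-barrier with
coefficient `Clog`. -/
def tsallisReg {K : ℕ} (Clog β : ℝ) (γ x : Fin K → ℝ) : ℝ :=
  -Clog * ∑ i, Real.log (x i) - 1 / (1 - β) * ∑ i, γ i * x i ^ β

/-- `p` minimizes `⟨x, L⟩ + φ(x)` over the simplex, `φ` being `tsallisReg Clog β γ`. -/
def IsFTRLArgmin {K : ℕ} (Clog β : ℝ) (γ L p : Fin K → ℝ) : Prop :=
  p ∈ posSimplex K ∧
    ∀ x ∈ posSimplex K,
      (∑ i, p i * L i) + tsallisReg Clog β γ p ≤ (∑ i, x i * L i) + tsallisReg Clog β γ x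

/-- The importance-weighted loss estimator built from the loss vector `l`, the sampling
distribution `p` and the drawn arm `a`; it only depends on the observed loss `l a`. -/
def lossEst {K : ℕ} (l p : Fin K → ℝ) (a : Fin K) (i : Fin K) : ℝ :=
  if a = i then l i / p i else 0

/-- The learning rate `θ √(1 + ∑_{τ < t} max{p^τ_i, 1/T}^{1 - 2α})` for a sequence of
distributions `p`. Rounds are numbered `0, 1, …, T - 1`. -/
def learningRate {K : ℕ} (θ α : ℝ) (T : ℕ) (p : ℕ → Fin K → ℝ) (t : ℕ) (i : Fin K) : ℝ :=
  θ * √(1 + ∑ τ ∈ Finset.range t, (max (p τ i) (1 / (T : ℝ))) ^ (1 - 2 * α))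

section Protocol

variable {Ω : Type*} {mΩ : MeasurableSpace Ω} {K : ℕ}

/-- A `K`-armed bandit game of `T` rounds (numbered `0, …, T - 1`): in round `t` the environment
picks the loss vector `ℓ t`, the learner holds the distribution `p t`, draws the arm `I t` from it
and observes only the loss of that arm. The σ-algebra `𝓗 t` is the history before round `t`. It
contains at least everything the learner has observed; it may also contain all the past loss
vectors and internal randomness of the environment. The loss vectors are otherwise arbitrary
random vectors in `[0,1]^K`, so `ℓ t` may depend on the past draws. -/
structure IsBanditGame (μ : Measure Ω) (T : ℕ) (𝓗 : Filtration ℕ mΩ)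
    (ℓ p : ℕ → Ω → Fin K → ℝ) (I : ℕ → Ω → Fin K) : Prop where
  loss_measurable : ∀ t < T, Measurable (ℓ t)
  loss_mem : ∀ t < T, ∀ ω i, ℓ t ω i ∈ Set.Icc (0 : ℝ) 1
  arm_measurable : ∀ t < T, Measurable (I t)
  /-- The arms drawn before round `t` belong to the history. -/
  arm_history : ∀ t < T, ∀ s < t, Measurable[𝓗 t] (I s)
  /-- The losses observed before round `t` belong to the history. -/
  obs_history : ∀ t < T, ∀ s < t, Measurable[𝓗 t] (fun ω => ℓ s ω (I s ω))
  /-- The learner's distribution in round `t` is determined by the history. -/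
  dist_history : ∀ t < T, Measurable[𝓗 t] (p t)
  /-- Learner and environment move simultaneously: given the history and the loss vector of the
  round, the arm is distributed according to `p t`. -/
  draw : ∀ t < T, ∀ i,
    μ[({ω | I t ω = i} : Set Ω).indicator (fun _ => (1 : ℝ)) |
        𝓗 t ⊔ MeasurableSpace.comap (ℓ t) inferInstance] =ᵐ[μ] fun ω => p t ω i

/-- The learner's distributions are those of FTRL with the β-Tsallis entropy regularizer, the
extra log-barrier with coefficient `Clog`, and the learning rate with parameters `θ`, `α`. -/
def FollowsTsallisFTRL (θ α β Clog : ℝ) (T : ℕ)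
    (ℓ p : ℕ → Ω → Fin K → ℝ) (I : ℕ → Ω → Fin K) : Prop :=
  ∀ t < T, ∀ ω,
    IsFTRLArgmin Clog β
      (learningRate θ α T (fun τ => p τ ω) t)
      (fun i => ∑ τ ∈ Finset.range t, lossEst (ℓ τ ω) (p τ ω) (I τ ω) i)
      (p t ω)

/-- `iStar` minimizes the expected cumulative loss. -/
def IsBestArm (μ : Measure Ω) (T : ℕ) (ℓ : ℕ → Ω → Fin K → ℝ) (iStar : Fin K) : Prop :=
  ∀ i, ∫ ω, ∑ t ∈ Finset.range T, ℓ t ω iStar ∂μ ≤ ∫ ω, ∑ t ∈ Finset.range T, ℓ t ω i ∂μ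

/-- The (pseudo-)regret against the fixed arm `iStar`. -/
def regret (μ : Measure Ω) (T : ℕ) (ℓ : ℕ → Ω → Fin K → ℝ) (I : ℕ → Ω → Fin K)
    (iStar : Fin K) : ℝ :=
  ∫ ω, (∑ t ∈ Finset.range T, ℓ t ω (I t ω) - ∑ t ∈ Finset.range T, ℓ t ω iStar) ∂μ

/-- The self-bounding condition with gap vector `Δ ∈ [0,1]^K` and corruption level `C ≥ 0`. -/
def SelfBounding (μ : Measure Ω) (T : ℕ) (ℓ p : ℕ → Ω → Fin K → ℝ) (I : ℕ → Ω → Fin K)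
    (iStar : Fin K) (Δ : Fin K → ℝ) (C : ℝ) : Prop :=
  (∀ i, Δ i ∈ Set.Icc (0 : ℝ) 1) ∧ 0 ≤ C ∧
    (∫ ω, ∑ t ∈ Finset.range T, ∑ i, p t ω i * Δ i ∂μ) - C ≤ regret μ T ℓ I iStar

/-- `E[∑_t max_{i : Δ i = 0} E^t[ℓ^t_i - ℓ^t_{iStar}]]`, where `E^t` is the conditional
expectation given the history before round `t` (the maximum over no arm is `0`). -/
def zeroGapExcess (μ : Measure Ω) (T : ℕ) (𝓗 : Filtration ℕ mΩ) (ℓ : ℕ → Ω → Fin K → ℝ)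
    (iStar : Fin K) (Δ : Fin K → ℝ) : ℝ :=
  ∫ ω, ∑ t ∈ Finset.range T,
    ⨆ i : {i : Fin K // Δ i = 0}, (μ[fun ω' => ℓ t ω' i.1 - ℓ t ω' iStar | 𝓗 t]) ω ∂μ

end Protocol

/-- The smallest nonzero gap (`0` if there is none). -/
def gapMin {K : ℕ} (Δ : Fin K → ℝ) : ℝ :=
  ⨅ i : {i : Fin K // Δ i ≠ 0}, Δ i.1

/-- `|U| / Δ_min + ∑_{i ∈ V} 1 / Δ_i`, with `U` the arms of zero gap and `V` the others. If `V` is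
empty, `Δ_min` is a minimum over no arm and the value is `0`. -/
def instanceComplexity {K : ℕ} (Δ : Fin K → ℝ) : ℝ :=
  ((Finset.univ.filter fun i => Δ i = 0).card : ℝ) / gapMin Δ
    + ∑ i ∈ Finset.univ.filter (fun i => Δ i ≠ 0), 1 / Δ i

end BOBW

end

noncomputable section
namespace BOBW

/-! ### Tangent-line inequalities for real powers -/

section Rpow

/-! The learner is compared not with a single arm but with a shadow player, who runs the same FTRL
with the learner's own loss estimates and learning rates, restricted to the arms of a set U
(`subDist`). With U the arms of zero gap, the shadow player's distribution is determined by the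
history, so its loss exceeds that of `iStar` by at most D in expectation
(`integral_sum_mul_loss_sub_le`). No single arm of U is singled out, so uniqueness of the optimal
arm plays no role.

Let Φ and Φ_U be the minima of the regularized objective over all arms and over U. The increments of
Φ - Φ_U telescope. They split the learner's excess over the shadow player into a difference of
stability terms (`stab`), a difference of learning-rate penalties (`pen`) and a boundary term
(`valGap_sub_le`). The point of taking differences is that the contributions of arms in U nearly
cancel.

Stability: the derivative of the difference in the loss increment of an arm a in U is the drop of
p_a minus the drop of the shadow probability q_a. Both are governed by the same convex function, the
inverse of the regularizer's slope. With w the inverse curvatures at p, the excess drop is at most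
the fraction w_a / ∑_U w of the mass flowing to arms outside U (`sum_icurv_mul_drop_le`). So arms
outside U control it.

Penalty: the shadow player gives every arm of U at least the learner's mass, so on U only the change
of p_i^β under the rate update survives (`pen_le`). The log-barrier makes this change, hence the
penalty, second order (`penalty_second_order`).

Write m = max(p, 1/T), S for the sum under the root in the rate, y = m^(1-2β) / (S + m^(1-2β)) and
κ² = 1/(β(1-β)). The rate is tuned so that, outside U, stability and penalty are both O(κ√(m y)),
while ∑_t y is O(log T) by telescoping logarithms. AM-GM with weight η Δ_i turns κ√(m y) into η Δ_i
m + κ² y / (η Δ_i) up to constants. Summed, this is 2η ∑ pΔ plus O(κ² 𝔾 log T / η) and lower-order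
terms. Self-bounding replaces ∑ pΔ by the regret plus C, and with η ≤ 1/4 the regret is absorbed
(`regret_le_of_gap`).

The worst-case bound takes U = {iStar} and constant weights. For β = 1/2 one has y = 1/(t+2)
exactly, and weights depending on the round remove the logarithm. -/

theorem rpow_le_tangent {β x y : ℝ} (h0 : 0 ≤ β) (h1 : β ≤ 1) (hx : 0 < x) (hy : 0 ≤ y) :
    y ^ β ≤ x ^ β + β * x ^ (β - 1) * (y - x) := by
  have h := rpow_one_add_le_one_add_mul_self (s := y / x - 1)
    (by have : 0 ≤ y / x := by positivity
        linarith) h0 h1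
  have e : y ^ β = x ^ β * (1 + (y / x - 1)) ^ β := by
    rw [← Real.mul_rpow hx.le (by rw [add_sub_cancel]; positivity)]
    congr 1
    field_simp
    ring
  have e2 : x ^ (β - 1) = x ^ β / x := Real.rpow_sub_one hx.ne' β
  rw [e, e2]
  calc x ^ β * (1 + (y / x - 1)) ^ β ≤ x ^ β * (1 + β * (y / x - 1)) := by gcongr
    _ = _ := by field_simp

/-- For a nonpositive exponent, write the power as an exponential of a logarithm and use exp u ≥ 1 +
u and log v ≤ v - 1. -/
theorem tangent_le_rpow_of_nonpos {q x y : ℝ} (hq : q ≤ 0) (hx : 0 < x) (hy : 0 < y) :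
    x ^ q + q * x ^ (q - 1) * (y - x) ≤ y ^ q := by
  have e : y ^ q = x ^ q * (y / x) ^ q := by
    rw [← Real.mul_rpow hx.le (by positivity)]
    congr 1
    field_simp
  have e2 : x ^ (q - 1) = x ^ q / x := Real.rpow_sub_one hx.ne' q
  have h : 1 + q * (y / x - 1) ≤ (y / x) ^ q := by
    rw [Real.rpow_def_of_pos (by positivity)]
    have h1 := Real.add_one_le_exp (Real.log (y / x) * q)
    have h2 := Real.log_le_sub_one_of_pos (show 0 < y / x by positivity)
    nlinarith
  rw [e, e2]
  calc x ^ q + q * (x ^ q / x) * (y - x) = x ^ q * (1 + q * (y / x - 1)) := by field_simp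
    _ ≤ _ := by gcongr

end Rpow

/-! ### One coordinate of the regularizer: slope, curvature and inverse slope -/

/-- The parameters of a one-dimensional regularizer `-C log x - γ x ^ β / (1 - β)`; the learning
rate `γ` is kept apart. -/
structure Hybrid where
  C : ℝ
  β : ℝ
  C_pos : 0 < C
  β_pos : 0 < β
  β_lt : β < 1

namespace Hybrid

variable (P : Hybrid)

/-- The regularizer of one coordinate. -/
def reg (γ x : ℝ) : ℝ := -P.C * Real.log x - 1 / (1 - P.β) * (γ * x ^ P.β)

/-- Minus the derivative of the regularizer of one coordinate. -/
def slope (γ x : ℝ) : ℝ := P.C / x + P.β / (1 - P.β) * γ * x ^ (P.β - 1)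

/-- The second derivative of the regularizer of one coordinate. -/
def curv (γ x : ℝ) : ℝ := P.C / x ^ 2 + P.β * γ * x ^ (P.β - 2)

/-- The inverse of `slope` on the positive reals (`0` elsewhere). -/
def inv (γ y : ℝ) : ℝ :=
  open Classical in if h : ∃ x, 0 < x ∧ P.slope γ x = y then h.choose else 0

theorem one_sub_pos : 0 < 1 - P.β := by linarith [P.β_lt]

theorem ratio_pos : 0 < P.β / (1 - P.β) := div_pos P.β_pos P.one_sub_pos

variable {P} {γ x y : ℝ}

theorem slope_pos (hγ : 0 ≤ γ) (hx : 0 < x) : 0 < P.slope γ x := by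
  have := P.ratio_pos
  have := P.C_pos
  unfold slope; positivity

theorem curv_pos (hγ : 0 ≤ γ) (hx : 0 < x) : 0 < P.curv γ x := by
  have := P.β_pos
  have := P.C_pos
  unfold curv; positivity

theorem slope_lt (hγ : 0 ≤ γ) (hx : 0 < x) (hxy : x < y) : P.slope γ y < P.slope γ x := by
  have := P.ratio_pos
  have := P.C_pos
  unfold slope
  have h1 : P.C / y < P.C / x := by gcongr
  have h2 : y ^ (P.β - 1) ≤ x ^ (P.β - 1) :=
    Real.rpow_le_rpow_of_nonpos hx hxy.le (by linarith [P.β_lt])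
  have h3 : P.β / (1 - P.β) * γ * y ^ (P.β - 1) ≤ P.β / (1 - P.β) * γ * x ^ (P.β - 1) := by gcongr
  linarith

theorem slope_le_iff (hγ : 0 ≤ γ) (hx : 0 < x) (hy : 0 < y) :
    P.slope γ x ≤ P.slope γ y ↔ y ≤ x := by
  constructor
  · intro h
    by_contra! hlt
    exact absurd (slope_lt hγ hx hlt) (not_lt.2 h)
  · intro h
    rcases h.eq_or_lt with rfl | h
    · rfl
    · exact (slope_lt hγ hy h).le

theorem slope_lt_iff (hγ : 0 ≤ γ) (hx : 0 < x) (hy : 0 < y) :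
    P.slope γ x < P.slope γ y ↔ y < x := by
  rw [← not_le, ← not_le, slope_le_iff hγ hy hx]

theorem curv_anti (hγ : 0 ≤ γ) (hx : 0 < x) (hxy : x ≤ y) : P.curv γ y ≤ P.curv γ x := by
  have := P.β_pos
  have := P.C_pos
  unfold curv
  have h2 : y ^ (P.β - 2) ≤ x ^ (P.β - 2) :=
    Real.rpow_le_rpow_of_nonpos hx hxy (by linarith [P.β_lt])
  gcongr

/-- Convexity of the slope, checked separately for the barrier and the Tsallis part. It yields the
supporting lines of `inv`, from which all first-order estimates of probabilities follow. -/
theorem slope_tangent (hγ : 0 ≤ γ) (hx : 0 < x) (hy : 0 < y) :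
    P.slope γ x - P.curv γ x * (y - x) ≤ P.slope γ y := by
  have := P.ratio_pos
  have hC := P.C_pos
  have h0 := P.one_sub_pos
  unfold slope curv
  have h1 : P.C / x - P.C / x ^ 2 * (y - x) ≤ P.C / y := by
    have : P.C / y - (P.C / x - P.C / x ^ 2 * (y - x)) = P.C * (y - x) ^ 2 / (x ^ 2 * y) := by
      field_simp
      ring
    have : 0 ≤ P.C * (y - x) ^ 2 / (x ^ 2 * y) := by positivity
    linarith
  have h2 := tangent_le_rpow_of_nonpos (q := P.β - 1) (by linarith) hx hy
  have h3 : P.β / (1 - P.β) * γ * (x ^ (P.β - 1) + (P.β - 1) * x ^ (P.β - 1 - 1) * (y - x))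
      ≤ P.β / (1 - P.β) * γ * y ^ (P.β - 1) := by gcongr
  have e : P.β - 1 - 1 = P.β - 2 := by ring
  rw [e] at h3
  have e3 : P.β / (1 - P.β) * γ * (x ^ (P.β - 1) + (P.β - 1) * x ^ (P.β - 2) * (y - x))
     = P.β / (1 - P.β) * γ * x ^ (P.β - 1) - P.β * γ * x ^ (P.β - 2) * (y - x) := by
    field_simp
    ring
  linarith

theorem reg_tangent (hγ : 0 ≤ γ) (hx : 0 < x) (hy : 0 < y) :
    P.reg γ x - P.slope γ x * (y - x) ≤ P.reg γ y := by
  have hC := P.C_pos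
  have h0 := P.one_sub_pos
  unfold reg slope
  have h1 := Real.log_le_sub_one_of_pos (show 0 < y / x by positivity)
  rw [Real.log_div hy.ne' hx.ne'] at h1
  have h1' : P.C * (Real.log y - Real.log x) ≤ P.C * (y / x - 1) := by gcongr
  have h2 := rpow_le_tangent P.β_pos.le P.β_lt.le hx hy.le
  have h3 : 1 / (1 - P.β) * (γ * y ^ P.β)
      ≤ 1 / (1 - P.β) * (γ * (x ^ P.β + P.β * x ^ (P.β - 1) * (y - x))) := by gcongr
  have e1 : P.C / x * (y - x) = P.C * (y / x - 1) := by field_simp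
  have e2 : 1 / (1 - P.β) * (γ * (x ^ P.β + P.β * x ^ (P.β - 1) * (y - x)))
    = 1 / (1 - P.β) * (γ * x ^ P.β) + P.β / (1 - P.β) * γ * x ^ (P.β - 1) * (y - x) := by
    field_simp
  linarith

theorem reg_tangent_lt (hγ : 0 ≤ γ) (hx : 0 < x) (hy : 0 < y) (hxy : y ≠ x) :
    P.reg γ x - P.slope γ x * (y - x) < P.reg γ y := by
  have h1 := reg_tangent (P := P) hγ hx (show 0 < (x + y) / 2 by positivity)
  have h2 := reg_tangent (P := P) hγ (show 0 < (x + y) / 2 by positivity) hy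
  rcases lt_or_gt_of_ne hxy with h | h
  · have := slope_lt (P := P) hγ (show 0 < (x + y) / 2 by positivity)
      (show (x + y) / 2 < x by linarith)
    nlinarith
  · have := slope_lt (P := P) hγ hx (show x < (x + y) / 2 by linarith)
    nlinarith

theorem continuousOn_slope : ContinuousOn (P.slope γ) (Set.Ioi 0) := by
  unfold slope
  have h : ∀ x ∈ Set.Ioi (0 : ℝ), x ≠ 0 := fun x hx => ne_of_gt hx
  refine ContinuousOn.add (continuousOn_const.div continuousOn_id h) ?_
  exact continuousOn_const.mul (continuousOn_id.rpow_const fun x hx => Or.inl (h x hx))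

/-- The barrier alone makes the slope at least y at the point C / y, and the slope tends to 0 at
infinity; the rest is the intermediate value theorem. -/
theorem exists_slope_eq (hγ : 0 ≤ γ) (hy : 0 < y) : ∃ x, 0 < x ∧ P.slope γ x = y := by
  have hC := P.C_pos
  have hr := P.ratio_pos
  have h1 : y ≤ P.slope γ (P.C / y) := by
    unfold slope
    have : P.C / (P.C / y) = y := by field_simp
    rw [this]
    have : 0 ≤ P.β / (1 - P.β) * γ * (P.C / y) ^ (P.β - 1) := by positivity
    linarith
  have ht : Filter.Tendsto (P.slope γ) Filter.atTop (nhds 0) := by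
    have t1 : Filter.Tendsto (fun x : ℝ => P.C / x) Filter.atTop (nhds 0) :=
      tendsto_const_nhds.div_atTop Filter.tendsto_id
    have t2 := (tendsto_rpow_neg_atTop P.one_sub_pos).const_mul (P.β / (1 - P.β) * γ)
    have t3 := t1.add t2
    simp only [neg_sub, mul_zero, add_zero] at t3
    exact t3
  obtain ⟨x2, hx2, hx2p⟩ := ((ht.eventually (gt_mem_nhds hy)).and
    (Filter.eventually_gt_atTop (0 : ℝ))).exists
  have hsub : Set.uIcc x2 (P.C / y) ⊆ Set.Ioi 0 := by
    intro z hz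
    have : min x2 (P.C / y) ≤ z := hz.1
    exact lt_of_lt_of_le (lt_min hx2p (by positivity)) this
  obtain ⟨x, hx, hxe⟩ := intermediate_value_uIcc ((continuousOn_slope (P := P) (γ := γ)).mono hsub)
    (Set.mem_uIcc.2 (Or.inl ⟨hx2.le, h1⟩))
  exact ⟨x, hsub hx, hxe⟩

theorem inv_pos (hγ : 0 ≤ γ) (hy : 0 < y) : 0 < P.inv γ y := by
  unfold inv
  rw [dif_pos (exists_slope_eq hγ hy)]
  exact (exists_slope_eq (P := P) hγ hy).choose_spec.1

theorem slope_inv (hγ : 0 ≤ γ) (hy : 0 < y) : P.slope γ (P.inv γ y) = y := by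
  unfold inv
  rw [dif_pos (exists_slope_eq hγ hy)]
  exact (exists_slope_eq (P := P) hγ hy).choose_spec.2

theorem inv_of_nonpos (hγ : 0 ≤ γ) (hy : y ≤ 0) : P.inv γ y = 0 := by
  unfold inv
  rw [dif_neg]
  rintro ⟨x, hx, rfl⟩
  exact absurd (slope_pos hγ hx) (not_lt.2 hy)

theorem slope_inj (hγ : 0 ≤ γ) (hx : 0 < x) (hy : 0 < y) (h : P.slope γ x = P.slope γ y) :
    x = y :=
  le_antisymm ((slope_le_iff hγ hy hx).1 h.ge) ((slope_le_iff hγ hx hy).1 h.le)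

theorem inv_slope (hγ : 0 ≤ γ) (hx : 0 < x) : P.inv γ (P.slope γ x) = x :=
  slope_inj hγ (inv_pos hγ (slope_pos hγ hx)) hx (slope_inv hγ (slope_pos hγ hx))

theorem inv_le_iff (hγ : 0 ≤ γ) (hy : 0 < y) (hx : 0 < x) :
    P.inv γ y ≤ x ↔ P.slope γ x ≤ y := by
  rw [← slope_le_iff hγ hx (inv_pos hγ hy), slope_inv hγ hy]

theorem inv_lt_iff (hγ : 0 ≤ γ) (hy : 0 < y) (hx : 0 < x) :
    P.inv γ y < x ↔ P.slope γ x < y := by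
  rw [← slope_lt_iff hγ hx (inv_pos hγ hy), slope_inv hγ hy]

theorem inv_lt (hγ : 0 ≤ γ) (hx : 0 < x) (hxy : x < y) : P.inv γ y < P.inv γ x := by
  rw [inv_lt_iff hγ (hx.trans hxy) (inv_pos hγ hx), slope_inv hγ hx]
  exact hxy

theorem inv_anti (hγ : 0 ≤ γ) (hx : 0 < x) (hxy : x ≤ y) : P.inv γ y ≤ P.inv γ x := by
  rcases hxy.eq_or_lt with rfl | h
  · rfl
  · exact (inv_lt hγ hx h).le

/-- The supporting line of the convex function `inv`. -/
theorem inv_tangent (hγ : 0 ≤ γ) (hx : 0 < x) (hy : 0 < y) :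
    P.inv γ x - (y - x) / P.curv γ (P.inv γ x) ≤ P.inv γ y := by
  have h := slope_tangent (P := P) hγ (inv_pos (P := P) hγ hx) (inv_pos (P := P) hγ hy)
  rw [slope_inv hγ hx, slope_inv hγ hy] at h
  have hk := curv_pos (P := P) hγ (inv_pos (P := P) hγ hx)
  have : (P.inv γ x - P.inv γ y) ≤ (y - x) / P.curv γ (P.inv γ x) := by
    rw [le_div_iff₀ hk]
    linarith
  linarith

theorem convexOn_inv (hγ : 0 ≤ γ) : ConvexOn ℝ (Set.Ioi 0) (P.inv γ) := by
  refine ⟨convex_Ioi 0, fun x hx y hy a b ha hb hab => ?_⟩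
  simp only [smul_eq_mul]
  have hz : 0 < a * x + b * y := by
    rcases ha.eq_or_lt with rfl | ha
    · have : b = 1 := by linarith
      subst this; simpa using hy
    · have := mul_pos ha hx
      have := mul_nonneg hb (le_of_lt hy)
      simp only [Set.mem_Ioi] at *
      linarith
  have h1 := inv_tangent (P := P) hγ hz hx
  have h2 := inv_tangent (P := P) hγ hz hy
  set z := a * x + b * y
  set w := P.curv γ (P.inv γ z)
  have e : a * (P.inv γ z - (x - z) / w) + b * (P.inv γ z - (y - z) / w) = P.inv γ z := by
    have hb' : b = 1 - a := by linarith
    have hz' : z = a * x + b * y := rfl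
    rw [hz', hb']
    ring
  rw [← e]
  gcongr

/-- Decreasing differences of the convex function `inv`. -/
theorem inv_sub_anti (hγ : 0 ≤ γ) {u : ℝ} (hx : 0 < x) (hxy : x ≤ y) (hu : 0 ≤ u) :
    P.inv γ y - P.inv γ (y + u) ≤ P.inv γ x - P.inv γ (x + u) := by
  rcases eq_or_lt_of_le (show x ≤ y + u by linarith) with h | h
  · have h1 : y = x := by linarith
    rw [h1]
  have hc := (convexOn_inv (P := P) hγ).2
  have hyu : y + u ∈ Set.Ioi (0 : ℝ) := hx.trans h
  have hd : 0 < y + u - x := by linarith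
  -- The points y and x + u are convex combinations of x and y + u with interchanged weights; adding
  -- the two convexity inequalities gives the claim.
  have h1 := hc hx hyu (a := u / (y + u - x)) (b := (y - x) / (y + u - x))
    (by positivity) (div_nonneg (by linarith) hd.le) (by field_simp; ring)
  have h2 := hc hx hyu (a := (y - x) / (y + u - x)) (b := u / (y + u - x))
    (div_nonneg (by linarith) hd.le) (by positivity) (by field_simp; ring)
  simp only [smul_eq_mul] at h1 h2
  have e1 : u / (y + u - x) * x + (y - x) / (y + u - x) * (y + u) = y := by field_simp; ring
  have e2 : (y - x) / (y + u - x) * x + u / (y + u - x) * (y + u) = x + u := by field_simp; ring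
  rw [e1] at h1
  rw [e2] at h2
  have e3 : u / (y + u - x) + (y - x) / (y + u - x) = 1 := by field_simp; ring
  have := congrArg (fun r => r * P.inv γ x) e3
  have := congrArg (fun r => r * P.inv γ (y + u)) e3
  linarith

theorem continuousOn_inv (hγ : 0 ≤ γ) : ContinuousOn (P.inv γ) (Set.Ioi 0) := by
  exact (convexOn_inv hγ).continuousOn isOpen_Ioi

theorem slope_mono_rate {γ' : ℝ} (h : γ ≤ γ') (hx : 0 < x) : P.slope γ x ≤ P.slope γ' x := by
  have := P.ratio_pos
  unfold slope
  gcongr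

theorem inv_mono_rate {γ' : ℝ} (hγ : 0 ≤ γ) (h : γ ≤ γ') (hy : 0 < y) :
    P.inv γ y ≤ P.inv γ' y := by
  have hγ' := hγ.trans h
  have h1 := inv_pos (P := P) hγ' hy
  rw [inv_le_iff hγ hy h1]
  exact (slope_mono_rate h h1).trans (slope_inv hγ' hy).le

/-- The inverse is defined by choice, so measurability is read off its sublevel sets, which are
described through the explicit `slope`. -/
theorem measurable_inv {Ω : Type*} {m : MeasurableSpace Ω} {g f : Ω → ℝ}
    (hg : Measurable g) (hg0 : ∀ ω, 0 ≤ g ω) (hf : Measurable f) :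
    Measurable fun ω => P.inv (g ω) (f ω) := by
  refine measurable_of_Iio fun x => ?_
  rcases le_or_gt x 0 with hx | hx
  · convert MeasurableSet.empty
    ext ω
    simp only [Set.mem_preimage, Set.mem_Iio, Set.mem_empty_iff_false, iff_false, not_lt]
    refine hx.trans ?_
    rcases le_or_gt (f ω) 0 with h | h
    · rw [inv_of_nonpos (hg0 ω) h]
    · exact (inv_pos (hg0 ω) h).le
  · have : (fun ω => P.inv (g ω) (f ω)) ⁻¹' Set.Iio x
        = {ω | f ω ≤ 0} ∪ {ω | P.slope (g ω) x < f ω} := by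
      ext ω
      simp only [Set.mem_preimage, Set.mem_Iio, Set.mem_union, Set.mem_ofPred_eq]
      rcases le_or_gt (f ω) 0 with h | h
      · simp [inv_of_nonpos (hg0 ω) h, hx, h]
      · rw [inv_lt_iff (hg0 ω) h hx]
        simp [not_le.2 h]
    rw [this]
    have hs : Measurable fun ω => P.slope (g ω) x := by
      unfold slope
      fun_prop
    exact (measurableSet_le hf measurable_const).union (measurableSet_lt hs hf)

end Hybrid

/-! ### Minimizers on a given support and their Lagrange multipliers -/

namespace Hybrid

variable {ι : Type*} (P : Hybrid) (W : Finset ι) (L γ : ι → ℝ)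

/-- `l` is the Lagrange multiplier of the minimization over the distributions supported on `W`. -/
def IsLevel (l : ℝ) : Prop :=
  (∀ j ∈ W, 0 < L j + l) ∧ ∑ j ∈ W, P.inv (γ j) (L j + l) = 1

/-- The Lagrange multiplier of the minimization over the distributions supported on `W`. -/
def level : ℝ :=
  open Classical in if h : ∃ l, P.IsLevel W L γ l then h.choose else 0

/-- The minimizer of the regularized linear loss over the distributions supported on `W`. -/
def pt (i : ι) : ℝ :=
  open Classical in if i ∈ W then P.inv (γ i) (L i + P.level W L γ) else 0

/-- The regularized linear loss on the coordinates in `W`. -/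
def obj (x : ι → ℝ) : ℝ := ∑ i ∈ W, (x i * L i + P.reg (γ i) (x i))

/-- The minimal regularized linear loss over the distributions supported on `W`. -/
def val : ℝ := P.obj W L γ (P.pt W L γ)

variable {P W L γ}

theorem sum_inv_anti (hγ : ∀ i, 0 ≤ γ i) {l l' : ℝ} (hl : ∀ j ∈ W, 0 < L j + l) (h : l ≤ l') :
    ∑ j ∈ W, P.inv (γ j) (L j + l') ≤ ∑ j ∈ W, P.inv (γ j) (L j + l) :=
  Finset.sum_le_sum fun j hj => inv_anti (hγ j) (hl j hj) (by linarith)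

/-- At `l1` the arm of smallest loss alone already has mass 1; at `l2` every arm has mass at most
1/|W|. The total mass is continuous in between. -/
theorem exists_isLevel (hγ : ∀ i, 0 ≤ γ i) (hW : W.Nonempty) : ∃ l, P.IsLevel W L γ l := by
  obtain ⟨j0, hj0, hmin⟩ := Finset.exists_min_image W L hW
  obtain ⟨j1, hj1, hmax⟩ := Finset.exists_max_image W
    (fun j => P.slope (γ j) (1 / W.card) - L j) hW
  set l1 := P.slope (γ j0) 1 - L j0
  set l2 := P.slope (γ j1) (1 / W.card) - L j1
  have hs1 : 0 < P.slope (γ j0) 1 := slope_pos (hγ j0) one_pos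
  have p1 : ∀ j ∈ W, 0 < L j + l1 := fun j hj => by
    have := hmin j hj
    simp only [l1]; linarith
  have p2 : ∀ j ∈ W, P.slope (γ j) (1 / W.card) ≤ L j + l2 := fun j hj => by
    have := hmax j hj
    simp only [l2]; linarith
  have p2' : ∀ j ∈ W, 0 < L j + l2 := fun j hj =>
    (slope_pos (hγ j) (by positivity)).trans_le (p2 j hj)
  have f1 : 1 ≤ ∑ j ∈ W, P.inv (γ j) (L j + l1) := by
    have h0 : P.inv (γ j0) (L j0 + l1) = 1 := by
      simp only [l1, add_sub_cancel]
      exact inv_slope (hγ j0) one_pos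
    rw [← h0]
    exact Finset.single_le_sum (f := fun j => P.inv (γ j) (L j + l1))
      (fun j hj => (inv_pos (hγ j) (p1 j hj)).le) hj0
  have f2 : ∑ j ∈ W, P.inv (γ j) (L j + l2) ≤ 1 := by
    calc _ ≤ ∑ j ∈ W, (1 / W.card : ℝ) := Finset.sum_le_sum fun j hj =>
          (inv_le_iff (hγ j) (p2' j hj) (by positivity)).2 (p2 j hj)
      _ = 1 := by rw [Finset.sum_const, nsmul_eq_mul]; field_simp
  have hpos : ∀ l ∈ Set.uIcc l2 l1, ∀ j ∈ W, 0 < L j + l := fun l hl j hj => by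
    have h : min l2 l1 ≤ l := hl.1
    rcases min_le_iff.1 h with h | h
    · linarith [p2' j hj]
    · linarith [p1 j hj]
  have hc : ContinuousOn (fun l => ∑ j ∈ W, P.inv (γ j) (L j + l)) (Set.uIcc l2 l1) := by
    refine continuousOn_finsetSum _ fun j hj => ?_
    exact (continuousOn_inv (hγ j)).comp (by fun_prop) fun l hl => hpos l hl j hj
  obtain ⟨l, hl, he⟩ := intermediate_value_uIcc hc (Set.mem_uIcc.2 (Or.inl ⟨f2, f1⟩))
  exact ⟨l, hpos l hl, he⟩

theorem isLevel_level (hγ : ∀ i, 0 ≤ γ i) (hW : W.Nonempty) :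
    P.IsLevel W L γ (P.level W L γ) := by
  unfold level
  rw [dif_pos (exists_isLevel hγ hW)]
  exact (exists_isLevel (P := P) hγ hW).choose_spec

theorem level_pos (hγ : ∀ i, 0 ≤ γ i) (hW : W.Nonempty) {i : ι} (hi : i ∈ W) :
    0 < L i + P.level W L γ :=
  (isLevel_level hγ hW).1 i hi

theorem pt_of_mem {i : ι} (hi : i ∈ W) :
    P.pt W L γ i = P.inv (γ i) (L i + P.level W L γ) := if_pos hi

theorem pt_of_notMem {i : ι} (hi : i ∉ W) : P.pt W L γ i = 0 := if_neg hi

theorem pt_pos (hγ : ∀ i, 0 ≤ γ i) {i : ι} (hi : i ∈ W) : 0 < P.pt W L γ i := by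
  rw [pt_of_mem hi]
  exact inv_pos (hγ i) (level_pos hγ ⟨i, hi⟩ hi)

theorem pt_nonneg (hγ : ∀ i, 0 ≤ γ i) (i : ι) : 0 ≤ P.pt W L γ i := by
  by_cases hi : i ∈ W
  · exact (pt_pos hγ hi).le
  · rw [pt_of_notMem hi]

theorem slope_pt (hγ : ∀ i, 0 ≤ γ i) {i : ι} (hi : i ∈ W) :
    P.slope (γ i) (P.pt W L γ i) = L i + P.level W L γ := by
  rw [pt_of_mem hi]
  exact slope_inv (hγ i) (level_pos hγ ⟨i, hi⟩ hi)

theorem sum_pt (hγ : ∀ i, 0 ≤ γ i) (hW : W.Nonempty) : ∑ i ∈ W, P.pt W L γ i = 1 := by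
  rw [Finset.sum_congr rfl fun i hi => pt_of_mem hi]
  exact (isLevel_level hγ hW).2

theorem pt_le_one (hγ : ∀ i, 0 ≤ γ i) (i : ι) : P.pt W L γ i ≤ 1 := by
  by_cases hi : i ∈ W
  · rw [← sum_pt (P := P) (L := L) hγ ⟨i, hi⟩]
    exact Finset.single_le_sum (f := P.pt W L γ) (fun j _ => pt_nonneg hγ j) hi
  · rw [pt_of_notMem hi]; exact zero_le_one

/-- A criterion for a lower bound on the multiplier. -/
theorem le_level (hγ : ∀ i, 0 ≤ γ i) (hW : W.Nonempty) {l : ℝ} 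
    (h : (∀ j ∈ W, 0 < L j + l) → 1 ≤ ∑ j ∈ W, P.inv (γ j) (L j + l)) :
    l ≤ P.level W L γ := by
  obtain ⟨h1, h2⟩ := isLevel_level (P := P) (L := L) hγ hW
  by_contra! hlt
  have hp : ∀ j ∈ W, 0 < L j + l := fun j hj => by linarith [h1 j hj]
  have := h hp
  have : ∑ j ∈ W, P.inv (γ j) (L j + l) < ∑ j ∈ W, P.inv (γ j) (L j + P.level W L γ) :=
    Finset.sum_lt_sum_of_nonempty hW fun j hj => inv_lt (hγ j) (h1 j hj) (by linarith)
  linarith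

/-- A criterion for an upper bound on the multiplier. -/
theorem level_le (hγ : ∀ i, 0 ≤ γ i) (hW : W.Nonempty) {l : ℝ} (hl : ∀ j ∈ W, 0 < L j + l)
    (h : ∑ j ∈ W, P.inv (γ j) (L j + l) ≤ 1) :
    P.level W L γ ≤ l := by
  obtain ⟨h1, h2⟩ := isLevel_level (P := P) (L := L) hγ hW
  by_contra! hlt
  have : ∑ j ∈ W, P.inv (γ j) (L j + P.level W L γ) < ∑ j ∈ W, P.inv (γ j) (L j + l) :=
    Finset.sum_lt_sum_of_nonempty hW fun j hj => inv_lt (hγ j) (hl j hj) (by linarith)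
  linarith

/-- Sum the tangent inequalities of the regularizer at the minimizer. There the slope is the loss
plus a multiplier common to all arms, and the multiplier cancels because both points have mass 1. -/
theorem val_le_obj (hγ : ∀ i, 0 ≤ γ i) (hW : W.Nonempty) {y : ι → ℝ} (hy : ∀ i ∈ W, 0 < y i)
    (hs : ∑ i ∈ W, y i = 1) : P.val W L γ ≤ P.obj W L γ y := by
  have h : ∀ i ∈ W, (P.pt W L γ i * L i + P.reg (γ i) (P.pt W L γ i))
      - P.level W L γ * (y i - P.pt W L γ i) ≤ y i * L i + P.reg (γ i) (y i) := fun i hi => by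
    have := reg_tangent (P := P) (hγ i) (pt_pos hγ hi) (hy i hi) (x := P.pt W L γ i)
    rw [slope_pt hγ hi] at this
    linarith
  have h2 := Finset.sum_le_sum h
  rw [Finset.sum_sub_distrib, ← Finset.mul_sum, Finset.sum_sub_distrib, hs, sum_pt hγ hW] at h2
  unfold val obj
  linarith

/-- Strict convexity. It identifies the learner's distribution, given only as some minimizer, with
the explicit `pt`. -/
theorem eq_pt_of_obj_le (hγ : ∀ i, 0 ≤ γ i) (hW : W.Nonempty) {y : ι → ℝ}
    (hy : ∀ i ∈ W, 0 < y i) (hs : ∑ i ∈ W, y i = 1) (hle : P.obj W L γ y ≤ P.val W L γ)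
    {i : ι} (hi : i ∈ W) : y i = P.pt W L γ i := by
  by_contra hne
  have h : ∀ i ∈ W, (P.pt W L γ i * L i + P.reg (γ i) (P.pt W L γ i))
      - P.level W L γ * (y i - P.pt W L γ i) ≤ y i * L i + P.reg (γ i) (y i) := fun i hi => by
    have := reg_tangent (P := P) (hγ i) (pt_pos hγ hi) (hy i hi) (x := P.pt W L γ i)
    rw [slope_pt hγ hi] at this
    linarith
  have h2 := Finset.sum_lt_sum h ⟨i, hi, by
    have := reg_tangent_lt (P := P) (hγ i) (pt_pos hγ hi) (hy i hi) hne
    rw [slope_pt hγ hi] at this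
    linarith⟩
  rw [Finset.sum_sub_distrib, ← Finset.mul_sum, Finset.sum_sub_distrib, hs, sum_pt hγ hW] at h2
  unfold val obj at hle
  linarith

/-- Shrinking the support raises the remaining coordinates. -/
theorem pt_le_pt_of_subset (hγ : ∀ i, 0 ≤ γ i) {U : Finset ι} (hUW : U ⊆ W) {i : ι}
    (hi : i ∈ U) : P.level U L γ ≤ P.level W L γ ∧ P.pt W L γ i ≤ P.pt U L γ i := by
  have hU : U.Nonempty := ⟨i, hi⟩
  have hW : W.Nonempty := hU.mono hUW
  have hl : P.level U L γ ≤ P.level W L γ := by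
    refine level_le hγ hU (fun j hj => level_pos hγ hW (hUW hj)) ?_
    rw [← sum_pt (P := P) (L := L) hγ hW, Finset.sum_congr rfl fun i hi => pt_of_mem (hUW hi) |>.symm]
    exact Finset.sum_le_sum_of_subset_of_nonneg hUW fun j _ _ => pt_nonneg hγ j
  refine ⟨hl, ?_⟩
  rw [pt_of_mem hi, pt_of_mem (hUW hi)]
  exact inv_anti (hγ i) (level_pos hγ hU hi) (by linarith)

/-- Raising the learning rates raises the multiplier. -/
theorem level_mono_rate {γ' : ι → ℝ} (hγ : ∀ i, 0 ≤ γ i) (h : ∀ i, γ i ≤ γ' i)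
    (hW : W.Nonempty) : P.level W L γ ≤ P.level W L γ' := by
  refine le_level (fun i => (hγ i).trans (h i)) hW fun _ => ?_
  rw [← (isLevel_level (P := P) (L := L) hγ hW).2]
  exact Finset.sum_le_sum fun j hj => inv_mono_rate (hγ j) (h j) (level_pos hγ hW hj)

/-- Again the sublevel sets are explicit: by monotonicity the multiplier is below x exactly when the
mass at x is defined and less than 1. This is what makes the shadow player measurable with respect
to the history. -/
theorem measurable_level {Ω : Type*} {m : MeasurableSpace Ω} {L γ : Ω → ι → ℝ}
    (hγ : ∀ ω i, 0 ≤ γ ω i) (hW : W.Nonempty) (mL : ∀ i, Measurable fun ω => L ω i)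
    (mγ : ∀ i, Measurable fun ω => γ ω i) : Measurable fun ω => P.level W (L ω) (γ ω) := by
  refine measurable_of_Iio fun x => ?_
  have : (fun ω => P.level W (L ω) (γ ω)) ⁻¹' Set.Iio x
      = (⋂ j ∈ W, {ω | 0 < L ω j + x}) ∩ {ω | ∑ j ∈ W, P.inv (γ ω j) (L ω j + x) < 1} := by
    ext ω
    simp only [Set.mem_preimage, Set.mem_Iio, Set.mem_inter_iff, Set.mem_iInter, Set.mem_ofPred_eq]
    constructor
    · intro h
      obtain ⟨h1, h2⟩ := isLevel_level (P := P) (L := L ω) (hγ ω) hW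
      refine ⟨fun j hj => by linarith [h1 j hj], ?_⟩
      rw [← h2]
      exact Finset.sum_lt_sum_of_nonempty hW fun j hj =>
        inv_lt (hγ ω j) (h1 j hj) (by linarith)
    · rintro ⟨h1, h2⟩
      by_contra! hle
      have := sum_inv_anti (P := P) (hγ ω) h1 hle
      rw [(isLevel_level (P := P) (L := L ω) (hγ ω) hW).2] at this
      linarith
  rw [this]
  refine MeasurableSet.inter (W.measurableSet_biInter fun j _ => ?_) ?_
  · exact measurableSet_lt measurable_const ((mL j).add_const x)
  · refine measurableSet_lt (Finset.measurable_sum _ fun j _ => ?_) measurable_const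
    exact measurable_inv (mγ j) (fun ω => hγ ω j) ((mL j).add_const x)

theorem measurable_pt {Ω : Type*} {m : MeasurableSpace Ω} {L γ : Ω → ι → ℝ}
    (hγ : ∀ ω i, 0 ≤ γ ω i) (hW : W.Nonempty) (mL : ∀ i, Measurable fun ω => L ω i)
    (mγ : ∀ i, Measurable fun ω => γ ω i) (i : ι) :
    Measurable fun ω => P.pt W (L ω) (γ ω) i := by
  by_cases hi : i ∈ W
  · simp only [pt_of_mem hi]
    exact measurable_inv (mγ i) (fun ω => hγ ω i)
      ((mL i).add (measurable_level hγ hW mL mγ))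
  · simp only [pt_of_notMem hi]
    exact measurable_const

end Hybrid

/-! ### Effect of raising the loss of one arm -/

/-- Add `s` to the coordinate `a`. -/
def shift {ι : Type*} [DecidableEq ι] (L : ι → ℝ) (a : ι) (s : ℝ) (i : ι) : ℝ :=
  L i + if a = i then s else 0

section Shift
variable {ι : Type*} [DecidableEq ι] {L : ι → ℝ} {a : ι} {s s' : ℝ}

theorem shift_self : shift L a s a = L a + s := by simp [shift]

theorem shift_of_ne {i : ι} (h : i ≠ a) : shift L a s i = L i := by simp [shift, h.symm]

theorem shift_zero : shift L a 0 = L := by funext i; simp [shift]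

theorem shift_shift : shift (shift L a s) a s' = shift L a (s + s') := by
  funext i
  by_cases h : a = i <;> simp [shift, h, add_assoc]

end Shift

namespace Hybrid

variable {ι : Type*} [DecidableEq ι] {P : Hybrid} {W U : Finset ι} {L γ : ι → ℝ} {a : ι} {s : ℝ}

theorem obj_shift {y : ι → ℝ} (hy : a ∉ W → y a = 0) :
    P.obj W (shift L a s) γ y = P.obj W L γ y + s * y a := by
  unfold obj
  have : ∀ i ∈ W, y i * shift L a s i + P.reg (γ i) (y i)
      = (y i * L i + P.reg (γ i) (y i)) + if a = i then s * y a else 0 := fun i _ => by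
    unfold shift
    split_ifs with h
    · subst h; ring
    · ring
  rw [Finset.sum_congr rfl this, Finset.sum_add_distrib, Finset.sum_ite_eq]
  split_ifs with h
  · rfl
  · rw [hy h]; ring

/-- The minimizer is a supergradient of the concave function L ↦ `val`: test the old minimizer in
the new objective. Exchanging the roles of old and new gives the opposite bound `val_le_val_shift`.
-/
theorem val_shift_le (hγ : ∀ i, 0 ≤ γ i) (hW : W.Nonempty) :
    P.val W (shift L a s) γ ≤ P.val W L γ + s * P.pt W L γ a := by
  have := val_le_obj (P := P) (L := shift L a s) hγ hW (y := P.pt W L γ)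
    (fun i hi => pt_pos hγ hi) (sum_pt hγ hW)
  rwa [obj_shift fun h => pt_of_notMem h] at this

theorem val_le_val_shift (hγ : ∀ i, 0 ≤ γ i) (hW : W.Nonempty) :
    P.val W L γ + s * P.pt W (shift L a s) γ a ≤ P.val W (shift L a s) γ := by
  have := val_shift_le (P := P) (L := shift L a s) (a := a) (s := -s) hγ hW
  rw [shift_shift, add_neg_cancel, shift_zero] at this
  linarith

theorem level_shift_le (hγ : ∀ i, 0 ≤ γ i) (hW : W.Nonempty) (hs : 0 ≤ s) :
    P.level W (shift L a s) γ ≤ P.level W L γ := by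
  have hle : ∀ j, L j ≤ shift L a s j := fun j => by
    unfold shift; split_ifs <;> linarith
  have hp : ∀ j ∈ W, 0 < L j + P.level W L γ := fun j hj => level_pos hγ hW hj
  refine level_le hγ hW (fun j hj => by linarith [hle j, hp j hj]) ?_
  rw [← (isLevel_level (P := P) (L := L) hγ hW).2]
  exact Finset.sum_le_sum fun j hj => inv_anti (hγ j) (hp j hj) (by linarith [hle j])

theorem le_level_shift (hγ : ∀ i, 0 ≤ γ i) (hW : W.Nonempty) (hs : 0 ≤ s) :
    P.level W L γ - s ≤ P.level W (shift L a s) γ := by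
  have hle : ∀ j, shift L a s j ≤ L j + s := fun j => by
    unfold shift; split_ifs <;> linarith
  refine le_level hγ hW fun h => ?_
  rw [← (isLevel_level (P := P) (L := L) hγ hW).2]
  exact Finset.sum_le_sum fun j hj => inv_anti (hγ j) (h j hj) (by linarith [hle j])

theorem pt_shift_self_le (hγ : ∀ i, 0 ≤ γ i) (hs : 0 ≤ s) :
    P.pt W (shift L a s) γ a ≤ P.pt W L γ a := by
  by_cases ha : a ∈ W
  · have hW : W.Nonempty := ⟨a, ha⟩
    rw [pt_of_mem ha, pt_of_mem ha, shift_self]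
    exact inv_anti (hγ a) (level_pos hγ hW ha)
      (by linarith [le_level_shift (P := P) (L := L) (a := a) hγ hW hs])
  · rw [pt_of_notMem ha, pt_of_notMem ha]

theorem pt_le_pt_shift (hγ : ∀ i, 0 ≤ γ i) (hs : 0 ≤ s) {j : ι} (hj : j ≠ a) :
    P.pt W L γ j ≤ P.pt W (shift L a s) γ j := by
  by_cases hjW : j ∈ W
  · have hW : W.Nonempty := ⟨j, hjW⟩
    have h := level_pos (P := P) (L := shift L a s) hγ hW hjW
    rw [shift_of_ne hj] at h
    rw [pt_of_mem hjW, pt_of_mem hjW, shift_of_ne hj]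
    exact inv_anti (hγ j) h (by linarith [level_shift_le (P := P) (L := L) (a := a) hγ hW hs])
  · rw [pt_of_notMem hjW, pt_of_notMem hjW]

/-- The drop of the probability of the arm whose loss increases. -/
theorem pt_sub_pt_shift_le (hγ : ∀ i, 0 ≤ γ i) (ha : a ∈ W) :
    P.pt W L γ a - P.pt W (shift L a s) γ a
      ≤ (s - (P.level W L γ - P.level W (shift L a s) γ)) / P.curv (γ a) (P.pt W L γ a) := by
  have hW : W.Nonempty := ⟨a, ha⟩
  have hp := level_pos (P := P) (L := L) hγ hW ha
  have hp' := level_pos (P := P) (L := shift L a s) hγ hW ha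
  rw [pt_of_mem ha, pt_of_mem ha]
  rw [shift_self] at *
  have := inv_tangent (P := P) (hγ a) hp hp'
  have e : L a + s + P.level W (shift L a s) γ - (L a + P.level W L γ)
    = s - (P.level W L γ - P.level W (shift L a s) γ) := by ring
  rw [e] at this
  linarith

theorem pt_sub_pt_shift_le' (hγ : ∀ i, 0 ≤ γ i) (ha : a ∈ W) (hs : 0 ≤ s) :
    P.pt W L γ a - P.pt W (shift L a s) γ a ≤ s / P.curv (γ a) (P.pt W L γ a) := by
  refine (pt_sub_pt_shift_le hγ ha).trans ?_
  have := level_shift_le (P := P) (L := L) (a := a) hγ ⟨a, ha⟩ hs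
  have := curv_pos (P := P) (hγ a) (pt_pos (P := P) (L := L) hγ ha)
  gcongr
  linarith

/-- The rise of the probability of another arm. -/
theorem le_pt_shift_sub_pt (hγ : ∀ i, 0 ≤ γ i) {j : ι} (hjW : j ∈ W) (hj : j ≠ a) :
    (P.level W L γ - P.level W (shift L a s) γ) / P.curv (γ j) (P.pt W L γ j)
      ≤ P.pt W (shift L a s) γ j - P.pt W L γ j := by
  have hW : W.Nonempty := ⟨j, hjW⟩
  have hp := level_pos (P := P) (L := L) hγ hW hjW
  have hp' := level_pos (P := P) (L := shift L a s) hγ hW hjW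
  rw [pt_of_mem hjW, pt_of_mem hjW]
  rw [shift_of_ne hj] at *
  have := inv_tangent (P := P) (hγ j) hp hp'
  have e : L j + P.level W (shift L a s) γ - (L j + P.level W L γ)
    = - (P.level W L γ - P.level W (shift L a s) γ) := by ring
  rw [e, neg_div] at this
  linarith

/-- Both powers in the curvature have exponent at least -2, so doubling the argument costs at most a
factor 4. -/
theorem curv_two_mul_le {γ x : ℝ} (hγ : 0 ≤ γ) (hx : 0 < x) :
    P.curv γ x ≤ 4 * P.curv γ (2 * x) := by
  have hC := P.C_pos
  have hβ := P.β_pos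
  unfold curv
  have e : (2 * x) ^ (P.β - 2) = 2 ^ (P.β - 2) * x ^ (P.β - 2) :=
    Real.mul_rpow (by norm_num) hx.le
  have h2 : (1 / 4 : ℝ) ≤ 2 ^ (P.β - 2) := by
    calc (1 / 4 : ℝ) = 2 ^ (-2 : ℝ) := by
          rw [Real.rpow_neg (by norm_num)]; norm_num
      _ ≤ _ := Real.rpow_le_rpow_of_exponent_le (by norm_num) (by linarith)
  have h3 : P.β * γ * x ^ (P.β - 2) * (1 / 4) ≤ P.β * γ * x ^ (P.β - 2) * 2 ^ (P.β - 2) := by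
    gcongr
  have e4 : P.C / (2 * x) ^ 2 = P.C / x ^ 2 / 4 := by field_simp; norm_num
  rw [e, e4]
  nlinarith

/-- The barrier part of the slope is exactly halved by doubling; for the Tsallis part Bernoulli
gives 2^(β-1) ≤ 1 - (1-β)/2. The bound says how far the multiplier must fall before a probability
can double. -/
theorem half_mul_curv_le {γ x : ℝ} (hγ : 0 ≤ γ) (hx : 0 < x) :
    x * P.curv γ x / 2 ≤ P.slope γ x - P.slope γ (2 * x) := by
  have hC := P.C_pos
  have hβ := P.β_pos
  have h0 := P.one_sub_pos
  unfold curv slope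
  have e : (2 * x) ^ (P.β - 1) = 2 ^ (P.β - 1) * x ^ (P.β - 1) :=
    Real.mul_rpow (by norm_num) hx.le
  have e2 : x ^ (P.β - 2) = x ^ (P.β - 1) / x := by
    rw [← Real.rpow_sub_one hx.ne']; congr 1; ring
  have h2 : (2 : ℝ) ^ (P.β - 1) ≤ 1 - (1 - P.β) / 2 := by
    have h := rpow_one_add_le_one_add_mul_self (s := -(1 / 2 : ℝ)) (by norm_num) h0.le
      (by linarith)
    have e5 : (2 : ℝ) ^ (P.β - 1) = (1 + -(1 / 2 : ℝ)) ^ (1 - P.β) := by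
      have : (1 + -(1 / 2 : ℝ)) = 2⁻¹ := by norm_num
      rw [this, Real.inv_rpow (by norm_num), ← Real.rpow_neg (by norm_num)]
      congr 1; ring
    rw [e5]
    linarith
  have h3 : P.β / (1 - P.β) * γ * x ^ (P.β - 1) * 2 ^ (P.β - 1)
      ≤ P.β / (1 - P.β) * γ * x ^ (P.β - 1) * (1 - (1 - P.β) / 2) := by gcongr
  have e6 : P.β / (1 - P.β) * γ * x ^ (P.β - 1) * (1 - (1 - P.β) / 2)
     = P.β / (1 - P.β) * γ * x ^ (P.β - 1) - P.β * γ * x ^ (P.β - 1) / 2 := by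
    field_simp
  have e7 : x * (P.C / x ^ 2 + P.β * γ * x ^ (P.β - 2)) / 2
     = P.C / x / 2 + P.β * γ * x ^ (P.β - 1) / 2 := by
    rw [e2]; field_simp
  have e8 : P.C / (2 * x) = P.C / x / 2 := by field_simp
  rw [e7, e8, e]
  linarith

/-- An arm whose probability more than doubles has a small curvature. -/
theorem curv_lt_of_two_mul_lt (hγ : ∀ i, 0 ≤ γ i) {j : ι} (hjW : j ∈ W) (hj : j ≠ a)
    (h : 2 * P.pt W L γ j < P.pt W (shift L a s) γ j) :
    P.pt W L γ j * P.curv (γ j) (P.pt W L γ j) / 2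
      < P.level W L γ - P.level W (shift L a s) γ := by
  have hp := pt_pos (P := P) (L := L) hγ hjW
  have h1 := half_mul_curv_le (P := P) (hγ j) hp
  have h2 := slope_lt (P := P) (hγ j) (by positivity) h
  rw [slope_pt hγ hjW, shift_of_ne hj] at h2
  rw [slope_pt hγ hjW] at h1
  linarith

/-- The rise of the probability of an arm that at most doubles. -/
theorem pt_shift_sub_pt_le (hγ : ∀ i, 0 ≤ γ i) (hs : 0 ≤ s) {j : ι} (hjW : j ∈ W) (hj : j ≠ a)
    (h : P.pt W (shift L a s) γ j ≤ 2 * P.pt W L γ j) :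
    P.pt W (shift L a s) γ j - P.pt W L γ j
      ≤ 4 * (P.level W L γ - P.level W (shift L a s) γ) / P.curv (γ j) (P.pt W L γ j) := by
  have hp := pt_pos (P := P) (L := L) hγ hjW
  have hp' := pt_pos (P := P) (L := shift L a s) hγ hjW
  have h1 := slope_tangent (P := P) (hγ j) hp' hp
  rw [slope_pt hγ hjW, slope_pt hγ hjW, shift_of_ne hj] at h1
  have h2 := (curv_two_mul_le (P := P) (hγ j) hp).trans
    (mul_le_mul_of_nonneg_left (curv_anti (hγ j) hp' h) (by norm_num))
  rw [le_div_iff₀ (curv_pos (hγ j) hp)]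
  have h3 := pt_le_pt_shift (P := P) (W := W) (L := L) hγ hs hj
  nlinarith

end Hybrid
-- The drop of an arm over all arms against its drop over U
namespace Hybrid

variable {ι : Type*} {P : Hybrid} {U : Finset ι} {L γ : ι → ℝ} {a : ι} {s : ℝ}

/-- The inverse curvature at the minimizer over all distributions. -/
def icurv (P : Hybrid) (γ x : ι → ℝ) (i : ι) : ℝ := 1 / P.curv (γ i) (x i)

theorem icurv_pos (hγ : ∀ i, 0 ≤ γ i) {x : ι → ℝ} (hx : ∀ i, 0 < x i) (i : ι) :
    0 < P.icurv γ x i := one_div_pos.2 (curv_pos (hγ i) (hx i))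

theorem univ_pt_pos [Fintype ι] (hγ : ∀ i, 0 ≤ γ i) (i : ι) : 0 < P.pt Finset.univ L γ i :=
  pt_pos hγ (Finset.mem_univ i)

theorem sum_shift_sub [DecidableEq ι] (hγ : ∀ i, 0 ≤ γ i) {W : Finset ι} (ha : a ∈ W) :
    P.pt W L γ a - P.pt W (shift L a s) γ a
      = ∑ j ∈ W.erase a, (P.pt W (shift L a s) γ j - P.pt W L γ j) := by
  have h1 := sum_pt (P := P) (L := L) hγ ⟨a, ha⟩
  have h2 := sum_pt (P := P) (L := shift L a s) hγ ⟨a, ha⟩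
  rw [← Finset.add_sum_erase _ _ ha] at h1 h2
  rw [Finset.sum_sub_distrib]
  linarith

variable [Fintype ι] [DecidableEq ι]

theorem univ_erase_eq (ha : a ∈ U) : Finset.univ.erase a = U.erase a ∪ Uᶜ := by
  ext i
  by_cases hi : i = a
  · subst hi; simp [ha]
  · by_cases h : i ∈ U <;> simp [hi, h]

theorem sum_univ_erase (ha : a ∈ U) (f : ι → ℝ) :
    ∑ i ∈ Finset.univ.erase a, f i = ∑ i ∈ U.erase a, f i + ∑ i ∈ Uᶜ, f i := by
  rw [univ_erase_eq ha, Finset.sum_union]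
  exact Finset.disjoint_left.2 fun i hi hi' =>
    (Finset.mem_compl.1 hi') (Finset.mem_of_mem_erase hi)

/-- The drop over all arms exceeds the drop over the arms in `U` by at most a fraction of the rise
of the arms outside `U`. -/
theorem sum_icurv_mul_drop_le (hγ : ∀ i, 0 ≤ γ i) (ha : a ∈ U) (hs : 0 ≤ s) :
    (∑ i ∈ U, P.icurv γ (P.pt Finset.univ L γ) i)
        * ((P.pt Finset.univ L γ a - P.pt Finset.univ (shift L a s) γ a)
          - (P.pt U L γ a - P.pt U (shift L a s) γ a))
      ≤ P.icurv γ (P.pt Finset.univ L γ) a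
        * ∑ i ∈ Uᶜ, (P.pt Finset.univ (shift L a s) γ i - P.pt Finset.univ L γ i) := by
  have hU : U.Nonempty := ⟨a, ha⟩
  have hW : (Finset.univ : Finset ι).Nonempty := ⟨a, Finset.mem_univ a⟩
  set p := P.pt Finset.univ L γ with hp
  set p' := P.pt Finset.univ (shift L a s) γ with hp'
  set q := P.pt U L γ with hq
  set q' := P.pt U (shift L a s) γ with hq'
  set d := P.level Finset.univ L γ - P.level Finset.univ (shift L a s) γ with hd
  set e := P.level U L γ - P.level U (shift L a s) γ with he
  have hppos : ∀ i, 0 < p i := fun i => univ_pt_pos hγ i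
  have hw : ∀ i, 0 < P.icurv γ p i := icurv_pos hγ hppos
  have hR : 0 ≤ ∑ i ∈ Uᶜ, (p' i - p i) := Finset.sum_nonneg fun i hi => by
    have : i ≠ a := fun h => (Finset.mem_compl.1 hi) (h ▸ ha)
    exact sub_nonneg.2 (pt_le_pt_shift hγ hs this)
  have hWU : 0 < ∑ i ∈ U, P.icurv γ p i := Finset.sum_pos (fun i _ => hw i) hU
  have he0 : 0 ≤ e := sub_nonneg.2 (level_shift_le hγ hU hs)
  have hds : d ≤ s := by linarith [le_level_shift (P := P) (L := L) (a := a) hγ hW hs]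
  have hes : e ≤ s := by linarith [le_level_shift (P := P) (L := L) (a := a) hγ hU hs]
  -- the dual coordinates
  have hl : P.level U L γ ≤ P.level Finset.univ L γ :=
    (pt_le_pt_of_subset hγ (Finset.subset_univ U) ha).1
  have hypos : ∀ i, 0 < L i + P.level Finset.univ L γ := fun i =>
    level_pos hγ hW (Finset.mem_univ i)
  have hyqpos : ∀ i ∈ U, 0 < L i + P.level U L γ := fun i hi => level_pos hγ hU hi
  have hpi : ∀ i, p i = P.inv (γ i) (L i + P.level Finset.univ L γ) := fun i =>
    pt_of_mem (Finset.mem_univ i)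
  have hpa' : p' a = P.inv (γ a) (L a + P.level Finset.univ L γ + (s - d)) := by
    rw [hp', pt_of_mem (Finset.mem_univ a), shift_self, hd]; congr 1; ring
  have hqa : q a = P.inv (γ a) (L a + P.level U L γ) := pt_of_mem ha
  have hqa' : q' a = P.inv (γ a) (L a + P.level U L γ + (s - e)) := by
    rw [hq', pt_of_mem ha, shift_self, he]; congr 1; ring
  have hΔq : P.inv (γ a) (L a + P.level Finset.univ L γ)
      - P.inv (γ a) (L a + P.level Finset.univ L γ + (s - e)) ≤ q a - q' a := by
    rw [hqa, hqa']
    exact inv_sub_anti (hγ a) (hyqpos a ha) (by linarith) (by linarith)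
  -- If e ≤ d, the dual coordinate of a rises by s - d ≤ s - e over all arms, and from a base at
  -- least as large as the one for U. By convexity of `inv` the drop is then no larger than over U,
  -- and the left side is nonpositive.
  rcases le_or_gt e d with hed | hed
  · have h1 : p a - p' a ≤ q a - q' a := by
      refine le_trans ?_ hΔq
      rw [← hpi a, hpa']
      have := inv_anti (P := P) (hγ a) (x := L a + P.level Finset.univ L γ + (s - d))
        (y := L a + P.level Finset.univ L γ + (s - e)) (by linarith [hypos a]) (by linarith)
      linarith
    have h2 : (∑ i ∈ U, P.icurv γ p i) * ((p a - p' a) - (q a - q' a)) ≤ 0 :=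
      mul_nonpos_of_nonneg_of_nonpos hWU.le (by linarith)
    exact h2.trans (mul_nonneg (hw a).le hR)
  · -- first bound: the drop of the arm `a`
    have b1 : (p a - p' a) - (q a - q' a) ≤ P.icurv γ p a * (e - d) := by
      have hv : 0 < L a + P.level Finset.univ L γ + (s - e) := by linarith [hypos a]
      have hv' : 0 < L a + P.level Finset.univ L γ + (s - d) := by linarith [hypos a]
      have t := inv_tangent (P := P) (hγ a) hv hv'
      have hle : P.inv (γ a) (L a + P.level Finset.univ L γ + (s - e)) ≤ p a := by
        rw [hpi a]; exact inv_anti (hγ a) (hypos a) (by linarith)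
      have hc := curv_anti (P := P) (hγ a) (inv_pos (P := P) (hγ a) hv) hle
      have e1 : L a + P.level Finset.univ L γ + (s - d) - (L a + P.level Finset.univ L γ + (s - e))
        = e - d := by ring
      rw [e1, ← hpa'] at t
      rw [← hpi a] at hΔq
      have h3 : (e - d) / P.curv (γ a) (P.inv (γ a) (L a + P.level Finset.univ L γ + (s - e)))
          ≤ P.icurv γ p a * (e - d) := by
        unfold icurv
        rw [one_div_mul_eq_div]
        have := curv_pos (P := P) (hγ a) (hppos a)
        gcongr
      linarith
    -- second bound: the rises of the other arms
    have b2 : (p a - p' a) - (q a - q' a)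
        ≤ ∑ i ∈ Uᶜ, (p' i - p i) - (∑ i ∈ U.erase a, P.icurv γ p i) * (e - d) := by
      have h1 := sum_shift_sub (P := P) (L := L) (s := s) hγ (Finset.mem_univ a)
      have h2 := sum_shift_sub (P := P) (L := L) (s := s) hγ ha
      rw [sum_univ_erase ha] at h1
      rw [← hp, ← hp'] at h1
      rw [← hq, ← hq'] at h2
      rw [h1, h2]
      have h3 : ∑ i ∈ U.erase a, (p' i - p i) + (∑ i ∈ U.erase a, P.icurv γ p i) * (e - d)
          ≤ ∑ i ∈ U.erase a, (q' i - q i) := by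
        rw [Finset.sum_mul, ← Finset.sum_add_distrib]
        refine Finset.sum_le_sum fun j hj => ?_
        have hjU := Finset.mem_of_mem_erase hj
        have hja := Finset.ne_of_mem_erase hj
        have hqj : q j = P.inv (γ j) (L j + P.level U L γ - e + e) := by
          rw [hq, pt_of_mem hjU]; congr 1; ring
        have hqj' : q' j = P.inv (γ j) (L j + P.level U L γ - e) := by
          rw [hq', pt_of_mem hjU, shift_of_ne hja, he]; congr 1; ring
        have hpj' : p' j = P.inv (γ j) (L j + P.level Finset.univ L γ - d) := by
          rw [hp', pt_of_mem (Finset.mem_univ j), shift_of_ne hja, hd]; congr 1; ring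
        have hq'pos : 0 < L j + P.level U L γ - e := by
          have := level_pos (P := P) (L := shift L a s) hγ hU hjU
          rw [shift_of_ne hja] at this
          rw [he]; linarith
        have hve : 0 < L j + P.level Finset.univ L γ - e := by linarith
        have hvd : 0 < L j + P.level Finset.univ L γ - d := by linarith
        -- By convexity, lowering the multiplier by e raises q_j at least as much as it would raise
        -- p_j. The actual fall for p_j is only d, and the missing e - d is worth at least w_j (e -
        -- d).
        have c1 := inv_sub_anti (P := P) (hγ j) (u := e) hq'pos
          (show L j + P.level U L γ - e ≤ L j + P.level Finset.univ L γ - e by linarith) he0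
        rw [sub_add_cancel, ← hpi j, ← hqj', ← hqj] at c1
        have t := inv_tangent (P := P) (hγ j) hvd hve
        have hle : p j ≤ p' j := pt_le_pt_shift hγ hs hja
        have hc := curv_anti (P := P) (hγ j) (hppos j) hle
        have e1 : L j + P.level Finset.univ L γ - e - (L j + P.level Finset.univ L γ - d)
          = -(e - d) := by ring
        rw [e1, ← hpj', neg_div] at t
        have h3 : P.icurv γ p j * (e - d) ≤ (e - d) / P.curv (γ j) (p' j) := by
          unfold icurv
          rw [one_div_mul_eq_div]
          have := curv_pos (P := P) (hγ j) (hppos j |>.trans_le hle)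
          gcongr
        linarith
      linarith
    -- Weighting the first bound by the sum of w over U without a, and the second by w_a, eliminates
    -- e - d.
    rw [← Finset.add_sum_erase _ _ ha]
    have hX : 0 ≤ ∑ i ∈ U.erase a, P.icurv γ p i := Finset.sum_nonneg fun i _ => (hw i).le
    have m1 := mul_le_mul_of_nonneg_left b1 hX
    have m2 := mul_le_mul_of_nonneg_left b2 (hw a).le
    linarith

theorem sum_compl_rise_le (hγ : ∀ i, 0 ≤ γ i) (ha : a ∈ U) (hs : 0 ≤ s) :
    ∑ i ∈ Uᶜ, (P.pt Finset.univ (shift L a s) γ i - P.pt Finset.univ L γ i)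
      ≤ P.pt Finset.univ L γ a := by
  have h1 := sum_shift_sub (P := P) (L := L) (s := s) hγ (Finset.mem_univ a)
  rw [sum_univ_erase ha] at h1
  have h2 : 0 ≤ ∑ i ∈ U.erase a, (P.pt Finset.univ (shift L a s) γ i - P.pt Finset.univ L γ i) :=
    Finset.sum_nonneg fun i hi =>
      sub_nonneg.2 (pt_le_pt_shift hγ hs (Finset.ne_of_mem_erase hi))
  have h3 : 0 ≤ P.pt Finset.univ (shift L a s) γ a := pt_nonneg hγ a
  linarith

/-- The mass lost by a is at most (s - d) w_a and equals the mass gained by the others, which is at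
least d times the sum of their w. Hence d ∑ w ≤ s w_a. An arm that at most doubles rises by at most
4 d w_i. -/
theorem sum_icurv_mul_compl_rise_le (hγ : ∀ i, 0 ≤ γ i) (ha : a ∈ U) (hs : 0 ≤ s)
    (h2 : ∀ i ∈ Uᶜ, P.pt Finset.univ (shift L a s) γ i ≤ 2 * P.pt Finset.univ L γ i) :
    (∑ i, P.icurv γ (P.pt Finset.univ L γ) i)
        * ∑ i ∈ Uᶜ, (P.pt Finset.univ (shift L a s) γ i - P.pt Finset.univ L γ i)
      ≤ 4 * s * P.icurv γ (P.pt Finset.univ L γ) a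
        * ∑ i ∈ Uᶜ, P.icurv γ (P.pt Finset.univ L γ) i := by
  set p := P.pt Finset.univ L γ with hp
  set p' := P.pt Finset.univ (shift L a s) γ with hp'
  set d := P.level Finset.univ L γ - P.level Finset.univ (shift L a s) γ with hd
  have hw : ∀ i, 0 < P.icurv γ p i := icurv_pos hγ fun i => univ_pt_pos hγ i
  have h3 : d * ∑ i, P.icurv γ p i ≤ s * P.icurv γ p a := by
    have t1 := pt_sub_pt_shift_le (P := P) (L := L) (s := s) hγ (Finset.mem_univ a)
    rw [sum_shift_sub hγ (Finset.mem_univ a)] at t1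
    have t2 : ∑ j ∈ Finset.univ.erase a, d * P.icurv γ p j
        ≤ ∑ j ∈ Finset.univ.erase a, (p' j - p j) := Finset.sum_le_sum fun j hj => by
      have := le_pt_shift_sub_pt (P := P) (L := L) (s := s) hγ (Finset.mem_univ j)
        (Finset.ne_of_mem_erase hj)
      unfold icurv
      rwa [mul_one_div]
    rw [← Finset.mul_sum] at t2
    rw [← Finset.add_sum_erase _ _ (Finset.mem_univ a)]
    have t3 : (s - d) / P.curv (γ a) (p a) = (s - d) * P.icurv γ p a := by
      unfold icurv; rw [mul_one_div]
    rw [← hd, ← hp, t3] at t1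
    linarith
  have h4 : ∑ i ∈ Uᶜ, (p' i - p i) ≤ 4 * d * ∑ i ∈ Uᶜ, P.icurv γ p i := by
    rw [Finset.mul_sum]
    refine Finset.sum_le_sum fun i hi => ?_
    have hia : i ≠ a := fun h => (Finset.mem_compl.1 hi) (h ▸ ha)
    have := pt_shift_sub_pt_le (P := P) (L := L) hγ hs (Finset.mem_univ i) hia (h2 i hi)
    unfold icurv
    rwa [mul_one_div]
  have hS : 0 ≤ ∑ i, P.icurv γ p i := Finset.sum_nonneg fun i _ => (hw i).le
  have hV : 0 ≤ ∑ i ∈ Uᶜ, P.icurv γ p i := Finset.sum_nonneg fun i _ => (hw i).le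
  have m1 := mul_le_mul_of_nonneg_left h4 hS
  have m2 := mul_le_mul_of_nonneg_right h3 hV
  linarith

/-- The excess drop of an arm in `U` is linear in the loss increment, with a coefficient that is
controlled by the arms outside `U`. -/
theorem drop_sub_drop_le (hγ : ∀ i, 0 ≤ γ i) (ha : a ∈ U) (hs : 0 ≤ s) :
    (∑ i ∈ U, P.icurv γ (P.pt Finset.univ L γ) i)
        * ((P.pt Finset.univ L γ a - P.pt Finset.univ (shift L a s) γ a)
          - (P.pt U L γ a - P.pt U (shift L a s) γ a))
      ≤ P.icurv γ (P.pt Finset.univ L γ) a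
        * (2 * P.pt Finset.univ L γ a
            * ∑ i ∈ Uᶜ, P.icurv γ (P.pt Finset.univ L γ) i / P.pt Finset.univ L γ i
          + 4 * P.icurv γ (P.pt Finset.univ L γ) a
            * (∑ i ∈ Uᶜ, P.icurv γ (P.pt Finset.univ L γ) i)
            / ∑ i, P.icurv γ (P.pt Finset.univ L γ) i) * s := by
  refine (sum_icurv_mul_drop_le hγ ha hs).trans ?_
  rw [mul_assoc]
  have hd1 : ∀ i ∈ Uᶜ, 2 * P.pt Finset.univ L γ i < P.pt Finset.univ (shift L a s) γ i →
      1 ≤ 2 * (P.icurv γ (P.pt Finset.univ L γ) i / P.pt Finset.univ L γ i) * s := fun i hi h2 => by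
    have hia : i ≠ a := fun h => (Finset.mem_compl.1 hi) (h ▸ ha)
    have h3 := curv_lt_of_two_mul_lt hγ (Finset.mem_univ i) hia h2
    have hds := le_level_shift (P := P) (L := L) (a := a) (W := Finset.univ) hγ
      ⟨a, Finset.mem_univ a⟩ hs
    have hpi : 0 < P.pt Finset.univ L γ i := univ_pt_pos hγ i
    have hk := curv_pos (P := P) (hγ i) hpi
    unfold icurv
    rw [div_div, mul_one_div, div_mul_eq_mul_div, le_div_iff₀ (by positivity)]
    linarith
  have hd2 := sum_icurv_mul_compl_rise_le (P := P) (L := L) hγ ha hs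
  have hd3 := sum_compl_rise_le (P := P) (L := L) hγ ha hs
  have hp : ∀ i, 0 < P.pt Finset.univ L γ i := fun i => univ_pt_pos hγ i
  have hw : ∀ i, 0 < P.icurv γ (P.pt Finset.univ L γ) i := icurv_pos hγ hp
  generalize P.icurv γ (P.pt Finset.univ L γ) = w at *
  generalize P.pt Finset.univ L γ = p at *
  generalize P.pt Finset.univ (shift L a s) γ = p' at *
  refine mul_le_mul_of_nonneg_left ?_ (hw a).le
  have hS : 0 < ∑ i, w i := Finset.sum_pos (fun i _ => hw i) ⟨a, Finset.mem_univ a⟩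
  have hV : 0 ≤ ∑ i ∈ Uᶜ, w i := Finset.sum_nonneg fun i _ => (hw i).le
  have hρ : 0 ≤ ∑ i ∈ Uᶜ, w i / p i := Finset.sum_nonneg fun i _ => (div_pos (hw i) (hp i)).le
  have hpa := hp a
  have hwa := hw a
  have h9 : 0 ≤ 4 * w a * (∑ i ∈ Uᶜ, w i) / (∑ i, w i) * s := by positivity
  have h4 : 0 ≤ 2 * p a * (∑ i ∈ Uᶜ, w i / p i) * s := by positivity
  rw [add_mul]
  -- If no arm outside U more than doubles, the rises are linear in s. If one does, then 1 ≤ 2 (w_i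
  -- / p_i) s, so the trivial bound p_a on the total rise is itself linear in s.
  by_cases h2 : ∀ i ∈ Uᶜ, p' i ≤ 2 * p i
  · have h3 : ∑ i ∈ Uᶜ, (p' i - p i) ≤ 4 * w a * (∑ i ∈ Uᶜ, w i) / (∑ i, w i) * s := by
      rw [div_mul_eq_mul_div, le_div_iff₀ hS]
      linarith [hd2 h2]
    linarith
  · push Not at h2
    obtain ⟨i, hi, h2⟩ := h2
    have h4 : w i / p i ≤ ∑ i ∈ Uᶜ, w i / p i :=
      Finset.single_le_sum (f := fun i => w i / p i) (fun i _ => (div_pos (hw i) (hp i)).le) hi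
    have h6 : 2 * (w i / p i) * s ≤ 2 * (∑ i ∈ Uᶜ, w i / p i) * s := by gcongr
    have h7 := mul_le_mul_of_nonneg_left ((hd1 i hi h2).trans h6) hpa.le
    linarith

end Hybrid

/-! ### The stability term -/

/-- A function whose increments are at least linear, up to a quadratic error, has a linear lower
bound. -/
theorem le_sub_of_quadratic_error {H : ℝ → ℝ} {z A M : ℝ} (hz : 0 ≤ z)
    (h : ∀ s s', 0 ≤ s → s ≤ s' → s' ≤ z → (s' - s) * A - M * (s' - s) ^ 2 ≤ H s' - H s) :
    z * A ≤ H z - H 0 := by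
  -- Cut [0, z] into n + 1 equal steps: the quadratic errors add up to M z² / (n + 1), which
  -- vanishes in the limit.
  have key : ∀ n : ℕ, z * A - M * z ^ 2 * (1 / ((n : ℝ) + 1)) ≤ H z - H 0 := fun n => by
    have hs : ∀ i ∈ Finset.range (n + 1), z / (n + 1) * A - M * (z / (n + 1)) ^ 2
        ≤ H (((i + 1 : ℕ) : ℝ) * (z / (n + 1))) - H ((i : ℝ) * (z / (n + 1))) := fun i hi => by
      have hi' : ((i : ℝ) + 1) ≤ n + 1 := by
        have := Finset.mem_range.1 hi
        exact_mod_cast this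
      have h0 : 0 ≤ z / ((n : ℝ) + 1) := by positivity
      have := h ((i : ℝ) * (z / (n + 1))) (((i + 1 : ℕ) : ℝ) * (z / (n + 1))) (by positivity)
        (by push_cast; nlinarith) (by
          push_cast
          calc ((i : ℝ) + 1) * (z / (n + 1)) ≤ (n + 1) * (z / (n + 1)) := by gcongr
            _ = z := by field_simp)
      have e : ((i + 1 : ℕ) : ℝ) * (z / (n + 1)) - (i : ℝ) * (z / (n + 1)) = z / (n + 1) := by
        push_cast; ring
      rwa [e] at this
    have := Finset.sum_le_sum hs
    rw [Finset.sum_range_sub (fun i : ℕ => H ((i : ℝ) * (z / (n + 1)))), Finset.sum_const,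
      Finset.card_range, nsmul_eq_mul] at this
    push_cast at this
    have e1 : ((n : ℝ) + 1) * (z / (n + 1)) = z := by field_simp
    rw [e1, zero_mul] at this
    refine le_trans (le_of_eq ?_) this
    field_simp
  have ht : Filter.Tendsto (fun n : ℕ => z * A - M * z ^ 2 * (1 / ((n : ℝ) + 1)))
      Filter.atTop (nhds (z * A - M * z ^ 2 * 0)) :=
    tendsto_const_nhds.sub (tendsto_one_div_add_atTop_nhds_zero_nat.const_mul _)
  have := le_of_tendsto' ht key
  linarith

namespace Hybrid

variable {ι : Type*} [Fintype ι] [DecidableEq ι] {P : Hybrid} {U : Finset ι} {L γ : ι → ℝ} {a : ι}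
  {z : ℝ}

/-- The price of the learner's not knowing the loss increment `z` of the arm `a`, in excess of that
of the player who only uses the arms in `U`. -/
def stab (P : Hybrid) (U : Finset ι) (L γ : ι → ℝ) (a : ι) (z : ℝ) : ℝ :=
  (z * P.pt Finset.univ L γ a - (P.val Finset.univ (shift L a z) γ - P.val Finset.univ L γ))
    - (z * P.pt U L γ a - (P.val U (shift L a z) γ - P.val U L γ))

/-- The stability term of the shadow player is nonnegative and can be dropped; that of the learner
is bounded by the supergradient after the shift. -/
theorem stab_le_drop (hγ : ∀ i, 0 ≤ γ i) (hU : U.Nonempty) :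
    P.stab U L γ a z
      ≤ z * (P.pt Finset.univ L γ a - P.pt Finset.univ (shift L a z) γ a) := by
  have h1 := val_shift_le (P := P) (L := L) (a := a) (s := z) hγ hU
  have h2 := val_le_val_shift (P := P) (L := L) (a := a) (s := z) hγ
    (W := Finset.univ) ⟨a, Finset.mem_univ a⟩
  unfold stab
  linarith

theorem stab_le_mul (hγ : ∀ i, 0 ≤ γ i) (hU : U.Nonempty) (hz : 0 ≤ z) :
    P.stab U L γ a z ≤ z * P.pt Finset.univ L γ a := by
  refine (stab_le_drop hγ hU).trans (mul_le_mul_of_nonneg_left ?_ hz)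
  have : 0 ≤ P.pt Finset.univ (shift L a z) γ a := pt_nonneg hγ a
  linarith

theorem stab_le_sq (hγ : ∀ i, 0 ≤ γ i) (hU : U.Nonempty) (hz : 0 ≤ z) :
    P.stab U L γ a z ≤ z ^ 2 * P.icurv γ (P.pt Finset.univ L γ) a := by
  refine (stab_le_drop hγ hU).trans ?_
  have := pt_sub_pt_shift_le' (P := P) (L := L) hγ (Finset.mem_univ a) hz
  have := mul_le_mul_of_nonneg_left this hz
  refine this.trans (le_of_eq ?_)
  unfold icurv
  ring

/-- Along L + s e_a the function Φ - Φ_U has slope p_a(s) - q_a(s), which the hypothesis bounds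
below by p_a - q_a - B z. Supergradients at grid points replace derivatives. The mismatch of q_a
between two grid points is at most the step divided by a fixed curvature, whence the quadratic
error. -/
theorem stab_le_of_drop_le {B : ℝ} (hB0 : 0 ≤ B) (hγ : ∀ i, 0 ≤ γ i) (ha : a ∈ U) (hz : 0 ≤ z)
    (hdrop : ∀ s, 0 ≤ s → (P.pt Finset.univ L γ a - P.pt Finset.univ (shift L a s) γ a)
          - (P.pt U L γ a - P.pt U (shift L a s) γ a) ≤ B * s) :
    P.stab U L γ a z ≤ z ^ 2 * B := by
  have hU : U.Nonempty := ⟨a, ha⟩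
  have hW : (Finset.univ : Finset ι).Nonempty := ⟨a, Finset.mem_univ a⟩
  have hqa := pt_pos (P := P) (L := L) hγ ha
  have key := le_sub_of_quadratic_error
    (H := fun s => P.val Finset.univ (shift L a s) γ - P.val U (shift L a s) γ)
    (A := P.pt Finset.univ L γ a - P.pt U L γ a - B * z)
    (M := 1 / P.curv (γ a) (P.pt U L γ a)) hz (fun s s' hs hss hs' => by
      have h1 := val_shift_le (P := P) (L := shift L a s) (a := a) (s := s' - s) hγ hU
      have h2 := val_le_val_shift (P := P) (L := shift L a s) (a := a) (s := s' - s) hγ hW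
      have h3 := pt_sub_pt_shift_le' (P := P) (L := shift L a s) (s := s' - s) hγ ha
        (by linarith)
      rw [shift_shift, add_sub_cancel] at h1 h2 h3
      have h4 := hdrop s' (hs.trans hss)
      have h5 : B * s' ≤ B * z := by gcongr
      have h6 : (s' - s) / P.curv (γ a) (P.pt U (shift L a s) γ a)
          ≤ 1 / P.curv (γ a) (P.pt U L γ a) * (s' - s) := by
        rw [one_div_mul_eq_div]
        have h7 := pt_shift_self_le (P := P) (W := U) (L := L) (a := a) hγ hs
        have h8 := curv_anti (P := P) (hγ a) (pt_pos (P := P) (L := shift L a s) hγ ha) h7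
        have := curv_pos (P := P) (hγ a) hqa
        gcongr
      have h9 : P.pt Finset.univ L γ a - P.pt U L γ a - B * z
          - 1 / P.curv (γ a) (P.pt U L γ a) * (s' - s)
          ≤ P.pt Finset.univ (shift L a s') γ a - P.pt U (shift L a s) γ a := by linarith
      have h10 := mul_le_mul_of_nonneg_left h9 (show 0 ≤ s' - s by linarith)
      linarith)
  simp only [shift_zero] at key
  unfold stab
  linarith

theorem stab_le_of_mem (hγ : ∀ i, 0 ≤ γ i) (ha : a ∈ U) (hz : 0 ≤ z) :
    P.stab U L γ a z ≤ z ^ 2 * (P.icurv γ (P.pt Finset.univ L γ) a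
        / (∑ i ∈ U, P.icurv γ (P.pt Finset.univ L γ) i)
        * (2 * P.pt Finset.univ L γ a
            * ∑ i ∈ Uᶜ, P.icurv γ (P.pt Finset.univ L γ) i / P.pt Finset.univ L γ i
          + 4 * P.icurv γ (P.pt Finset.univ L γ) a
            * (∑ i ∈ Uᶜ, P.icurv γ (P.pt Finset.univ L γ) i)
            / ∑ i, P.icurv γ (P.pt Finset.univ L γ) i)) := by
  have hdrop := fun (s : ℝ) (hs : 0 ≤ s) =>
    drop_sub_drop_le (P := P) (L := L) (s := s) hγ ha hs
  have hp : ∀ i, 0 < P.pt Finset.univ L γ i := fun i => univ_pt_pos hγ i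
  have hw : ∀ i, 0 < P.icurv γ (P.pt Finset.univ L γ) i := icurv_pos hγ hp
  refine stab_le_of_drop_le ?_ hγ ha hz ?_
  · generalize P.icurv γ (P.pt Finset.univ L γ) = w at *
    generalize P.pt Finset.univ L γ = p at *
    have h1 : 0 ≤ ∑ i ∈ Uᶜ, w i / p i := Finset.sum_nonneg fun i _ => (div_pos (hw i) (hp i)).le
    have h2 : 0 ≤ ∑ i ∈ Uᶜ, w i := Finset.sum_nonneg fun i _ => (hw i).le
    have h3 : 0 ≤ ∑ i, w i := Finset.sum_nonneg fun i _ => (hw i).le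
    have h4 : 0 ≤ ∑ i ∈ U, w i := Finset.sum_nonneg fun i _ => (hw i).le
    have := hp a
    have := hw a
    positivity
  · intro s hs
    have hWU : 0 < ∑ i ∈ U, P.icurv γ (P.pt Finset.univ L γ) i :=
      Finset.sum_pos (fun i _ => hw i) ⟨a, ha⟩
    rw [div_mul_eq_mul_div, div_mul_eq_mul_div, le_div_iff₀ hWU, mul_comm]
    exact hdrop s hs

/-- The stability bound of an arm outside `U`, weighted with its probability. -/
theorem pt_mul_stab_le_of_notMem (hγ : ∀ i, 0 ≤ γ i) (hU : U.Nonempty) (hz : 0 ≤ z)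
    (hzp : z * P.pt Finset.univ L γ a ≤ 1) :
    P.pt Finset.univ L γ a * P.stab U L γ a z
      ≤ P.icurv γ (P.pt Finset.univ L γ) a / P.pt Finset.univ L γ a := by
  have hp : 0 < P.pt Finset.univ L γ a := univ_pt_pos hγ a
  have hw : 0 < P.icurv γ (P.pt Finset.univ L γ) a := icurv_pos hγ (fun i => univ_pt_pos hγ i) a
  have h := stab_le_sq (P := P) (L := L) (a := a) hγ hU hz
  rw [le_div_iff₀ hp]
  have h2 : (z * P.pt Finset.univ L γ a) ^ 2 ≤ 1 := pow_le_one₀ (by positivity) hzp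
  calc _ = (P.pt Finset.univ L γ a) ^ 2 * P.stab U L γ a z := by ring
    _ ≤ (P.pt Finset.univ L γ a) ^ 2 * (z ^ 2 * P.icurv γ (P.pt Finset.univ L γ) a) := by gcongr
    _ = (z * P.pt Finset.univ L γ a) ^ 2 * P.icurv γ (P.pt Finset.univ L γ) a := by ring
    _ ≤ 1 * P.icurv γ (P.pt Finset.univ L γ) a := by gcongr
    _ = _ := one_mul _

/-- The stability bound of an arm in `U`, weighted with its probability. -/
theorem pt_mul_stab_le_of_mem (hγ : ∀ i, 0 ≤ γ i) (ha : a ∈ U) (hz : 0 ≤ z)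
    (hzp : z * P.pt Finset.univ L γ a ≤ 1) :
    P.pt Finset.univ L γ a * P.stab U L γ a z
      ≤ 6 * (P.icurv γ (P.pt Finset.univ L γ) a / ∑ i ∈ U, P.icurv γ (P.pt Finset.univ L γ) i)
          * (∑ i ∈ Uᶜ, P.icurv γ (P.pt Finset.univ L γ) i / P.pt Finset.univ L γ i)
        + 4 * (P.icurv γ (P.pt Finset.univ L γ) a / P.pt Finset.univ L γ a
              / √(P.pt Finset.univ L γ a))
          * √(P.icurv γ (P.pt Finset.univ L γ) a / (∑ i ∈ U, P.icurv γ (P.pt Finset.univ L γ) i)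
            * ∑ i ∈ Uᶜ, P.pt Finset.univ L γ i) := by
  have h := stab_le_of_mem (P := P) (L := L) hγ ha hz
  have hp : ∀ i, 0 < P.pt Finset.univ L γ i := fun i => univ_pt_pos hγ i
  have hw : ∀ i, 0 < P.icurv γ (P.pt Finset.univ L γ) i := icurv_pos hγ hp
  generalize P.stab U L γ a z = S at *
  generalize P.icurv γ (P.pt Finset.univ L γ) = w at *
  generalize P.pt Finset.univ L γ = p at *
  have hpa := hp a
  have hwa := hw a
  have hWU : 0 < ∑ i ∈ U, w i := Finset.sum_pos (fun i _ => hw i) ⟨a, ha⟩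
  have hWT : 0 < ∑ i, w i := Finset.sum_pos (fun i _ => hw i) ⟨a, Finset.mem_univ a⟩
  have hV : 0 ≤ ∑ i ∈ Uᶜ, w i := Finset.sum_nonneg fun i _ => (hw i).le
  have hPV : 0 ≤ ∑ i ∈ Uᶜ, p i := Finset.sum_nonneg fun i _ => (hp i).le
  have hρ : 0 ≤ ∑ i ∈ Uᶜ, w i / p i := Finset.sum_nonneg fun i _ => (div_pos (hw i) (hp i)).le
  have hVT : ∑ i ∈ Uᶜ, w i ≤ ∑ i, w i :=
    Finset.sum_le_sum_of_subset_of_nonneg (Finset.subset_univ _) fun i _ _ => (hw i).le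
  have hwaU : w a ≤ ∑ i ∈ U, w i := Finset.single_le_sum (fun i _ => (hw i).le) ha
  have hwaT : w a ≤ ∑ i, w i := Finset.single_le_sum (fun i _ => (hw i).le) (Finset.mem_univ a)
  have hvv : ∀ i ∈ Uᶜ, w i / p i ≤ ∑ i ∈ Uᶜ, w i / p i := fun i hi =>
    Finset.single_le_sum (f := fun i => w i / p i) (fun i _ => (div_pos (hw i) (hp i)).le) hi
  -- When w_a / p_a exceeds the sum outside U, it exceeds each of its terms, and then w_i ≤ (w_a /
  -- p_a) p_i for every outside arm. In the other case w_a / p_a is absorbed into that sum.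
  have hVP : w a / p a ≤ ∑ i ∈ Uᶜ, w i / p i ∨ ∑ i ∈ Uᶜ, w i ≤ w a / p a * ∑ i ∈ Uᶜ, p i := by
    rcases le_or_gt (w a / p a) (∑ i ∈ Uᶜ, w i / p i) with h | h
    · exact Or.inl h
    · right
      rw [Finset.mul_sum]
      refine Finset.sum_le_sum fun i hi => ?_
      have h1 := (hvv i hi).trans h.le
      calc w i = w i / p i * p i := by rw [div_mul_cancel₀ _ (hp i).ne']
        _ ≤ _ := mul_le_mul_of_nonneg_right h1 (hp i).le
  set u := w a / ∑ i ∈ U, w i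
  set ρ := ∑ i ∈ Uᶜ, w i / p i
  set V := ∑ i ∈ Uᶜ, w i
  set Tt := ∑ i, w i
  set r := w a / p a with hr
  have hu1 : u ≤ 1 := div_le_one_of_le₀ hwaU hWU.le
  have hr0 : 0 < r := by positivity
  have hwr : w a = r * p a := by rw [hr, div_mul_cancel₀ _ hpa.ne']
  have step : p a * S ≤ 2 * u * ρ + 4 * r * (u * (V / Tt)) := by
    have h2 : (z * p a) ^ 2 ≤ 1 := pow_le_one₀ (by positivity) hzp
    have h3 : p a * S ≤ (z * p a) ^ 2 * (2 * u * ρ + 4 * r * (u * (V / Tt))) := by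
      refine (mul_le_mul_of_nonneg_left h hpa.le).trans (le_of_eq ?_)
      rw [hwr]; ring
    refine h3.trans ?_
    have : 0 ≤ 2 * u * ρ + 4 * r * (u * (V / Tt)) := by positivity
    nlinarith
  have hb1 : V / Tt ≤ 1 := div_le_one_of_le₀ hVT hWT.le
  rcases hVP with hc | hc
  · have h3 : r * (u * (V / Tt)) ≤ ρ * (u * 1) := by gcongr
    have h4 : 0 ≤ 4 * (r / √(p a)) * √(u * ∑ i ∈ Uᶜ, p i) := by positivity
    linarith
  · have h5 : p a * (u * (V / Tt)) ^ 2 ≤ u * ∑ i ∈ Uᶜ, p i := by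
      have h6 : p a * (V / Tt) ≤ ∑ i ∈ Uᶜ, p i := by
        rw [mul_div_assoc', div_le_iff₀ hWT]
        calc p a * V ≤ p a * (r * ∑ i ∈ Uᶜ, p i) := by gcongr
          _ = (∑ i ∈ Uᶜ, p i) * w a := by rw [hwr]; ring
          _ ≤ _ := by gcongr
      calc p a * (u * (V / Tt)) ^ 2 = u * (p a * (V / Tt)) * (u * (V / Tt)) := by ring
        _ ≤ u * (∑ i ∈ Uᶜ, p i) * (1 * 1) := by gcongr
        _ = _ := by ring
    have h6 : √(p a) * (u * (V / Tt)) ≤ √(u * ∑ i ∈ Uᶜ, p i) := by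
      refine Real.le_sqrt_of_sq_le ?_
      rw [mul_pow, Real.sq_sqrt hpa.le]
      exact h5
    have h7 : r * (u * (V / Tt)) ≤ r / √(p a) * √(u * ∑ i ∈ Uᶜ, p i) := by
      calc r * (u * (V / Tt)) = r / √(p a) * (√(p a) * (u * (V / Tt))) := by field_simp
        _ ≤ _ := by gcongr
    have h8 : 0 ≤ u * ρ := by positivity
    linarith

end Hybrid
-- The price of raising the learning rates
namespace Hybrid

variable {ι : Type*} {P : Hybrid} {W U : Finset ι} {L γ γ' : ι → ℝ} {a : ι} {z : ℝ}

theorem obj_rate {y : ι → ℝ} :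
    P.obj W L γ' y = P.obj W L γ y - ∑ i ∈ W, 1 / (1 - P.β) * ((γ' i - γ i) * y i ^ P.β) := by
  unfold obj reg
  rw [← Finset.sum_sub_distrib]
  refine Finset.sum_congr rfl fun i _ => ?_
  ring

theorem val_rate_le (hγ : ∀ i, 0 ≤ γ i) (hγ' : ∀ i, 0 ≤ γ' i) (hW : W.Nonempty) :
    P.val W L γ' ≤ P.val W L γ
      - ∑ i ∈ W, 1 / (1 - P.β) * ((γ' i - γ i) * P.pt W L γ i ^ P.β) := by
  have := val_le_obj (P := P) (L := L) hγ' hW (y := P.pt W L γ)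
    (fun i hi => pt_pos hγ hi) (sum_pt hγ hW)
  rwa [obj_rate (γ := γ)] at this

variable [Fintype ι]

/-- The price of raising the learning rates, in excess of that of the player who only uses the arms
in `U`. -/
def pen (P : Hybrid) (U : Finset ι) (L γ γ' : ι → ℝ) : ℝ :=
  (P.val U L γ' - P.val U L γ) - (P.val Finset.univ L γ' - P.val Finset.univ L γ)

/-- The minimum over U is tested at its old minimizer, the minimum over all arms at its new one. On
U the old shadow probability is at least the learner's (`pt_le_pt_of_subset`), so only the change of
p_i^β remains there. -/
theorem pen_le [DecidableEq ι] (hγ : ∀ i, 0 ≤ γ i) (h : ∀ i, γ i ≤ γ' i) (hU : U.Nonempty) :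
    P.pen U L γ γ'
      ≤ ∑ i ∈ Uᶜ, 1 / (1 - P.β) * ((γ' i - γ i) * P.pt Finset.univ L γ' i ^ P.β)
        + ∑ i ∈ U, 1 / (1 - P.β) * ((γ' i - γ i)
          * (P.pt Finset.univ L γ' i ^ P.β - P.pt Finset.univ L γ i ^ P.β)) := by
  have hγ' : ∀ i, 0 ≤ γ' i := fun i => (hγ i).trans (h i)
  have h1 := val_rate_le (P := P) (L := L) hγ hγ' hU
  have h2 := val_rate_le (P := P) (L := L) (W := Finset.univ) hγ' hγ (hU.mono (Finset.subset_univ _))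
  have h3 : ∑ i ∈ U, 1 / (1 - P.β) * ((γ' i - γ i) * P.pt Finset.univ L γ i ^ P.β)
      ≤ ∑ i ∈ U, 1 / (1 - P.β) * ((γ' i - γ i) * P.pt U L γ i ^ P.β) := by
    refine Finset.sum_le_sum fun i hi => ?_
    have h4 := (pt_le_pt_of_subset (P := P) (L := L) hγ (Finset.subset_univ U) hi).2
    have h5 : 0 ≤ γ' i - γ i := sub_nonneg.2 (h i)
    have h6 := P.one_sub_pos
    have h7 : 0 ≤ P.pt Finset.univ L γ i := pt_nonneg hγ i
    have h8 := P.β_pos.le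
    gcongr
  rw [← Finset.sum_add_sum_compl U] at h2
  have e1 : ∀ i, 1 / (1 - P.β) * ((γ i - γ' i) * P.pt Finset.univ L γ' i ^ P.β)
    = -(1 / (1 - P.β) * ((γ' i - γ i) * P.pt Finset.univ L γ' i ^ P.β)) := fun i => by ring
  have e2 : ∀ i, 1 / (1 - P.β) * ((γ' i - γ i)
          * (P.pt Finset.univ L γ' i ^ P.β - P.pt Finset.univ L γ i ^ P.β))
     = 1 / (1 - P.β) * ((γ' i - γ i) * P.pt Finset.univ L γ' i ^ P.β)
      - 1 / (1 - P.β) * ((γ' i - γ i) * P.pt Finset.univ L γ i ^ P.β) := fun i => by ring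
  simp only [e1, Finset.sum_neg_distrib] at h2
  simp only [e2, Finset.sum_sub_distrib]
  unfold pen
  linarith

/-- By optimality the slope is the loss plus the multiplier, and the multiplier grows with the
rates. This one inequality controls how far a probability can rise in a rate update. -/
theorem slope_le_slope_of_rate_le (hγ : ∀ i, 0 ≤ γ i) (h : ∀ i, γ i ≤ γ' i) (i : ι) :
    P.slope (γ i) (P.pt Finset.univ L γ i) ≤ P.slope (γ' i) (P.pt Finset.univ L γ' i) := by
  rw [slope_pt hγ (Finset.mem_univ i), slope_pt (fun i => (hγ i).trans (h i)) (Finset.mem_univ i)]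
  have := level_mono_rate (P := P) (L := L) (W := Finset.univ) hγ h ⟨i, Finset.mem_univ i⟩
  linarith

/-- A loss increment of at most the inverse probability multiplies no probability by more than
a constant. -/
theorem pt_shift_le [DecidableEq ι] (hγ : ∀ i, 0 ≤ γ i) (hz : 0 ≤ z) (hzp : z * P.pt Finset.univ L γ a ≤ 1)
    (i : ι) : P.pt Finset.univ (shift L a z) γ i ≤ (2 + 2 / P.C) * P.pt Finset.univ L γ i := by
  have hp : ∀ i, 0 < P.pt Finset.univ L γ i := fun i => univ_pt_pos hγ i
  have hC := P.C_pos
  have hC2 : 0 < 2 / P.C := by positivity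
  by_cases hia : i = a
  · subst hia
    have := pt_shift_self_le (P := P) (W := Finset.univ) (L := L) (a := i) hγ hz
    nlinarith [hp i]
  -- Otherwise the arm more than doubles. The barrier part of its curvature then gives C / (2 p_i) ≤
  -- z, so p_a ≤ (2 / C) p_i because z p_a ≤ 1. But no arm can rise by more than p_a.
  by_contra! hlt
  have h2 : 2 * P.pt Finset.univ L γ i < P.pt Finset.univ (shift L a z) γ i := by nlinarith [hp i]
  have h3 := curv_lt_of_two_mul_lt hγ (Finset.mem_univ i) hia h2
  have hd := le_level_shift (P := P) (L := L) (a := a) (W := Finset.univ) hγ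
      ⟨a, Finset.mem_univ a⟩ hz
  have h4 : P.C / P.pt Finset.univ L γ i ≤ P.pt Finset.univ L γ i
      * P.curv (γ i) (P.pt Finset.univ L γ i) := by
    have hpi := hp i
    have hβ := P.β_pos
    have hγi := hγ i
    unfold curv
    have e : P.pt Finset.univ L γ i * (P.C / P.pt Finset.univ L γ i ^ 2)
      = P.C / P.pt Finset.univ L γ i := by field_simp
    rw [mul_add, e]
    have : 0 ≤ P.pt Finset.univ L γ i * (P.β * γ i * P.pt Finset.univ L γ i ^ (P.β - 2)) := by
      positivity
    linarith
  have h5 : P.pt Finset.univ (shift L a z) γ i - P.pt Finset.univ L γ i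
      ≤ P.pt Finset.univ L γ a := by
    have h6 := sum_shift_sub (P := P) (L := L) (s := z) hγ (Finset.mem_univ a)
    have h7 := Finset.single_le_sum
      (f := fun j => P.pt Finset.univ (shift L a z) γ j - P.pt Finset.univ L γ j)
      (fun j hj => sub_nonneg.2 (pt_le_pt_shift hγ hz (Finset.ne_of_mem_erase hj)))
      (Finset.mem_erase.2 ⟨hia, Finset.mem_univ i⟩)
    have h8 : 0 ≤ P.pt Finset.univ (shift L a z) γ a := pt_nonneg hγ a
    linarith
  have h9 : P.C / P.pt Finset.univ L γ i / 2 * P.pt Finset.univ L γ a ≤ 1 := by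
    refine le_trans (mul_le_mul_of_nonneg_right ?_ (hp a).le) hzp
    linarith
  have h10 : P.pt Finset.univ L γ a ≤ 2 / P.C * P.pt Finset.univ L γ i := by
    have hpi := hp i
    rw [div_div, div_mul_eq_mul_div, div_le_one (by positivity)] at h9
    rw [div_mul_eq_mul_div, le_div_iff₀ hC]
    linarith
  nlinarith [hp i]

end Hybrid

/-! ### One-arm estimates for the tuned parameters -/

section Scalar

variable {β m S : ℝ}

theorem sqrt_ratio_eq (h0 : 0 < β) (h1 : β < 1) :
    √((1 - β) / β) = (1 - β) * √(1 / (β * (1 - β))) := by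
  have : 0 < 1 - β := by linarith
  have e : (1 - β) / β = (1 - β) ^ 2 * (1 / (β * (1 - β))) := by field_simp
  rw [e, Real.sqrt_mul (by positivity), Real.sqrt_sq this.le]

theorem sqrt_ratio_sq (h0 : 0 < β) (h1 : β < 1) : √((1 - β) / β) ^ 2 = (1 - β) / β := by
  exact Real.sq_sqrt (by positivity)

theorem kappa_sq (h0 : 0 < β) (h1 : β < 1) :
    √(1 / (β * (1 - β))) ^ 2 = 1 / (β * (1 - β)) := by
  exact Real.sq_sqrt (by positivity)

theorem two_le_kappa (h0 : 0 < β) (h1 : β < 1) : 2 ≤ √(1 / (β * (1 - β))) := by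
  refine Real.le_sqrt_of_sq_le ?_
  rw [le_div_iff₀ (by positivity)]
  nlinarith [sq_nonneg (1 - 2 * β)]

theorem mul_rpow_one_sub_two (hm : 0 < m) : m * m ^ (1 - 2 * β) = (m ^ (1 - β)) ^ 2 := by
  have h1 : m * m ^ (1 - 2 * β) = m ^ (1 : ℝ) * m ^ (1 - 2 * β) := by rw [Real.rpow_one]
  rw [h1, ← Real.rpow_add hm, ← Real.rpow_natCast, ← Real.rpow_mul hm.le]
  congr 1; push_cast; ring

theorem rpow_one_sub_two_mul (hm : 0 < m) : m ^ (1 - 2 * β) * (m ^ β) ^ 2 = m := by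
  rw [← Real.rpow_natCast, ← Real.rpow_mul hm.le, ← Real.rpow_add hm]
  convert Real.rpow_one m using 2
  push_cast; ring

theorem rpow_one_sub_two_mul_rpow (hm : 0 < m) :
    m ^ (1 - 2 * β) * m ^ β = m ^ (1 - β) := by
  rw [← Real.rpow_add hm]; congr 1; ring

/-- The identity behind the exponent 1 - 2β in the learning rate: the natural stability scale
m^(1-β) / √S is √(m x / S) with x = m^(1-2β), the very summand added to S. -/
theorem sqrt_mul_div_eq (hm : 0 < m) :
    √(m * (m ^ (1 - 2 * β) / S)) = m ^ (1 - β) / √S := by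
  rw [mul_div_assoc', mul_rpow_one_sub_two hm, Real.sqrt_div (by positivity),
    Real.sqrt_sq (by positivity)]

theorem sqrt_add_sub_le {x : ℝ} (hS : 0 ≤ S) (hx : 0 ≤ x) :
    (√(S + x) - √S) * √(S + x) ≤ x := by
  have h1 := Real.mul_self_sqrt (show 0 ≤ S + x by linarith)
  have h2 := Real.mul_self_sqrt hS
  have h3 : √S ≤ √(S + x) := Real.sqrt_le_sqrt (by linarith)
  nlinarith [Real.sqrt_nonneg S]

theorem sqrt_add_sub_le_sqrt {x : ℝ} (hS : 0 ≤ S) (hx : 0 ≤ x) : √(S + x) - √S ≤ √x := by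
  have h1 : √(S + x) ≤ √S + √x := by
    rw [Real.sqrt_le_left (by positivity)]
    nlinarith [Real.sq_sqrt hS, Real.sq_sqrt hx, Real.sqrt_nonneg S, Real.sqrt_nonneg x,
      mul_nonneg (Real.sqrt_nonneg S) (Real.sqrt_nonneg x)]
  linarith

end Scalar

/-- The regularizer of the algorithm, up to the learning rate. -/
def algHybrid (β : ℝ) (h0 : 0 < β) (h1 : β < 1) : Hybrid where
  C := 162 * β / (1 - β)
  β := β
  C_pos := by have : 0 < 1 - β := by linarith
              positivity
  β_pos := h0
  β_lt := h1

section Scalar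

variable {β m S r r' : ℝ} (h0 : 0 < β) (h1 : β < 1)

/-- With the chosen barrier the slope is β/(1-β) times 162/x + γ x^(β-1). Moving from r up to r'
lowers the barrier part, and only the rate increase can pay for it. Discarding the barrier gives the
second estimate. -/
theorem sub_le_of_slope_le {γ γ' : ℝ} (hγ : 0 ≤ γ) (hr : 0 < r) (hlt : r < r')
    (h : (algHybrid β h0 h1).slope γ r ≤ (algHybrid β h0 h1).slope γ' r') :
    162 * (r' - r) ≤ (γ' - γ) * r * r' ^ β ∧ γ * r ^ (β - 1) ≤ γ' * r' ^ (β - 1) := by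
  have hr' : 0 < r' := hr.trans hlt
  have hbb : 0 < β / (1 - β) := by positivity
  have e : ∀ g x : ℝ, (algHybrid β h0 h1).slope g x
      = β / (1 - β) * (162 / x + g * x ^ (β - 1)) := fun g x => by
    unfold Hybrid.slope algHybrid; simp only; ring
  rw [e, e] at h
  have h2 := le_of_mul_le_mul_left h hbb
  have h3 : r' ^ (β - 1) ≤ r ^ (β - 1) := Real.rpow_le_rpow_of_nonpos hr hlt.le (by linarith)
  have h4 : 162 / r' ≤ 162 / r := by gcongr
  refine ⟨?_, by linarith⟩
  have h5 : γ * r' ^ (β - 1) ≤ γ * r ^ (β - 1) := by gcongr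
  have h6 : 162 / r - 162 / r' ≤ (γ' - γ) * r' ^ (β - 1) := by linarith
  have h7 := mul_le_mul_of_nonneg_right h6 (show 0 ≤ r * r' by positivity)
  have e1 : (162 / r - 162 / r') * (r * r') = 162 * (r' - r) := by field_simp
  have e2 : r' ^ (β - 1) * r' = r' ^ β := by
    rw [Real.rpow_sub_one hr'.ne']; field_simp
  rw [e1] at h7
  calc _ ≤ _ := h7
    _ = (γ' - γ) * r * (r' ^ (β - 1) * r') := by ring
    _ = _ := by rw [e2]

/-- The effect on a probability of raising the learning rates. -/
theorem rpow_le_of_slope_le (hm : 0 < m) (hm1 : m ≤ 1) (hS : 1 ≤ S) (hr : 0 < r) (hlt : r < r')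
    (hrm : r ^ β ≤ 3 * m ^ β)
    (h : (algHybrid β h0 h1).slope (√((1 - β) / β) * √S) r
      ≤ (algHybrid β h0 h1).slope (√((1 - β) / β) * √(S + m ^ (1 - 2 * β))) r') :
    r' ^ β ≤ 2 * r ^ β := by
  have hr' : 0 < r' := hr.trans hlt
  have hx : 0 < m ^ (1 - 2 * β) := by positivity
  have hSS : √S ≤ √(S + m ^ (1 - 2 * β)) := Real.sqrt_le_sqrt (by linarith)
  obtain ⟨hI, hII⟩ := sub_le_of_slope_le h0 h1 (by positivity) hr hlt h
  -- For β ≤ 1/2 the new summand is at most 1 ≤ S, so the rate at most doubles and the Tsallis part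
  -- alone limits r'. For β > 1/2 the rate may jump, and the barrier is needed: 162 (r' - r) ≤ 3 r'.
  rcases le_or_gt β (1 / 2) with hβ | hβ
  · have hx1 : m ^ (1 - 2 * β) ≤ 1 := Real.rpow_le_one hm.le hm1 (by linarith)
    have h2 : √(S + m ^ (1 - 2 * β)) ≤ 2 * √S := by
      rw [Real.sqrt_le_left (by positivity), mul_pow, Real.sq_sqrt (by linarith)]
      linarith
    have h3 : r ^ (β - 1) ≤ 2 * r' ^ (β - 1) := by
      have h4 : √((1 - β) / β) * √S * r ^ (β - 1)
          ≤ √((1 - β) / β) * √S * (2 * r' ^ (β - 1)) := by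
        refine hII.trans ?_
        have : √((1 - β) / β) * √(S + m ^ (1 - 2 * β)) * r' ^ (β - 1)
          ≤ √((1 - β) / β) * (2 * √S) * r' ^ (β - 1) := by gcongr
        linarith
      exact le_of_mul_le_mul_left h4 (by positivity)
    have h5 : (r' / r) ^ β ≤ (r' / r) ^ (1 - β) :=
      Real.rpow_le_rpow_of_exponent_le ((one_le_div hr).2 hlt.le) (by linarith)
    have h6 : (r' / r) ^ (1 - β) ≤ 2 := by
      rw [Real.div_rpow hr'.le hr.le]
      have e1 : r' ^ (1 - β) = (r' ^ (β - 1))⁻¹ := by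
        rw [← Real.rpow_neg hr'.le]; congr 1; ring
      have e2 : r ^ (1 - β) = (r ^ (β - 1))⁻¹ := by
        rw [← Real.rpow_neg hr.le]; congr 1; ring
      have p1 : 0 < r' ^ (β - 1) := by positivity
      rw [e1, e2, div_inv_eq_mul, inv_mul_le_iff₀ p1]
      linarith
    have h7 := h5.trans h6
    rw [Real.div_rpow hr'.le hr.le, div_le_iff₀ (by positivity)] at h7
    exact h7
  · have hθ1 : √((1 - β) / β) ≤ 1 := by
      rw [Real.sqrt_le_left zero_le_one, one_pow, div_le_one h0]
      linarith
    have h2 : r' ^ β ≤ r' * (r ^ β / r) := by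
      have h3 : r' ^ (β - 1) ≤ r ^ (β - 1) := Real.rpow_le_rpow_of_nonpos hr hlt.le (by linarith)
      rw [Real.rpow_sub_one hr'.ne', Real.rpow_sub_one hr.ne', div_le_iff₀ hr'] at h3
      linarith
    have h3 : (√((1 - β) / β) * √(S + m ^ (1 - 2 * β)) - √((1 - β) / β) * √S)
        ≤ √(m ^ (1 - 2 * β)) := by
      have := sqrt_add_sub_le_sqrt (show 0 ≤ S by linarith) hx.le
      rw [← mul_sub]
      nlinarith
    have h4 : √(m ^ (1 - 2 * β)) * m ^ β ≤ 1 := by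
      have e : √(m ^ (1 - 2 * β)) * m ^ β = √(m ^ (1 - 2 * β) * (m ^ β) ^ 2) := by
        rw [Real.sqrt_mul hx.le, Real.sqrt_sq (by positivity)]
      rw [e, rpow_one_sub_two_mul hm]
      exact (Real.sqrt_le_left zero_le_one).2 (by linarith)
    have h5 : 162 * (r' - r) ≤ 3 * r' := by
      calc _ ≤ _ := hI
        _ ≤ √(m ^ (1 - 2 * β)) * r * (r' * (r ^ β / r)) := by gcongr
        _ = √(m ^ (1 - 2 * β)) * r ^ β * r' := by field_simp
        _ ≤ √(m ^ (1 - 2 * β)) * (3 * m ^ β) * r' := by gcongr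
        _ = 3 * (√(m ^ (1 - 2 * β)) * m ^ β) * r' := by ring
        _ ≤ 3 * 1 * r' := by gcongr
        _ = _ := by ring
    have h6 : r' ≤ 2 * r := by linarith
    calc r' ^ β ≤ (2 * r) ^ β := by gcongr
      _ = 2 ^ β * r ^ β := Real.mul_rpow (by norm_num) hr.le
      _ ≤ 2 ^ (1 : ℝ) * r ^ β := by
        gcongr
        norm_num
      _ = _ := by rw [Real.rpow_one]

theorem rate_sub_le (hm : 0 < m) (hS : 1 ≤ S) :
    √((1 - β) / β) * √(S + m ^ (1 - 2 * β)) - √((1 - β) / β) * √S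
      ≤ √((1 - β) / β) * (m ^ (1 - 2 * β) / √(S + m ^ (1 - 2 * β))) := by
  have hx : 0 < m ^ (1 - 2 * β) := by positivity
  have h2 := sqrt_add_sub_le (show 0 ≤ S by linarith) hx.le
  rw [← mul_sub]
  refine mul_le_mul_of_nonneg_left ?_ (Real.sqrt_nonneg _)
  rw [le_div_iff₀ (Real.sqrt_pos.2 (by linarith))]
  exact h2

/-- The rate grows by at most θ x / √(S + x), the mass factor satisfies x m^β = m^(1-β), and θ /
(1-β) = κ. The penalty thus has the same scale as the stability bound. -/
theorem penalty_first_order (h0 : 0 < β) (h1 : β < 1) (hm : 0 < m) (hS : 1 ≤ S)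
    (hr' : r' ^ β ≤ 6 * m ^ β) (hr0 : 0 ≤ r' ^ β) :
    1 / (1 - β) * ((√((1 - β) / β) * √(S + m ^ (1 - 2 * β)) - √((1 - β) / β) * √S) * r' ^ β)
      ≤ 6 * √(1 / (β * (1 - β)))
        * √(m * (m ^ (1 - 2 * β) / (S + m ^ (1 - 2 * β)))) := by
  have hb : 0 < 1 - β := by linarith
  have h2 := rate_sub_le (β := β) hm hS
  calc _ ≤ 1 / (1 - β) * ((√((1 - β) / β) * (m ^ (1 - 2 * β) / √(S + m ^ (1 - 2 * β))))
          * (6 * m ^ β)) := by gcongr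
    _ = _ := by
      rw [sqrt_mul_div_eq hm, ← rpow_one_sub_two_mul_rpow (β := β) hm, sqrt_ratio_eq h0 h1]
      generalize m ^ (1 - 2 * β) = x
      generalize m ^ β = y
      field_simp

/-- The barrier bounds r' - r by the rate increment, so the product is quadratic in that increment.
The factor κ disappears because θ² β / (1-β) = 1. -/
theorem penalty_second_order (hm : 0 < m) (hm1 : m ≤ 1) (hS : 1 ≤ S) (hr : 0 < r)
    (hr'p : 0 < r') (hrm : r ^ β ≤ 3 * m ^ β)
    (h : (algHybrid β h0 h1).slope (√((1 - β) / β) * √S) r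
      ≤ (algHybrid β h0 h1).slope (√((1 - β) / β) * √(S + m ^ (1 - 2 * β))) r') :
    1 / (1 - β) * ((√((1 - β) / β) * √(S + m ^ (1 - 2 * β)) - √((1 - β) / β) * √S)
        * (r' ^ β - r ^ β))
      ≤ m * (m ^ (1 - 2 * β) / (S + m ^ (1 - 2 * β))) := by
  have hb : 0 < 1 - β := by linarith
  have hx : 0 < m ^ (1 - 2 * β) := by positivity
  have hSS : √S ≤ √(S + m ^ (1 - 2 * β)) := Real.sqrt_le_sqrt (by linarith)
  have hθ : 0 < √((1 - β) / β) := Real.sqrt_pos.2 (by positivity)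
  have hΔ : 0 ≤ √((1 - β) / β) * √(S + m ^ (1 - 2 * β)) - √((1 - β) / β) * √S :=
    sub_nonneg.2 (mul_le_mul_of_nonneg_left hSS hθ.le)
  rcases le_or_gt r' r with hle | hlt
  · have h3 : r' ^ β ≤ r ^ β := by gcongr
    have h4 : 1 / (1 - β) * ((√((1 - β) / β) * √(S + m ^ (1 - 2 * β)) - √((1 - β) / β) * √S)
        * (r' ^ β - r ^ β)) ≤ 0 :=
      mul_nonpos_of_nonneg_of_nonpos (by positivity)
        (mul_nonpos_of_nonneg_of_nonpos hΔ (by linarith))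
    refine h4.trans ?_
    positivity
  obtain ⟨hI, -⟩ := sub_le_of_slope_le h0 h1 (by positivity) hr hlt h
  have hr2 := rpow_le_of_slope_le h0 h1 hm hm1 hS hr hlt hrm h
  have h2 := rate_sub_le (β := β) hm hS
  set Δ := √((1 - β) / β) * √(S + m ^ (1 - 2 * β)) - √((1 - β) / β) * √S
  have h3 := rpow_le_tangent (y := r') h0.le h1.le hr hr'p.le
  have h4 : β * r ^ (β - 1) * (r' - r) ≤ β * r ^ (β - 1) * (Δ * r * r' ^ β / 162) := by
    gcongr
    linarith
  have e : β * r ^ (β - 1) * (Δ * r * r' ^ β / 162) = β / 162 * Δ * (r ^ β * r' ^ β) := by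
    rw [Real.rpow_sub_one hr.ne']; field_simp
  have h5 : r ^ β * r' ^ β ≤ 3 * m ^ β * (2 * (3 * m ^ β)) := by
    gcongr
    linarith
  -- The product of powers is at most 3 · 6 (m^β)² = 18 (m^β)², and 18/162 = 1/9.
  have h6 : r' ^ β - r ^ β ≤ β / 9 * Δ * (m ^ β) ^ 2 := by
    have : β / 162 * Δ * (r ^ β * r' ^ β) ≤ β / 162 * Δ * (3 * m ^ β * (2 * (3 * m ^ β))) := by
      gcongr
    linarith
  calc _ ≤ 1 / (1 - β) * (Δ * (β / 9 * Δ * (m ^ β) ^ 2)) := by gcongr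
    _ = β / (1 - β) / 9 * Δ ^ 2 * (m ^ β) ^ 2 := by ring
    _ ≤ β / (1 - β) / 9 * (√((1 - β) / β) * (m ^ (1 - 2 * β) / √(S + m ^ (1 - 2 * β)))) ^ 2
        * (m ^ β) ^ 2 := by gcongr
    _ = β / (1 - β) / 9 * √((1 - β) / β) ^ 2 * (m ^ (1 - 2 * β)
        / √(S + m ^ (1 - 2 * β)) ^ 2) * (m ^ (1 - 2 * β) * (m ^ β) ^ 2) := by ring
    _ = 1 / 9 * (m * (m ^ (1 - 2 * β) / (S + m ^ (1 - 2 * β)))) := by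
      rw [rpow_one_sub_two_mul hm, sqrt_ratio_sq h0 h1, Real.sq_sqrt (by linarith)]
      field_simp
    _ ≤ _ := by
      have : 0 ≤ m * (m ^ (1 - 2 * β) / (S + m ^ (1 - 2 * β))) := by
        positivity
      linarith

/-- The inverse curvature relative to the probability. -/
theorem icurv_div_le {p : ℝ} (hp : 0 < p) (hS : 1 ≤ S) :
    1 / (algHybrid β h0 h1).curv (√((1 - β) / β) * √S) p / p
      ≤ √(1 / (β * (1 - β))) * (p ^ (1 - β) / √S) := by
  have hb : 0 < 1 - β := by linarith
  have h2 : β * (√((1 - β) / β) * √S) * p ^ (β - 2)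
      ≤ (algHybrid β h0 h1).curv (√((1 - β) / β) * √S) p := by
    unfold Hybrid.curv algHybrid
    simp only
    have : 0 ≤ 162 * β / (1 - β) / p ^ 2 := by positivity
    linarith
  have hk : β * (√((1 - β) / β)) * √(1 / (β * (1 - β))) = 1 := by
    rw [sqrt_ratio_eq h0 h1]
    have := kappa_sq h0 h1
    calc _ = β * (1 - β) * √(1 / (β * (1 - β))) ^ 2 := by ring
      _ = 1 := by rw [this]; field_simp
  calc _ ≤ 1 / (β * (√((1 - β) / β) * √S) * p ^ (β - 2)) / p := by gcongr
    _ = β * (√((1 - β) / β)) * √(1 / (β * (1 - β)))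
        / (β * (√((1 - β) / β) * √S) * p ^ (β - 2)) / p := by rw [hk]
    _ = √(1 / (β * (1 - β))) / √S * (p ^ (β - 2) * p)⁻¹ := by field_simp
    _ = _ := by
      have : (p ^ (β - 2) * p)⁻¹ = p ^ (1 - β) := by
        rw [← Real.rpow_add_one hp.ne', ← Real.rpow_neg hp.le]; congr 1; ring
      rw [this]; ring

theorem icurv_div_le_div {p : ℝ} (hp : 0 < p) {γ : ℝ} (hγ : 0 ≤ γ) :
    1 / (algHybrid β h0 h1).curv γ p / p ≤ p * (1 - β) / (162 * β) := by
  have hb : 0 < 1 - β := by linarith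
  have h2 : 162 * β / (1 - β) / p ^ 2 ≤ (algHybrid β h0 h1).curv γ p := by
    unfold Hybrid.curv algHybrid
    simp only
    have : 0 ≤ β * γ * p ^ (β - 2) := by positivity
    linarith
  calc _ ≤ 1 / (162 * β / (1 - β) / p ^ 2) / p := by gcongr
    _ = _ := by field_simp

theorem sqrt_two_bound {A : ℝ} (hA : 0 ≤ A) {S' : ℝ} (hS : 0 < S) (hS' : S' ≤ 2 * S) (hS'0 : 0 < S') :
    A / √S ≤ √2 * (A / √S') := by
  have h : √S' ≤ √2 * √S := by
    rw [← Real.sqrt_mul (by norm_num)]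
    exact Real.sqrt_le_sqrt hS'
  have p1 := Real.sqrt_pos.2 hS
  have p2 := Real.sqrt_pos.2 hS'0
  rw [mul_div_assoc', div_le_div_iff₀ p1 p2]
  nlinarith

/-- The Tsallis curvature gives the bound with S in place of S + x, where x = m^(1-2β); for x ≤ S
this costs a factor √2. If x > S ≥ 1, then β > 1/2, the ratio x / (S + x) is at least 1/2, and the
barrier curvature already bounds the left side by m. -/
theorem icurv_div_le_sqrt {p : ℝ} (hp : 0 < p) (hpm : p ≤ m) (hm1 : m ≤ 1) (hS : 1 ≤ S) :
    1 / (algHybrid β h0 h1).curv (√((1 - β) / β) * √S) p / p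
      ≤ 2 * √(1 / (β * (1 - β)))
        * √(m * (m ^ (1 - 2 * β) / (S + m ^ (1 - 2 * β)))) := by
  have hm : 0 < m := hp.trans_le hpm
  have hx : 0 < m ^ (1 - 2 * β) := by positivity
  have hκ := two_le_kappa h0 h1
  rcases le_or_gt (m ^ (1 - 2 * β)) S with hxS | hxS
  · refine (icurv_div_le h0 h1 hp hS).trans ?_
    rw [sqrt_mul_div_eq hm]
    have h2 : p ^ (1 - β) ≤ m ^ (1 - β) := by gcongr
    have h3 := sqrt_two_bound (A := m ^ (1 - β)) (S := S) (S' := S + m ^ (1 - 2 * β))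
      (by positivity) (by linarith) (by linarith) (by linarith)
    have h4 : √2 ≤ 2 := by rw [Real.sqrt_le_left (by norm_num)]; norm_num
    calc _ ≤ √(1 / (β * (1 - β))) * (m ^ (1 - β) / √S) := by gcongr
      _ ≤ √(1 / (β * (1 - β))) * (√2 * (m ^ (1 - β) / √(S + m ^ (1 - 2 * β)))) := by gcongr
      _ ≤ √(1 / (β * (1 - β))) * (2 * (m ^ (1 - β) / √(S + m ^ (1 - 2 * β)))) := by gcongr
      _ = _ := by ring
  · have hβ : 1 / 2 < β := by
      by_contra! hle
      have := Real.rpow_le_one hm.le hm1 (show 0 ≤ 1 - 2 * β by linarith)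
      linarith
    have h2 := icurv_div_le_div h0 h1 hp (show 0 ≤ √((1 - β) / β) * √S by positivity)
    have h3 : p * (1 - β) / (162 * β) ≤ m := by
      rw [div_le_iff₀ (by positivity)]
      have : p * (1 - β) ≤ m * (162 * β) := by gcongr; linarith
      exact this
    have h4 : (m / 2) ≤ √(m * (m ^ (1 - 2 * β) / (S + m ^ (1 - 2 * β)))) := by
      refine Real.le_sqrt_of_sq_le ?_
      have : 1 / 2 ≤ m ^ (1 - 2 * β) / (S + m ^ (1 - 2 * β)) := by
        rw [div_le_div_iff₀ (by norm_num) (by linarith)]; linarith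
      nlinarith
    calc _ ≤ m := h2.trans h3
      _ ≤ 2 * 2 * (m / 2) := by linarith
      _ ≤ _ := by gcongr

/-- The stability bound of an arm in `U` in terms of the learning rates. -/
theorem stab_bound_of_mem {p A u Q τ ρ : ℝ} (hp : 0 < p) (hp1 : p ≤ 1) (hτ : 0 ≤ τ)
    (hm : m = max p τ) (hS : 1 ≤ S) (hA : A ≤ p) (hu : 0 ≤ u) (hρ : 0 ≤ ρ)
    (hA2 : A ≤ 6 * u * ρ
      + 4 * (1 / (algHybrid β h0 h1).curv (√((1 - β) / β) * √S) p / p / √p) * √Q) :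
    A ≤ 6 * u * ρ + 6 * √(1 / (β * (1 - β)))
        * (√(m ^ (1 - 2 * β) / (S + m ^ (1 - 2 * β))) * √Q)
      + 2 * (m * (m ^ (1 - 2 * β) / (S + m ^ (1 - 2 * β)))) + τ := by
  have hb : 0 < 1 - β := by linarith
  have hpm : p ≤ m := hm ▸ le_max_left _ _
  have hm0 : 0 < m := hp.trans_le hpm
  have hx : 0 < m ^ (1 - 2 * β) := by positivity
  have hS' : 0 < S + m ^ (1 - 2 * β) := by linarith
  have n1 : 0 ≤ 6 * u * ρ := by positivity
  have n2 : 0 ≤ 6 * √(1 / (β * (1 - β)))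
        * (√(m ^ (1 - 2 * β) / (S + m ^ (1 - 2 * β))) * √Q) := by positivity
  have n3 : 0 ≤ 2 * (m * (m ^ (1 - 2 * β) / (S + m ^ (1 - 2 * β)))) := by positivity
  -- An arm below the cutoff costs at most τ. Above it m = p, and if m^(1-2β) > S the trivial bound
  -- A ≤ m is at most twice the term m · m^(1-2β) / (S + m^(1-2β)).
  rcases le_or_gt p τ with hpτ | hpτ
  · linarith
  have hmp : m = p := by rw [hm, max_eq_left hpτ.le]
  subst hmp
  rcases le_or_gt (m ^ (1 - 2 * β)) S with hxS | hxS
  · have h2 := icurv_div_le h0 h1 hp hS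
    have h3 : 1 / (algHybrid β h0 h1).curv (√((1 - β) / β) * √S) m / m / √m
        ≤ √(1 / (β * (1 - β))) * (√2 * √(m ^ (1 - 2 * β) / (S + m ^ (1 - 2 * β)))) := by
      have h4 := sqrt_two_bound (A := √(m ^ (1 - 2 * β))) (S := S) (S' := S + m ^ (1 - 2 * β))
        (by positivity) (by linarith) (by linarith) (by linarith)
      rw [← Real.sqrt_div hx.le] at h4
      have e : m ^ (1 - β) = √(m ^ (1 - 2 * β)) * √m := by
        rw [← Real.sqrt_mul hx.le, mul_comm, mul_rpow_one_sub_two hp,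
          Real.sqrt_sq (by positivity)]
      rw [← Real.sqrt_div hx.le] at h4
      calc _ ≤ √(1 / (β * (1 - β))) * (m ^ (1 - β) / √S) / √m := by gcongr
        _ = √(1 / (β * (1 - β))) * (√(m ^ (1 - 2 * β)) / √S) := by rw [e]; field_simp
        _ ≤ _ := by
          rw [← Real.sqrt_div hx.le]
          gcongr
    have h5 : 4 * √2 ≤ 6 := by
      have : √2 ≤ 3 / 2 := by rw [Real.sqrt_le_left (by norm_num)]; norm_num
      linarith
    have h6 : 4 * (1 / (algHybrid β h0 h1).curv (√((1 - β) / β) * √S) m / m / √m) * √Q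
        ≤ 6 * √(1 / (β * (1 - β))) * (√(m ^ (1 - 2 * β) / (S + m ^ (1 - 2 * β))) * √Q) := by
      calc _ ≤ 4 * (√(1 / (β * (1 - β)))
            * (√2 * √(m ^ (1 - 2 * β) / (S + m ^ (1 - 2 * β))))) * √Q := by gcongr
        _ = 4 * √2 * (√(1 / (β * (1 - β)))
            * √(m ^ (1 - 2 * β) / (S + m ^ (1 - 2 * β))) * √Q) := by ring
        _ ≤ 6 * (√(1 / (β * (1 - β)))
            * √(m ^ (1 - 2 * β) / (S + m ^ (1 - 2 * β))) * √Q) := by gcongr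
        _ = _ := by ring
    linarith
  · have : 1 / 2 ≤ m ^ (1 - 2 * β) / (S + m ^ (1 - 2 * β)) := by
      rw [div_le_div_iff₀ (by norm_num) hS']; linarith
    have : m * (1 / 2) ≤ m * (m ^ (1 - 2 * β) / (S + m ^ (1 - 2 * β))) := by gcongr
    linarith

end Scalar

/-! ### Play along one fixed outcome -/

section Path

variable {K : ℕ}

/-- The probability of an arm, cut off from below at `1 / T`. -/
def mass (T : ℕ) (p : ℕ → Fin K → ℝ) (t : ℕ) (i : Fin K) : ℝ := max (p t i) (1 / (T : ℝ))

/-- The sum under the square root in the learning rate. -/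
def rateSum (β : ℝ) (T : ℕ) (p : ℕ → Fin K → ℝ) (t : ℕ) (i : Fin K) : ℝ :=
  1 + ∑ τ ∈ Finset.range t, mass T p τ i ^ (1 - 2 * β)

/-- The relative increase of the sum under the square root in the learning rate. -/
def rateStep (β : ℝ) (T : ℕ) (p : ℕ → Fin K → ℝ) (t : ℕ) (i : Fin K) : ℝ :=
  mass T p t i ^ (1 - 2 * β) / (rateSum β T p t i + mass T p t i ^ (1 - 2 * β))

/-- The cumulative loss estimates. -/
def cumEst (l p : ℕ → Fin K → ℝ) (a : ℕ → Fin K) (t : ℕ) (i : Fin K) : ℝ :=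
  ∑ τ ∈ Finset.range t, lossEst (l τ) (p τ) (a τ) i

/-- The learning rates of the algorithm. -/
def algRate (β : ℝ) (T : ℕ) (p : ℕ → Fin K → ℝ) (t : ℕ) (i : Fin K) : ℝ :=
  learningRate (√((1 - β) / β)) β T p t i

variable {β : ℝ} {T : ℕ} {l p : ℕ → Fin K → ℝ} {a : ℕ → Fin K} {t : ℕ}

theorem algRate_eq (i : Fin K) :
    algRate β T p t i = √((1 - β) / β) * √(rateSum β T p t i) := rfl

theorem algRate_nonneg (i : Fin K) : 0 ≤ algRate β T p t i := by
  rw [algRate_eq]; positivity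

theorem mass_pos (hT : 0 < T) (i : Fin K) : 0 < mass T p t i :=
  lt_of_lt_of_le (by positivity) (le_max_right _ _)

theorem one_le_rateSum (hT : 0 < T) (i : Fin K) : 1 ≤ rateSum β T p t i := by
  unfold rateSum
  have : 0 ≤ ∑ τ ∈ Finset.range t, mass T p τ i ^ (1 - 2 * β) :=
    Finset.sum_nonneg fun τ _ => Real.rpow_nonneg (mass_pos hT i).le _
  linarith

theorem rateSum_succ (i : Fin K) :
    rateSum β T p (t + 1) i = rateSum β T p t i + mass T p t i ^ (1 - 2 * β) := by
  unfold rateSum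
  rw [Finset.sum_range_succ]; ring

theorem algRate_mono (hT : 0 < T) (i : Fin K) : algRate β T p t i ≤ algRate β T p (t + 1) i := by
  rw [algRate_eq, algRate_eq, rateSum_succ]
  have : 0 < mass T p t i ^ (1 - 2 * β) := Real.rpow_pos_of_pos (mass_pos hT i) _
  gcongr
  linarith

theorem cumEst_succ :
    cumEst l p a (t + 1) = shift (cumEst l p a t) (a t) (l t (a t) / p t (a t)) := by
  funext i
  unfold cumEst shift
  rw [Finset.sum_range_succ]
  congr 1
  unfold lossEst
  split_ifs with h
  · rw [h]
  · rfl

theorem cumEst_zero : cumEst l p a 0 = fun _ => 0 := by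
  funext i; simp [cumEst]

theorem obj_univ_eq (h0 : 0 < β) (h1 : β < 1) (L γ x : Fin K → ℝ) :
    (algHybrid β h0 h1).obj Finset.univ L γ x
      = (∑ i, x i * L i) + tsallisReg (162 * β / (1 - β)) β γ x := by
  unfold Hybrid.obj Hybrid.reg tsallisReg algHybrid
  simp only
  rw [Finset.sum_add_distrib, Finset.sum_sub_distrib, ← Finset.mul_sum, ← Finset.mul_sum]

theorem eq_pt_of_isFTRLArgmin (h0 : 0 < β) (h1 : β < 1) {L γ x : Fin K → ℝ} (hγ : ∀ i, 0 ≤ γ i)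
    (h : IsFTRLArgmin (162 * β / (1 - β)) β γ L x) :
    x = (algHybrid β h0 h1).pt Finset.univ L γ := by
  obtain ⟨⟨hx, hs⟩, hmin⟩ := h
  have hK : (Finset.univ : Finset (Fin K)).Nonempty := by
    by_contra hne
    rw [Finset.not_nonempty_iff_eq_empty] at hne
    simp [hne] at hs
  funext i
  refine Hybrid.eq_pt_of_obj_le hγ hK (fun i _ => hx i) hs ?_ (Finset.mem_univ i)
  have := hmin ((algHybrid β h0 h1).pt Finset.univ L γ)
    ⟨fun i => Hybrid.univ_pt_pos hγ i, Hybrid.sum_pt hγ hK⟩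
  rw [← obj_univ_eq h0 h1, ← obj_univ_eq h0 h1] at this
  exact this

/-- The factor in front of the main terms of the regret bound. -/
def kappa (β : ℝ) : ℝ := √(1 / (β * (1 - β)))

/-- The share of an arm in `U` in the inverse curvature of the regularizer. -/
def share (h0 : 0 < β) (h1 : β < 1) (T : ℕ) (U : Finset (Fin K)) (p : ℕ → Fin K → ℝ) (t : ℕ)
    (i : Fin K) : ℝ :=
  (algHybrid β h0 h1).icurv (algRate β T p t) (p t) i
    / ∑ j ∈ U, (algHybrid β h0 h1).icurv (algRate β T p t) (p t) j

/-- The conditional expectation bound on the stability term of an arm. -/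
def stabBound (h0 : 0 < β) (h1 : β < 1) (T : ℕ) (U : Finset (Fin K)) (p : ℕ → Fin K → ℝ) (t : ℕ)
    (i : Fin K) : ℝ :=
  if i ∈ U then
    6 * share h0 h1 T U p t i
        * (∑ j ∈ Uᶜ, 2 * kappa β * √(mass T p t j * rateStep β T p t j))
      + 6 * kappa β * (√(rateStep β T p t i) * √(share h0 h1 T U p t i * ∑ j ∈ Uᶜ, p t j))
      + 2 * (mass T p t i * rateStep β T p t i) + 1 / T
  else 2 * kappa β * √(mass T p t i * rateStep β T p t i)

/-- The bound on the price of changing the learning rates. -/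
def penBound (β : ℝ) (T : ℕ) (U : Finset (Fin K)) (p : ℕ → Fin K → ℝ) (t : ℕ) : ℝ :=
  ∑ i ∈ Uᶜ, 6 * kappa β * √(mass T p t i * rateStep β T p t i)
    + ∑ i ∈ U, mass T p t i * rateStep β T p t i

/-- The path of the play along a fixed outcome. -/
structure IsPath (β : ℝ) (T : ℕ) (l p : ℕ → Fin K → ℝ) (a : ℕ → Fin K) : Prop where
  loss_mem : ∀ t < T, ∀ i, l t i ∈ Set.Icc (0 : ℝ) 1
  argmin : ∀ t < T, IsFTRLArgmin (162 * β / (1 - β)) β (algRate β T p t) (cumEst l p a t) (p t)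

/-- The advantage of the learner over the player who only uses the arms in `U`, as measured by the
minima of the regularized objectives. -/
def valGap (h0 : 0 < β) (h1 : β < 1) (T : ℕ) (U : Finset (Fin K)) (l p : ℕ → Fin K → ℝ)
    (a : ℕ → Fin K) (t : ℕ) : ℝ :=
  (algHybrid β h0 h1).val Finset.univ (cumEst l p a t) (algRate β T p t)
    - (algHybrid β h0 h1).val U (cumEst l p a t) (algRate β T p t)

/-- The distribution of the player who only uses the arms in `U`. -/
def subDist (h0 : 0 < β) (h1 : β < 1) (T : ℕ) (U : Finset (Fin K)) (l p : ℕ → Fin K → ℝ)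
    (a : ℕ → Fin K) (t : ℕ) (i : Fin K) : ℝ :=
  (algHybrid β h0 h1).pt U (cumEst l p a t) (algRate β T p t) i

namespace IsPath

variable (H : IsPath β T l p a) (h0 : 0 < β) (h1 : β < 1) (ht : t < T) {U : Finset (Fin K)}
  (hU : U.Nonempty)
include H ht

theorem eq_pt : p t = (algHybrid β h0 h1).pt Finset.univ (cumEst l p a t) (algRate β T p t) :=
  eq_pt_of_isFTRLArgmin h0 h1 (fun i => algRate_nonneg i) (H.argmin t ht)

theorem pos (i : Fin K) : 0 < p t i := (H.argmin t ht).1.1 i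

theorem sum_eq : ∑ i, p t i = 1 := (H.argmin t ht).1.2

theorem le_one (i : Fin K) : p t i ≤ 1 := by
  rw [← H.sum_eq ht]
  exact Finset.single_le_sum (fun j _ => (H.pos ht j).le) (Finset.mem_univ i)

theorem mass_le_one (i : Fin K) : mass T p t i ≤ 1 := by
  refine max_le (H.le_one ht i) ?_
  have : (1 : ℝ) ≤ T := by exact_mod_cast (by omega : 1 ≤ T)
  exact div_le_one_of_le₀ this (by positivity)

/-- The importance-weighted increment satisfies z p_a ≤ 1, which is all the stability bounds need.
The quotient by p_a is kept because averaging over the draw turns it into a sum over all arms. -/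
theorem stab_le (hU : U.Nonempty) :
    (algHybrid β h0 h1).stab U (cumEst l p a t) (algRate β T p t) (a t)
        (l t (a t) / p t (a t))
      ≤ stabBound h0 h1 T U p t (a t) / p t (a t) := by
  have hT : 0 < T := by omega
  have hγ : ∀ i, 0 ≤ algRate β T p t i := fun i => algRate_nonneg i
  have hp := H.pos ht
  have hpa := hp (a t)
  have hz : 0 ≤ l t (a t) / p t (a t) := div_nonneg (H.loss_mem t ht (a t)).1 hpa.le
  have hzp : l t (a t) / p t (a t) * p t (a t) ≤ 1 := by
    rw [div_mul_cancel₀ _ hpa.ne']; exact (H.loss_mem t ht (a t)).2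
  have e := H.eq_pt h0 h1 ht
  have s1 := Hybrid.stab_le_mul (P := algHybrid β h0 h1) (L := cumEst l p a t) (a := a t) hγ hU hz
  rw [← e] at s1
  have s1' := s1.trans hzp
  have hr : ∀ i, (algHybrid β h0 h1).icurv (algRate β T p t) (p t) i / p t i
      ≤ 2 * kappa β * √(mass T p t i * rateStep β T p t i) := fun i =>
    icurv_div_le_sqrt h0 h1 (hp i) (le_max_left _ _) (H.mass_le_one ht i) (one_le_rateSum hT i)
  rw [le_div_iff₀ hpa, mul_comm]
  by_cases haU : a t ∈ U
  · have s2 := Hybrid.pt_mul_stab_le_of_mem (P := algHybrid β h0 h1) (L := cumEst l p a t)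
      hγ haU hz (by rw [← e]; exact hzp)
    rw [← e] at s2
    have hw : ∀ i, 0 < (algHybrid β h0 h1).icurv (algRate β T p t) (p t) i :=
      Hybrid.icurv_pos hγ hp
    have hu : 0 ≤ share h0 h1 T U p t (a t) :=
      div_nonneg (hw _).le (Finset.sum_nonneg fun i _ => (hw i).le)
    unfold stabBound
    rw [if_pos haU]
    refine stab_bound_of_mem h0 h1 hpa (H.le_one ht _) (by positivity) rfl (one_le_rateSum hT _)
      (mul_le_of_le_one_right hpa.le s1') hu ?_ (s2.trans ?_)
    · exact Finset.sum_nonneg fun i _ => by unfold kappa; positivity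
    · refine add_le_add ?_ le_rfl
      refine mul_le_mul_of_nonneg_left (Finset.sum_le_sum fun i _ => hr i) ?_
      unfold share at hu
      positivity
  · have s2 := Hybrid.pt_mul_stab_le_of_notMem (P := algHybrid β h0 h1) (U := U)
      (L := cumEst l p a t) hγ hU hz (by rw [← e]; exact hzp)
    rw [← e] at s2
    unfold stabBound
    rw [if_neg haU]
    exact s2.trans (hr _)

/-- The penalty is evaluated after the loss update, whereas the rate increment is built from p_t.
`pt_shift_le` carries the comparison across the loss update, and the slope inequality across the
rate update. -/
theorem pen_le (hU : U.Nonempty) :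
    (algHybrid β h0 h1).pen U (cumEst l p a (t + 1)) (algRate β T p t) (algRate β T p (t + 1))
      ≤ penBound β T U p t := by
  have hT : 0 < T := by omega
  have hγ : ∀ i, 0 ≤ algRate β T p t i := fun i => algRate_nonneg i
  have hγγ : ∀ i, algRate β T p t i ≤ algRate β T p (t + 1) i := fun i => algRate_mono hT i
  have hp := H.pos ht
  have hpa := hp (a t)
  have hz : 0 ≤ l t (a t) / p t (a t) := div_nonneg (H.loss_mem t ht (a t)).1 hpa.le
  have hzp : l t (a t) / p t (a t) * p t (a t) ≤ 1 := by
    rw [div_mul_cancel₀ _ hpa.ne']; exact (H.loss_mem t ht (a t)).2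
  have e := H.eq_pt h0 h1 ht
  have hb : 0 < 1 - β := by linarith
  set r := (algHybrid β h0 h1).pt Finset.univ (cumEst l p a (t + 1)) (algRate β T p t) with hr
  set r' := (algHybrid β h0 h1).pt Finset.univ (cumEst l p a (t + 1)) (algRate β T p (t + 1))
    with hr'
  have hrp : ∀ i, 0 < r i := fun i => Hybrid.univ_pt_pos hγ i
  have hrp' : ∀ i, 0 < r' i := fun i => Hybrid.univ_pt_pos (fun i => algRate_nonneg i) i
  have hrm : ∀ i, r i ^ β ≤ 3 * mass T p t i ^ β := fun i => by
    have h2 := Hybrid.pt_shift_le (P := algHybrid β h0 h1) (L := cumEst l p a t) hγ hz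
      (by rw [← e]; exact hzp) i
    rw [← cumEst_succ, ← hr, ← e] at h2
    have hpm : p t i ≤ mass T p t i := le_max_left _ _
    -- The growth factor blows up as β → 0, but its β-th power does not: 2/C ≤ 1/β, and Bernoulli
    -- gives 1 + β (1 + 1/β) = 2 + β ≤ 3.
    have hc : 2 + 2 / (algHybrid β h0 h1).C ≤ 1 + (1 + 1 / β) := by
      have : 2 / (algHybrid β h0 h1).C ≤ 1 / β := by
        change 2 / (162 * β / (1 - β)) ≤ 1 / β
        rw [div_le_div_iff₀ (by positivity) h0, mul_div_assoc', one_mul] 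
        rw [le_div_iff₀ hb]
        nlinarith
      linarith
    have hc3 : (1 + (1 + 1 / β)) ^ β ≤ 3 := by
      have := rpow_one_add_le_one_add_mul_self (s := 1 + 1 / β)
        (by have : 0 < 1 / β := by positivity
            linarith) h0.le h1.le
      have e2 : 1 + β * (1 + 1 / β) = 2 + β := by field_simp; ring
      linarith
    have hi := hp i
    have hm := mass_pos (p := p) (t := t) hT i
    calc r i ^ β ≤ ((1 + (1 + 1 / β)) * mass T p t i) ^ β := by
          refine Real.rpow_le_rpow (hrp i).le (h2.trans ?_) h0.le
          gcongr
      _ = (1 + (1 + 1 / β)) ^ β * mass T p t i ^ β := Real.mul_rpow (by positivity) hm.le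
      _ ≤ _ := by gcongr
  have hslope := fun i => Hybrid.slope_le_slope_of_rate_le (P := algHybrid β h0 h1)
    (L := cumEst l p a (t + 1)) hγ hγγ i
  have hr6 : ∀ i, r' i ^ β ≤ 6 * mass T p t i ^ β := fun i => by
    have hmp : 0 ≤ mass T p t i ^ β := Real.rpow_nonneg (mass_pos hT i).le _
    rcases le_or_gt (r' i) (r i) with h | h
    · have : r' i ^ β ≤ r i ^ β := Real.rpow_le_rpow (hrp' i).le h h0.le
      linarith [hrm i]
    · have h3 := hslope i
      rw [algRate_eq, algRate_eq, rateSum_succ] at h3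
      have := rpow_le_of_slope_le h0 h1 (mass_pos hT i) (H.mass_le_one ht i)
        (one_le_rateSum hT i) (hrp i) h (hrm i) h3
      linarith [hrm i]
  refine (Hybrid.pen_le hγ hγγ hU).trans ?_
  unfold penBound
  refine add_le_add (Finset.sum_le_sum fun i _ => ?_) (Finset.sum_le_sum fun i _ => ?_)
  · have := penalty_first_order (r' := r' i) h0 h1 (mass_pos (p := p) (t := t) hT i)
      (one_le_rateSum (β := β) (p := p) (t := t) hT i) (hr6 i) (Real.rpow_nonneg (hrp' i).le _)
    rw [algRate_eq, algRate_eq, rateSum_succ]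
    exact this
  · have h3 := hslope i
    rw [algRate_eq, algRate_eq, rateSum_succ] at h3
    have := penalty_second_order h0 h1 (mass_pos (p := p) (t := t) hT i) (H.mass_le_one ht i)
      (one_le_rateSum (β := β) (p := p) (t := t) hT i) (hrp i) (hrp' i) (hrm i) h3
    rw [algRate_eq, algRate_eq, rateSum_succ]
    exact this

/-- The excess loss of one round over the player who only uses the arms in `U`. -/
theorem round_le (hU : U.Nonempty) :
    l t (a t) ≤ (subDist h0 h1 T U l p a t (a t) * l t (a t)
        + stabBound h0 h1 T U p t (a t)) / p t (a t) + penBound β T U p t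
      + (valGap h0 h1 T U l p a (t + 1) - valGap h0 h1 T U l p a t) := by
  have s1 := H.stab_le h0 h1 ht hU
  have s2 := H.pen_le h0 h1 ht hU
  have e := H.eq_pt h0 h1 ht
  have hpa := H.pos ht (a t)
  unfold Hybrid.stab at s1
  unfold Hybrid.pen at s2
  rw [← e, ← cumEst_succ, div_mul_cancel₀ _ hpa.ne'] at s1
  unfold valGap subDist
  rw [add_div]
  have e2 : (algHybrid β h0 h1).pt U (cumEst l p a t) (algRate β T p t) (a t) * l t (a t)
      / p t (a t) = l t (a t) / p t (a t)
        * (algHybrid β h0 h1).pt U (cumEst l p a t) (algRate β T p t) (a t) := by ring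
  rw [e2]
  linarith

end IsPath

end Path

/-! ### The boundary terms of the telescoping sum -/

section Boundary

variable {K : ℕ} {β : ℝ} {T : ℕ} {l p : ℕ → Fin K → ℝ} {a : ℕ → Fin K} {U : Finset (Fin K)}

theorem one_sub_two_mul_le_rpow {β ε : ℝ} (h0 : 0 < β) (h1 : β < 1) (hε0 : 0 ≤ ε)
    (hε : ε ≤ 1 / 2) : 1 - 2 * β * ε ≤ (1 - ε) ^ β := by
  have h := rpow_le_tangent (x := 1 - ε) (y := 1) h0.le h1.le (by linarith) zero_le_one
  rw [Real.one_rpow] at h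
  have h2 : (1 - ε) ^ (β - 1) ≤ 2 := by
    calc (1 - ε) ^ (β - 1) ≤ (1 / 2 : ℝ) ^ (β - 1) :=
          Real.rpow_le_rpow_of_nonpos (by norm_num) (by linarith) (by linarith)
      _ ≤ (1 / 2 : ℝ) ^ (-1 : ℝ) :=
          Real.rpow_le_rpow_of_exponent_ge (by norm_num) (by norm_num) (by linarith)
      _ = 2 := by rw [Real.rpow_neg_one]; norm_num
  have h3 : β * (1 - ε) ^ (β - 1) * (1 - (1 - ε)) ≤ β * 2 * ε := by
    have : 1 - (1 - ε) = ε := by ring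
    rw [this]
    gcongr
  linarith

namespace Hybrid

/-- The minimum over all distributions is at most that over the distributions on `U`, up to the
cost of moving a little mass to the other arms. -/
theorem val_univ_le {P : Hybrid} {L γ : Fin K → ℝ} (hγ : ∀ i, 0 ≤ γ i) (hL : ∀ i, 0 ≤ L i)
    (hU : U.Nonempty) (hT : 0 < T) (hV : Uᶜ.card ≤ T) :
    P.val Finset.univ L γ ≤ P.val U L γ + 1 / (2 * T) * ∑ i ∈ Uᶜ, L i
      + P.C * Uᶜ.card * Real.log (2 * T)
      + ∑ i ∈ U, (P.C + P.β / (1 - P.β) * γ i) * (Uᶜ.card / T) := by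
  have hC := P.C_pos
  have hb := P.one_sub_pos
  have hβ := P.β_pos
  have hVr : (Uᶜ.card : ℝ) ≤ T := by exact_mod_cast hV
  -- The total mass moved: each arm outside U receives 1/(2T), and the arms of U are scaled by 1 - ε
  -- ≥ 1/2.
  set ε : ℝ := Uᶜ.card / (2 * T) with hε
  have hε0 : 0 ≤ ε := by positivity
  have hε1 : ε ≤ 1 / 2 := by
    rw [hε, div_le_div_iff₀ (by positivity) (by norm_num)]; linarith
  have hε2 : (Uᶜ.card : ℝ) / T = 2 * ε := by rw [hε]; field_simp
  set q := P.pt U L γ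
  set y : Fin K → ℝ := fun i => if i ∈ U then (1 - ε) * q i else 1 / (2 * T) with hy
  have hq : ∀ i ∈ U, 0 < q i := fun i hi => pt_pos hγ hi
  have hyU : ∀ i ∈ U, y i = (1 - ε) * q i := fun i hi => if_pos hi
  have hyV : ∀ i ∈ Uᶜ, y i = 1 / (2 * T) := fun i hi => if_neg (Finset.mem_compl.1 hi)
  have hpos : ∀ i ∈ Finset.univ, 0 < y i := fun i _ => by
    by_cases hi : i ∈ U
    · rw [hyU i hi]; exact mul_pos (by linarith) (hq i hi)
    · rw [hyV i (Finset.mem_compl.2 hi)]; positivity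
  have hsum : ∑ i, y i = 1 := by
    rw [← Finset.sum_add_sum_compl U, Finset.sum_congr rfl hyU, Finset.sum_congr rfl hyV,
      ← Finset.mul_sum, sum_pt hγ hU, Finset.sum_const, nsmul_eq_mul, hε]
    ring
  refine (val_le_obj hγ (hU.mono (Finset.subset_univ U)) hpos hsum).trans ?_
  unfold obj
  rw [← Finset.sum_add_sum_compl U]
  have c1 : ∀ i ∈ U, y i * L i + P.reg (γ i) (y i) ≤ (q i * L i + P.reg (γ i) (q i))
      + (P.C + P.β / (1 - P.β) * γ i) * (Uᶜ.card / T) := fun i hi => by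
    have hqi := hq i hi
    have hγi := hγ i
    rw [hyU i hi, hε2]
    have e1 : (1 - ε) * q i * L i ≤ q i * L i := by
      have := mul_nonneg hqi.le (hL i)
      nlinarith
    have e2 : -Real.log (1 - ε) ≤ 2 * ε := by
      have := Real.log_le_sub_one_of_pos (show 0 < (1 - ε)⁻¹ by
        have : 0 < 1 - ε := by linarith
        positivity)
      rw [Real.log_inv] at this
      have h3 : (1 - ε)⁻¹ ≤ 1 + 2 * ε := by
        rw [inv_le_iff_one_le_mul₀ (by linarith)]
        nlinarith
      linarith
    have e3 : (1 - 2 * P.β * ε) * q i ^ P.β ≤ ((1 - ε) * q i) ^ P.β := by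
      rw [Real.mul_rpow (by linarith) hqi.le]
      have := one_sub_two_mul_le_rpow hβ P.β_lt hε0 hε1
      gcongr
    have e4 : q i ^ P.β ≤ 1 := Real.rpow_le_one hqi.le (pt_le_one hγ i) hβ.le
    unfold reg
    rw [Real.log_mul (by linarith) hqi.ne']
    have e5 : 1 / (1 - P.β) * (γ i * ((1 - 2 * P.β * ε) * q i ^ P.β))
        ≤ 1 / (1 - P.β) * (γ i * ((1 - ε) * q i) ^ P.β) := by gcongr
    have e6 : 1 / (1 - P.β) * (γ i * ((1 - 2 * P.β * ε) * q i ^ P.β))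
        = 1 / (1 - P.β) * (γ i * q i ^ P.β) - P.β / (1 - P.β) * γ i * (2 * ε) * q i ^ P.β := by
      ring
    have e7 : P.β / (1 - P.β) * γ i * (2 * ε) * q i ^ P.β ≤ P.β / (1 - P.β) * γ i * (2 * ε) * 1 := by
      gcongr
    have e8 : P.C * -Real.log (1 - ε) ≤ P.C * (2 * ε) := by gcongr
    linarith
  have c2 : ∀ i ∈ Uᶜ, y i * L i + P.reg (γ i) (y i)
      ≤ 1 / (2 * T) * L i + P.C * Real.log (2 * T) := fun i hi => by
    rw [hyV i hi]
    unfold reg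
    have hγi := hγ i
    have : 0 ≤ 1 / (1 - P.β) * (γ i * (1 / (2 * T) : ℝ) ^ P.β) := by positivity
    rw [one_div (2 * (T : ℝ)), Real.log_inv] at *
    linarith
  have s1 := (Finset.sum_le_sum c1).trans_eq Finset.sum_add_distrib
  have s2 := (Finset.sum_le_sum c2).trans_eq Finset.sum_add_distrib
  rw [← Finset.mul_sum, Finset.sum_const, nsmul_eq_mul] at s2
  unfold val obj
  linarith

/-- Test the uniform distribution on U, and bound the full minimum below by log v ≤ v - 1 at v = K
p_i. The negative term C |Uᶜ| log K is kept: it later turns log(2T) into log(2T/K), which the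
logarithm-free case β = 1/2 requires. -/
theorem val_zero_sub_le {P : Hybrid} {g : ℝ} (hg : 0 ≤ g) (hU : U.Nonempty) :
    P.val U (fun _ => 0) (fun _ => g) - P.val (Finset.univ : Finset (Fin K)) (fun _ => 0) (fun _ => g)
      ≤ 1 / (1 - P.β) * g * K - P.C * Uᶜ.card * Real.log K := by
  have hC := P.C_pos
  have hb := P.one_sub_pos
  have hβ := P.β_pos
  have hγ : ∀ _ : Fin K, 0 ≤ g := fun _ => hg
  have hn : (0 : ℝ) < U.card := by exact_mod_cast hU.card_pos
  have hKn : U.card ≤ K := by simpa using Finset.card_le_univ U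
  have hK : (0 : ℝ) < K := hn.trans_le (by exact_mod_cast hKn)
  have hcard : (U.card : ℝ) + Uᶜ.card = K := by
    have := Finset.card_add_card_compl U
    rw [Fintype.card_fin] at this
    exact_mod_cast this
  have u1 : P.val U (fun _ => 0) (fun _ => g) ≤ P.C * U.card * Real.log K := by
    refine (val_le_obj hγ hU (y := fun _ => 1 / (U.card : ℝ)) (fun i _ => by positivity) ?_).trans ?_
    · rw [Finset.sum_const, nsmul_eq_mul]; field_simp
    · unfold obj reg
      rw [Finset.sum_const, nsmul_eq_mul, one_div (U.card : ℝ), Real.log_inv]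
      have h1 : 0 ≤ 1 / (1 - P.β) * (g * ((U.card : ℝ)⁻¹) ^ P.β) := by positivity
      have h2 : Real.log U.card ≤ Real.log K := Real.log_le_log hn (by exact_mod_cast hKn)
      have h3 : P.C * Real.log U.card ≤ P.C * Real.log K := by gcongr
      have h4 : (U.card : ℝ) * (((U.card : ℝ)⁻¹ * 0 + (-P.C * -Real.log U.card
          - 1 / (1 - P.β) * (g * ((U.card : ℝ)⁻¹) ^ P.β)))) ≤ U.card * (P.C * Real.log K) := by
        gcongr
        linarith
      linarith
  have u2 : P.C * K * Real.log K - 1 / (1 - P.β) * g * K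
      ≤ P.val (Finset.univ : Finset (Fin K)) (fun _ => 0) (fun _ => g) := by
    have hW := hU.mono (Finset.subset_univ U)
    have hs := sum_pt (P := P) (L := fun _ => 0) hγ hW
    unfold val obj reg
    have h1 : ∀ i ∈ (Finset.univ : Finset (Fin K)),
        P.C * Real.log K - P.C * (K * P.pt (Finset.univ : Finset (Fin K)) (fun _ => 0) (fun _ => g) i - 1)
          - 1 / (1 - P.β) * g
        ≤ P.pt (Finset.univ : Finset (Fin K)) (fun _ => 0) (fun _ => g) i * 0
          + (-P.C * Real.log (P.pt (Finset.univ : Finset (Fin K)) (fun _ => 0) (fun _ => g) i)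
            - 1 / (1 - P.β) * (g * P.pt (Finset.univ : Finset (Fin K)) (fun _ => 0) (fun _ => g) i ^ P.β)) :=
      fun i hi => by
        have hx := pt_pos (P := P) (L := fun _ => 0) hγ hi
        have hx1 := pt_le_one (P := P) (W := Finset.univ) (L := fun _ => 0) hγ i
        have h2 := Real.log_le_sub_one_of_pos (mul_pos hK hx)
        rw [Real.log_mul hK.ne' hx.ne'] at h2
        have h3 := Real.rpow_le_one hx.le hx1 hβ.le
        have h4 := mul_le_mul_of_nonneg_left h2 hC.le
        have h5 : 1 / (1 - P.β) * (g * P.pt (Finset.univ : Finset (Fin K)) (fun _ => 0) (fun _ => g) i ^ P.β)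
          ≤ 1 / (1 - P.β) * (g * 1) := by gcongr
        linarith
    have h2 := Finset.sum_le_sum h1
    simp only [Finset.sum_sub_distrib, ← Finset.mul_sum, hs, Finset.sum_const, Finset.card_univ,
      Fintype.card_fin, nsmul_eq_mul] at h2
    have e0 : P.C * (K * 1 - K * 1) = 0 := by ring
    rw [e0] at h2
    refine le_trans (le_of_eq ?_) h2
    ring
  have e : P.C * Uᶜ.card * Real.log K = P.C * K * Real.log K - P.C * U.card * Real.log K := by
    rw [← hcard]; ring
  linarith

end Hybrid

/-- The additive constant in the regret bound. -/
def boundaryCost (β : ℝ) (T K : ℕ) (U : Finset (Fin K)) : ℝ :=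
  162 * β / (1 - β) * Uᶜ.card * Real.log (2 * T / K) + 162 * β / (1 - β) * U.card
    + 2 * √(β / (1 - β)) * U.card * Uᶜ.card + kappa β * K

theorem rpow_le_natCast (h1 : β < 1) (hT : 0 < T) {m : ℝ} (hm : 1 / (T : ℝ) ≤ m)
    (hm1 : m ≤ 1) : m ^ (1 - 2 * β) ≤ T := by
  have hTr : (0 : ℝ) < T := by exact_mod_cast hT
  have hT1 : (1 : ℝ) ≤ T := by exact_mod_cast hT
  have hm0 : 0 < m := lt_of_lt_of_le (by positivity) hm
  rcases le_or_gt 0 (1 - 2 * β) with h | h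
  · exact (Real.rpow_le_one hm0.le hm1 h).trans hT1
  · calc m ^ (1 - 2 * β) ≤ (1 / (T : ℝ)) ^ (1 - 2 * β) :=
          Real.rpow_le_rpow_of_nonpos (by positivity) hm h.le
      _ = (T : ℝ) ^ (2 * β - 1) := by
        rw [one_div, Real.inv_rpow hTr.le, ← Real.rpow_neg hTr.le]; congr 1; ring
      _ ≤ (T : ℝ) ^ (1 : ℝ) := Real.rpow_le_rpow_of_exponent_le hT1 (by linarith)
      _ = T := Real.rpow_one _

namespace IsPath

variable (H : IsPath β T l p a) (h0 : 0 < β) (h1 : β < 1)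
include H

theorem rateSum_le (h1 : β < 1) (hT : 0 < T) {t : ℕ} (ht : t ≤ T) (i : Fin K) :
    rateSum β T p t i ≤ 1 + T * T := by
  have : ∑ τ ∈ Finset.range t, mass T p τ i ^ (1 - 2 * β) ≤ ∑ τ ∈ Finset.range t, (T : ℝ) :=
    Finset.sum_le_sum fun τ hτ => rpow_le_natCast h1 hT (le_max_right _ _)
      (H.mass_le_one ((Finset.mem_range.1 hτ).trans_le ht) i)
  rw [Finset.sum_const, Finset.card_range, nsmul_eq_mul] at this
  have h3 : (t : ℝ) * T ≤ T * T := by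
    have : (t : ℝ) ≤ T := by exact_mod_cast ht
    gcongr
  unfold rateSum
  linarith

theorem cumEst_nonneg {t : ℕ} (ht : t ≤ T) (i : Fin K) : 0 ≤ cumEst l p a t i :=
  Finset.sum_nonneg fun τ hτ => by
    have hτT := (Finset.mem_range.1 hτ).trans_le ht
    unfold lossEst
    split_ifs
    · exact div_nonneg (H.loss_mem τ hτT i).1 (H.pos hτT i).le
    · exact le_rfl

theorem valGap_sub_le (hKT : K ≤ T) (hU : U.Nonempty) :
    valGap h0 h1 T U l p a T - valGap h0 h1 T U l p a 0
      ≤ 1 / (2 * T) * ∑ i ∈ Uᶜ, cumEst l p a T i + boundaryCost β T K U := by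
  have hb : 0 < 1 - β := by linarith
  have hn : 0 < U.card := hU.card_pos
  have hKn : U.card ≤ K := by simpa using Finset.card_le_univ U
  have hT : 0 < T := by omega
  have hK : 0 < K := by omega
  have hTr : (0 : ℝ) < T := by exact_mod_cast hT
  have hT1 : (1 : ℝ) ≤ T := by exact_mod_cast hT
  have hKr : (0 : ℝ) < K := by exact_mod_cast hK
  have hcard : U.card + Uᶜ.card = K := by
    have := Finset.card_add_card_compl U
    rwa [Fintype.card_fin] at this
  have hVT : Uᶜ.card ≤ T := by omega
  have b1 := Hybrid.val_univ_le (P := algHybrid β h0 h1) (L := cumEst l p a T)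
    (γ := algRate β T p T) (fun i => algRate_nonneg i) (fun i => H.cumEst_nonneg le_rfl i) hU hT hVT
  have hθb : β / (1 - β) * √((1 - β) / β) = √(β / (1 - β)) := by
    have e : β / (1 - β) = √(β / (1 - β)) * √(β / (1 - β)) :=
      (Real.mul_self_sqrt (by positivity)).symm
    have e2 : √(β / (1 - β)) * √((1 - β) / β) = 1 := by
      rw [← Real.sqrt_mul (by positivity)]
      have : β / (1 - β) * ((1 - β) / β) = 1 := by field_simp
      rw [this, Real.sqrt_one]
    calc _ = √(β / (1 - β)) * √(β / (1 - β)) * √((1 - β) / β) := by rw [← e]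
      _ = √(β / (1 - β)) * (√(β / (1 - β)) * √((1 - β) / β)) := by ring
      _ = _ := by rw [e2, mul_one]
  have hθk : 1 / (1 - β) * √((1 - β) / β) = kappa β := by
    rw [sqrt_ratio_eq h0 h1]; unfold kappa; field_simp
  -- Since S ≤ 1 + T², the final rate is at most 2 θ T. The factor T cancels against the moved mass
  -- |Uᶜ| / T and leaves the term of order |U| |Uᶜ|, at most K².
  have hγT : ∀ i, β / (1 - β) * algRate β T p T i ≤ √(β / (1 - β)) * (2 * T) := fun i => by
    rw [algRate_eq, ← mul_assoc, hθb]
    refine mul_le_mul_of_nonneg_left ?_ (Real.sqrt_nonneg _)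
    rw [Real.sqrt_le_left (by positivity)]
    have := H.rateSum_le h1 hT le_rfl i
    nlinarith
  have b2 : ∑ i ∈ U, ((algHybrid β h0 h1).C + (algHybrid β h0 h1).β / (1 - (algHybrid β h0 h1).β)
        * algRate β T p T i) * (Uᶜ.card / T)
      ≤ 162 * β / (1 - β) * U.card + 2 * √(β / (1 - β)) * U.card * Uᶜ.card := by
    calc _ ≤ ∑ i ∈ U, (162 * β / (1 - β) * 1 + 2 * √(β / (1 - β)) * Uᶜ.card) := by
          refine Finset.sum_le_sum fun i _ => ?_
          have hv : (Uᶜ.card : ℝ) / T ≤ 1 :=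
            div_le_one_of_le₀ (by exact_mod_cast hVT) hTr.le
          have hv0 : 0 ≤ (Uᶜ.card : ℝ) / T := by positivity
          rw [add_mul]
          refine add_le_add ?_ ?_
          · change 162 * β / (1 - β) * _ ≤ _
            gcongr
          · change β / (1 - β) * algRate β T p T i * _ ≤ _
            calc _ ≤ √(β / (1 - β)) * (2 * T) * (Uᶜ.card / T) :=
                  mul_le_mul_of_nonneg_right (hγT i) hv0
              _ = _ := by field_simp
      _ = _ := by rw [Finset.sum_const, nsmul_eq_mul]; ring
  have hγ0 : algRate β T p 0 = fun _ => √((1 - β) / β) := by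
    funext i; rw [algRate_eq]; simp [rateSum]
  have b3 := Hybrid.val_zero_sub_le (P := algHybrid β h0 h1) (U := U)
    (Real.sqrt_nonneg ((1 - β) / β)) hU
  have e3 : 1 / (1 - (algHybrid β h0 h1).β) * √((1 - β) / β) = kappa β := hθk
  rw [e3] at b3
  have e4 : (algHybrid β h0 h1).C = 162 * β / (1 - β) := rfl
  rw [e4] at b1 b3
  rw [e4] at b2
  have hlog : Real.log (2 * T / K) = Real.log (2 * T) - Real.log K :=
    Real.log_div (by positivity) hKr.ne'
  unfold valGap boundaryCost
  rw [hγ0, cumEst_zero, hlog]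
  linarith

/-- The regret of the learner along the path, up to the importance weighting. -/
theorem sum_loss_le (hKT : K ≤ T) (hU : U.Nonempty) :
    ∑ t ∈ Finset.range T, l t (a t)
      ≤ ∑ t ∈ Finset.range T, (subDist h0 h1 T U l p a t (a t) * l t (a t)
          + stabBound h0 h1 T U p t (a t)) / p t (a t)
        + ∑ t ∈ Finset.range T, penBound β T U p t
        + 1 / (2 * T) * ∑ i ∈ Uᶜ, cumEst l p a T i + boundaryCost β T K U := by
  have h := Finset.sum_le_sum fun t (ht : t ∈ Finset.range T) =>
    H.round_le h0 h1 (Finset.mem_range.1 ht) hU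
  rw [Finset.sum_add_distrib, Finset.sum_add_distrib,
    Finset.sum_range_sub (valGap h0 h1 T U l p a)] at h
  linarith [H.valGap_sub_le h0 h1 hKT hU]

end IsPath

end Boundary

/-! ### Summing the cost of the rounds -/

section Costs

variable {K : ℕ} {β : ℝ} {T : ℕ} {l p : ℕ → Fin K → ℝ} {a : ℕ → Fin K} {U : Finset (Fin K)} {t : ℕ}

/-- The bound on the conditional expectation of the cost of a round. -/
def roundCost (h0 : 0 < β) (h1 : β < 1) (T : ℕ) (U : Finset (Fin K)) (p : ℕ → Fin K → ℝ)
    (t : ℕ) : ℝ :=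
  ∑ i, stabBound h0 h1 T U p t i + penBound β T U p t

/-- AM-GM with a free weight, chosen later from the gaps. -/
theorem mul_sqrt_mul_le {c x y η : ℝ} (hx : 0 ≤ x) (hy : 0 ≤ y) (hη : 0 < η) :
    2 * c * √(x * y) ≤ η * x + c ^ 2 * y / η := by
  rw [Real.sqrt_mul hx]
  have h1 := Real.sq_sqrt hx
  have h2 := Real.sq_sqrt hy
  have e : η * x + c ^ 2 * y / η - 2 * c * (√x * √y) = (η * √x - c * √y) ^ 2 / η := by
    rw [sub_sq, mul_pow, mul_pow, h1, h2]
    field_simp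
    ring
  have : 0 ≤ (η * √x - c * √y) ^ 2 / η := by positivity
  linarith

theorem rateStep_nonneg (hT : 0 < T) (i : Fin K) : 0 ≤ rateStep β T p t i := by
  have h1 : 0 < mass T p t i ^ (1 - 2 * β) := Real.rpow_pos_of_pos (mass_pos hT i) _
  have h2 := one_le_rateSum (β := β) (p := p) (t := t) hT i
  unfold rateStep
  positivity

theorem kappa_nonneg : 0 ≤ kappa β := Real.sqrt_nonneg _

theorem share_nonneg (h0 : 0 < β) (h1 : β < 1) (hp : ∀ i, 0 < p t i) (i : Fin K) :
    0 ≤ share h0 h1 T U p t i := by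
  have hw := fun i => (Hybrid.icurv_pos (P := algHybrid β h0 h1)
    (fun i => algRate_nonneg (β := β) (T := T) (p := p) (t := t) i) hp i).le
  exact div_nonneg (hw i) (Finset.sum_nonneg fun j _ => hw j)

theorem sum_share (h0 : 0 < β) (h1 : β < 1) (hp : ∀ i, 0 < p t i) (hU : U.Nonempty) :
    ∑ i ∈ U, share h0 h1 T U p t i = 1 := by
  have hw := fun i => (Hybrid.icurv_pos (P := algHybrid β h0 h1)
    (fun i => algRate_nonneg (β := β) (T := T) (p := p) (t := t) i) hp i)
  unfold share
  rw [← Finset.sum_div]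
  exact div_self (Finset.sum_pos (fun j _ => hw j) hU).ne'

/-- The shares sum to 1 over U, so the first part of the stability bounds of U adds up to 12κR; the
outside arms add 2κR and the penalty 6κR. AM-GM on 20κR produces the constant 100. The cross terms
are split with weight η₀, and the shares again sum to 1. -/
theorem roundCost_le (h0 : 0 < β) (h1 : β < 1) (hT : 0 < T) (hp : ∀ i, 0 < p t i)
    (hU : U.Nonempty) {η : Fin K → ℝ} {η₀ : ℝ} (hη : ∀ i ∈ Uᶜ, 0 < η i) (hη₀ : 0 < η₀) :
    roundCost h0 h1 T U p t
      ≤ ∑ i ∈ Uᶜ, (η i * mass T p t i + 100 * kappa β ^ 2 / η i * rateStep β T p t i)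
        + η₀ * ∑ i ∈ Uᶜ, p t i
        + ∑ i ∈ U, (9 * kappa β ^ 2 / η₀ * rateStep β T p t i
          + 3 * (mass T p t i * rateStep β T p t i) + 1 / T) := by
  have hy : ∀ i, 0 ≤ rateStep β T p t i := fun i => rateStep_nonneg hT i
  have hm : ∀ i, 0 ≤ mass T p t i := fun i => (mass_pos hT i).le
  have hs := share_nonneg (T := T) (U := U) h0 h1 hp
  have hPV : 0 ≤ ∑ i ∈ Uᶜ, p t i := Finset.sum_nonneg fun i _ => (hp i).le
  set R := ∑ j ∈ Uᶜ, √(mass T p t j * rateStep β T p t j) with hR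
  have e1 : ∑ j ∈ Uᶜ, 2 * kappa β * √(mass T p t j * rateStep β T p t j) = 2 * kappa β * R := by
    rw [hR, Finset.mul_sum]
  have e2 : ∑ j ∈ Uᶜ, 6 * kappa β * √(mass T p t j * rateStep β T p t j) = 6 * kappa β * R := by
    rw [hR, Finset.mul_sum]
  have hUs : ∑ i ∈ U, stabBound h0 h1 T U p t i
      ≤ 12 * kappa β * R + η₀ * ∑ i ∈ Uᶜ, p t i
        + ∑ i ∈ U, (9 * kappa β ^ 2 / η₀ * rateStep β T p t i
          + 2 * (mass T p t i * rateStep β T p t i) + 1 / T) := by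
    have h2 : ∀ i ∈ U, stabBound h0 h1 T U p t i
        ≤ share h0 h1 T U p t i * (12 * kappa β * R + η₀ * ∑ i ∈ Uᶜ, p t i)
          + (9 * kappa β ^ 2 / η₀ * rateStep β T p t i
            + 2 * (mass T p t i * rateStep β T p t i) + 1 / T) := fun i hi => by
      unfold stabBound
      rw [if_pos hi, e1, mul_comm (√(rateStep β T p t i)), ← Real.sqrt_mul (by
        have := hs i; positivity)]
      have := mul_sqrt_mul_le (c := 3 * kappa β) (x := share h0 h1 T U p t i * ∑ i ∈ Uᶜ, p t i)
        (by have := hs i; positivity) (hy i) hη₀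
      have e3 : (3 * kappa β) ^ 2 * rateStep β T p t i / η₀
        = 9 * kappa β ^ 2 / η₀ * rateStep β T p t i := by ring
      rw [e3] at this
      linarith
    refine (Finset.sum_le_sum h2).trans (le_of_eq ?_)
    rw [Finset.sum_add_distrib, ← Finset.sum_mul, sum_share h0 h1 hp hU, one_mul]
  have hVs : ∑ i ∈ Uᶜ, stabBound h0 h1 T U p t i = 2 * kappa β * R := by
    rw [← e1]
    refine Finset.sum_congr rfl fun i hi => ?_
    unfold stabBound
    rw [if_neg (Finset.mem_compl.1 hi)]
  have hRb : 20 * kappa β * R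
      ≤ ∑ i ∈ Uᶜ, (η i * mass T p t i + 100 * kappa β ^ 2 / η i * rateStep β T p t i) := by
    rw [hR, Finset.mul_sum]
    refine Finset.sum_le_sum fun i hi => ?_
    have := mul_sqrt_mul_le (c := 10 * kappa β) (hm i) (hy i) (hη i hi)
    have e3 : (10 * kappa β) ^ 2 * rateStep β T p t i / η i
        = 100 * kappa β ^ 2 / η i * rateStep β T p t i := by ring
    rw [e3] at this
    linarith
  unfold roundCost penBound
  rw [← Finset.sum_add_sum_compl U, hVs, e2]
  have e4 : ∀ i, (9 * kappa β ^ 2 / η₀ * rateStep β T p t i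
          + 3 * (mass T p t i * rateStep β T p t i) + 1 / (T : ℝ))
      = (9 * kappa β ^ 2 / η₀ * rateStep β T p t i
          + 2 * (mass T p t i * rateStep β T p t i) + 1 / T)
        + mass T p t i * rateStep β T p t i := fun i => by ring
  simp only [e4]
  rw [Finset.sum_add_distrib (s := U) (g := fun i => mass T p t i * rateStep β T p t i)]
  linarith

/-- The step equals 1 - S_t / S_{t+1}, and 1 - v ≤ -log v. Summation over rounds telescopes. -/
theorem rateStep_le_log (hT : 0 < T) (i : Fin K) :
    rateStep β T p t i ≤ Real.log (rateSum β T p (t + 1) i) - Real.log (rateSum β T p t i) := by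
  have h1 : 0 < mass T p t i ^ (1 - 2 * β) := Real.rpow_pos_of_pos (mass_pos hT i) _
  have h2 := one_le_rateSum (β := β) (p := p) (t := t) hT i
  have hS : 0 < rateSum β T p t i := by linarith
  have hS' : 0 < rateSum β T p (t + 1) i := by rw [rateSum_succ]; linarith
  have h3 := Real.log_le_sub_one_of_pos (div_pos hS hS')
  rw [Real.log_div hS.ne' hS'.ne'] at h3
  have e : rateStep β T p t i = 1 - rateSum β T p t i / rateSum β T p (t + 1) i := by
    unfold rateStep
    rw [rateSum_succ] at *
    field_simp
    ring
  linarith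

theorem two_mul_log_two_le : 1 ≤ 2 * Real.log 2 := by
  have := Real.log_two_gt_d9
  linarith

theorem IsPath.sum_rateStep_le (H : IsPath β T l p a) (h1 : β < 1) (hT : 2 ≤ T) (i : Fin K) :
    ∑ t ∈ Finset.range T, rateStep β T p t i ≤ 3 * Real.log T := by
  have hT0 : 0 < T := by omega
  have hTr : (2 : ℝ) ≤ T := by exact_mod_cast hT
  have h := Finset.sum_le_sum fun t (_ : t ∈ Finset.range T) =>
    rateStep_le_log (β := β) (p := p) (t := t) hT0 i
  rw [Finset.sum_range_sub (fun t => Real.log (rateSum β T p t i))] at h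
  have e : rateSum β T p 0 i = 1 := by simp [rateSum]
  rw [e, Real.log_one, sub_zero] at h
  refine h.trans ?_
  have h2 := H.rateSum_le h1 hT0 le_rfl i
  -- From S ≤ 1 + T²; this is where T ≥ 2 is needed and where the 3 in 3 log T comes from.
  have h3 : rateSum β T p T i ≤ (T : ℝ) ^ 3 := by
    refine h2.trans ?_
    nlinarith [sq_nonneg ((T : ℝ) - 2)]
  have h4 := one_le_rateSum (β := β) (p := p) (t := T) hT0 i
  calc Real.log (rateSum β T p T i) ≤ Real.log ((T : ℝ) ^ 3) :=
        Real.log_le_log (by linarith) h3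
    _ = _ := by rw [Real.log_pow]; norm_num

theorem mass_le_add (i : Fin K) (hp : 0 < p t i) : mass T p t i ≤ p t i + 1 / T := by
  refine max_le ?_ ?_
  · have : (0 : ℝ) ≤ 1 / T := by positivity
    linarith
  · linarith

/-- The cost of the game in terms of the arms outside `U`, with free weights. -/
theorem IsPath.sum_roundCost_le (H : IsPath β T l p a) (h0 : 0 < β) (h1 : β < 1) (hT : 2 ≤ T)
    (hU : U.Nonempty) {η : Fin K → ℝ} {η₀ : ℝ} (hη : ∀ i ∈ Uᶜ, 0 < η i) (hη₀ : 0 < η₀) :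
    ∑ t ∈ Finset.range T, roundCost h0 h1 T U p t
      ≤ ∑ i ∈ Uᶜ, (η i * (∑ t ∈ Finset.range T, p t i + 1)
            + 300 * kappa β ^ 2 * Real.log T / η i)
        + η₀ * ∑ i ∈ Uᶜ, ∑ t ∈ Finset.range T, p t i
        + U.card * (27 * kappa β ^ 2 * Real.log T / η₀ + 9 * Real.log T + 1) := by
  have hT0 : 0 < T := by omega
  have hy := fun i => H.sum_rateStep_le h1 hT i
  have h := Finset.sum_le_sum fun t (ht : t ∈ Finset.range T) =>
    roundCost_le (p := p) (t := t) h0 h1 hT0 (H.pos (Finset.mem_range.1 ht)) hU hη hη₀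
  refine h.trans ?_
  rw [Finset.sum_add_distrib, Finset.sum_add_distrib, Finset.sum_comm, ← Finset.mul_sum,
    Finset.sum_comm (s := Finset.range T) (t := Uᶜ) (f := fun t i => p t i),
    Finset.sum_comm (s := Finset.range T) (t := U)]
  refine add_le_add (add_le_add (Finset.sum_le_sum fun i hi => ?_) le_rfl) ?_
  · rw [Finset.sum_add_distrib, ← Finset.mul_sum, ← Finset.mul_sum]
    have hηi := hη i hi
    refine add_le_add (mul_le_mul_of_nonneg_left ?_ hηi.le) ?_
    · have : ∑ t ∈ Finset.range T, mass T p t i ≤ ∑ t ∈ Finset.range T, (p t i + 1 / T) :=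
        Finset.sum_le_sum fun t ht => mass_le_add i (H.pos (Finset.mem_range.1 ht) i)
      refine this.trans (le_of_eq ?_)
      rw [Finset.sum_add_distrib, Finset.sum_const, Finset.card_range, nsmul_eq_mul]
      field_simp
    · calc _ ≤ 100 * kappa β ^ 2 / η i * (3 * Real.log T) := by
            refine mul_le_mul_of_nonneg_left (hy i) (by positivity)
        _ = _ := by ring
  · rw [← nsmul_eq_mul, ← Finset.sum_const]
    refine Finset.sum_le_sum fun i _ => ?_
    have h2 : ∑ t ∈ Finset.range T, (9 * kappa β ^ 2 / η₀ * rateStep β T p t i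
          + 3 * (mass T p t i * rateStep β T p t i) + 1 / (T : ℝ))
        ≤ ∑ t ∈ Finset.range T, ((9 * kappa β ^ 2 / η₀ + 3) * rateStep β T p t i + 1 / (T : ℝ)) := by
      refine Finset.sum_le_sum fun t ht => ?_
      have h3 := H.mass_le_one (Finset.mem_range.1 ht) i
      have h4 := rateStep_nonneg (β := β) (p := p) (t := t) hT0 i
      nlinarith
    refine h2.trans ?_
    rw [Finset.sum_add_distrib, ← Finset.mul_sum, Finset.sum_const, Finset.card_range,
      nsmul_eq_mul]
    have h5 : (9 * kappa β ^ 2 / η₀ + 3) * ∑ t ∈ Finset.range T, rateStep β T p t i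
        ≤ (9 * kappa β ^ 2 / η₀ + 3) * (3 * Real.log T) :=
      mul_le_mul_of_nonneg_left (hy i) (by positivity)
    have e : (T : ℝ) * (1 / T) = 1 := by field_simp
    rw [e]
    refine (add_le_add_left h5 1).trans (le_of_eq ?_)
    ring

theorem sum_inv_sqrt_le (n : ℕ) : ∑ t ∈ Finset.range n, 1 / √((t : ℝ) + 2) ≤ 2 * √n := by
  have h : ∀ t ∈ Finset.range n, 1 / √((t : ℝ) + 2) ≤ 2 * √((t + 1 : ℕ) : ℝ) - 2 * √(t : ℝ) :=
    fun t _ => by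
      have h1 : √(t : ℝ) ≤ √((t + 1 : ℕ) : ℝ) := Real.sqrt_le_sqrt (by push_cast; linarith)
      have h2 : √((t + 1 : ℕ) : ℝ) ≤ √((t : ℝ) + 2) := Real.sqrt_le_sqrt (by push_cast; linarith)
      have h3 : 0 < √((t : ℝ) + 2) := Real.sqrt_pos.2 (by positivity)
      have h4 := Real.sq_sqrt (show (0 : ℝ) ≤ (t : ℝ) by positivity)
      have h5 := Real.sq_sqrt (show (0 : ℝ) ≤ ((t + 1 : ℕ) : ℝ) by positivity)
      push_cast at *
      rw [div_le_iff₀ h3]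
      nlinarith
  refine (Finset.sum_le_sum h).trans (le_of_eq ?_)
  rw [Finset.sum_range_sub (fun t : ℕ => 2 * √(t : ℝ))]
  simp

/-- For the exponent `1 / 2` there is no logarithm in the worst case. -/
theorem IsPath.sum_roundCost_half_le (H : IsPath (1 / 2) T l p a)
    (h0 : (0 : ℝ) < 1 / 2) (h1 : (1 / 2 : ℝ) < 1)
    (hKT : K ≤ T) (i₀ : Fin K) :
    ∑ t ∈ Finset.range T, roundCost h0 h1 T {i₀} p t ≤ 1000 * √(K * T) := by
  have hK0 : 0 < K := i₀.pos
  have hT0 : 0 < T := by omega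
  have hTr : (0 : ℝ) < T := by exact_mod_cast hT0
  have hKr : (0 : ℝ) < K := by exact_mod_cast hK0
  have hK1 : (1 : ℝ) ≤ K := by exact_mod_cast hK0
  have hKTr : (K : ℝ) ≤ T := by exact_mod_cast hKT
  have hk : kappa (1 / 2) ^ 2 = 4 := by
    unfold kappa; rw [kappa_sq h0 h1]; norm_num
  -- The exponent 1 - 2β vanishes, so S = 1 + t is deterministic and the AM-GM weight may depend on
  -- the round.
  have hy : ∀ t i, rateStep (1 / 2) T p t i = 1 / ((t : ℝ) + 2) := fun t i => by
    unfold rateStep rateSum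
    norm_num
    rw [show (1 : ℝ) + t + 1 = t + 2 by ring]
  have key : ∀ t ∈ Finset.range T, roundCost h0 h1 T {i₀} p t
      ≤ 442 * √K * (1 / √((t : ℝ) + 2)) + 1 / T := fun t ht => by
    have htT := Finset.mem_range.1 ht
    set s := √((t : ℝ) + 2) with hs
    have hs0 : 0 < s := Real.sqrt_pos.2 (by positivity)
    have hs2 : s ^ 2 = (t : ℝ) + 2 := Real.sq_sqrt (by positivity)
    have hs1 : 1 ≤ s := by
      nlinarith
    have hk0 : 0 < √(K : ℝ) := Real.sqrt_pos.2 hKr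
    have hk2 : √(K : ℝ) ^ 2 = K := Real.sq_sqrt hKr.le
    have hk1 : 1 ≤ √(K : ℝ) := by nlinarith
    -- The weight √(K/(t+2)) balances η times the total mass, which is at most 2, against 400 K / (η
    -- (t+2)).
    have hη : 0 < √K / s := by positivity
    have h := roundCost_le (p := p) (t := t) (U := {i₀}) h0 h1 hT0 (H.pos htT)
      (Finset.singleton_nonempty i₀) (η := fun _ => √K / s) (η₀ := √K / s) (fun _ _ => hη) hη
    refine h.trans ?_
    simp only [hk, hy, ← hs2, Finset.sum_singleton]
    rw [Finset.sum_add_distrib, ← Finset.mul_sum, Finset.sum_const, nsmul_eq_mul]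
    have hsubset : ∀ f : Fin K → ℝ, (∀ i, 0 ≤ f i) → ∑ i ∈ ({i₀} : Finset (Fin K))ᶜ, f i ≤ ∑ i, f i :=
      fun f hf => Finset.sum_le_sum_of_subset_of_nonneg (Finset.subset_univ _) fun i _ _ => hf i
    have m1 : ∑ i ∈ ({i₀} : Finset (Fin K))ᶜ, mass T p t i ≤ 2 := by
      refine (hsubset _ fun i => (mass_pos hT0 i).le).trans ?_
      have := Finset.sum_le_sum fun i (_ : i ∈ (Finset.univ : Finset (Fin K))) =>
        mass_le_add (T := T) i (H.pos htT i)
      rw [Finset.sum_add_distrib, H.sum_eq htT, Finset.sum_const, Finset.card_univ,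
        Fintype.card_fin, nsmul_eq_mul] at this
      have h2 : (K : ℝ) * (1 / T) ≤ 1 := by
        rw [mul_one_div]; exact div_le_one_of_le₀ hKTr hTr.le
      linarith
    have m2 : ∑ i ∈ ({i₀} : Finset (Fin K))ᶜ, p t i ≤ 1 := by
      rw [← H.sum_eq htT]
      exact hsubset _ fun i => (H.pos htT i).le
    have m3 : ((({i₀} : Finset (Fin K))ᶜ.card : ℕ) : ℝ) ≤ K := by
      have := Finset.card_le_univ (({i₀} : Finset (Fin K))ᶜ)
      rw [Fintype.card_fin] at this
      exact_mod_cast this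
    have m4 := H.mass_le_one htT i₀
    have n1 : √K / s * ∑ i ∈ ({i₀} : Finset (Fin K))ᶜ, mass T p t i ≤ √K / s * 2 := by gcongr
    have n2 : √K / s * ∑ i ∈ ({i₀} : Finset (Fin K))ᶜ, p t i ≤ √K / s * 1 := by gcongr
    have n3 : ((({i₀} : Finset (Fin K))ᶜ.card : ℕ) : ℝ) * (100 * 4 / (√K / s) * (1 / s ^ 2))
        ≤ K * (100 * 4 / (√K / s) * (1 / s ^ 2)) := by gcongr
    have n4 : K * (100 * 4 / (√K / s) * (1 / s ^ 2)) = 400 * (√K / s) := by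
      have h3 : ∀ k : ℝ, 0 < k → k ^ 2 * (100 * 4 / (k / s) * (1 / s ^ 2)) = 400 * (k / s) :=
        fun k hk => by field_simp; ring
      have h4 := h3 _ hk0
      rwa [hk2] at h4
    have n5 : 9 * 4 / (√K / s) * (1 / s ^ 2) ≤ 36 * (√K / s) := by
      have e : 9 * 4 / (√K / s) * (1 / s ^ 2) = 36 * (1 / (√K * s)) := by field_simp; norm_num
      rw [e]
      have : 1 / (√K * s) ≤ √K / s := by
        rw [div_le_div_iff₀ (by positivity) hs0]
        nlinarith
      linarith
    have n6 : 3 * (mass T p t i₀ * (1 / s ^ 2)) ≤ 3 * (√K / s) := by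
      have e : mass T p t i₀ * (1 / s ^ 2) ≤ 1 * (1 / s ^ 2) := by gcongr
      have : 1 / s ^ 2 ≤ √K / s := by
        rw [div_le_div_iff₀ (by positivity) hs0]
        nlinarith
      linarith
    have e7 : 442 * √K * (1 / s) = 442 * (√K / s) := by ring
    rw [e7]
    linarith
  refine (Finset.sum_le_sum key).trans ?_
  rw [Finset.sum_add_distrib, ← Finset.mul_sum, Finset.sum_const, Finset.card_range, nsmul_eq_mul]
  have h2 := mul_le_mul_of_nonneg_left (sum_inv_sqrt_le T) (show 0 ≤ 442 * √(K : ℝ) by positivity)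
  have h3 : (T : ℝ) * (1 / T) = 1 := by field_simp
  have h4 : 1 ≤ √(K * T) := by
    refine Real.le_sqrt_of_sq_le ?_
    nlinarith
  rw [h3]
  rw [Real.sqrt_mul hKr.le] at *
  linarith

end Costs

/-! ### Importance weighting and conditional probability -/

section CondProb

variable {Ω : Type*} {m m0 : MeasurableSpace Ω} {μ : Measure Ω} [IsProbabilityMeasure μ]

/-- Integrating over an event amounts to integrating against its conditional probability. -/
theorem lintegral_restrict_eq_of_condExp (hm : m ≤ m0) {A : Set Ω} (hA : MeasurableSet A)
    {r : Ω → ℝ} (hr : Measurable[m] r) (hr0 : ∀ ω, 0 ≤ r ω)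
    (h : μ[A.indicator (fun _ => (1 : ℝ)) | m] =ᵐ[μ] r)
    {g : Ω → ENNReal} (hg : Measurable[m] g) :
    ∫⁻ ω in A, g ω ∂μ = ∫⁻ ω, ENNReal.ofReal (r ω) * g ω ∂μ := by
  have hint : Integrable (A.indicator fun _ => (1 : ℝ)) μ :=
    (integrable_const (1 : ℝ)).indicator hA
  have hrint : Integrable r μ := integrable_condExp.congr h
  have hr' : Measurable r := hr.mono hm le_rfl
  -- On the smaller σ-algebra, restricting to A is the same as taking the density r, by the defining
  -- property of the conditional expectation.
  have key : (μ.restrict A).trim hm = (μ.withDensity fun ω => ENNReal.ofReal (r ω)).trim hm := by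
    refine @Measure.ext Ω m _ _ fun B hB => ?_
    have hB' : MeasurableSet B := hm B hB
    rw [trim_measurableSet_eq hm hB, trim_measurableSet_eq hm hB, Measure.restrict_apply hB',
      withDensity_apply _ hB', ← ofReal_integral_eq_lintegral_ofReal hrint.integrableOn
        (Filter.Eventually.of_forall hr0)]
    have e1 : ∫ ω in B, r ω ∂μ = ∫ ω in B, A.indicator (fun _ => (1 : ℝ)) ω ∂μ := by
      rw [← setIntegral_condExp hm hint hB]
      exact setIntegral_congr_ae hB' (h.mono fun ω hω _ => hω.symm)
    rw [e1, setIntegral_indicator hA, setIntegral_const, smul_eq_mul, mul_one,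
      Measure.real, ENNReal.ofReal_toReal (measure_ne_top _ _)]
  rw [← lintegral_trim hm hg, key, lintegral_trim hm hg,
    lintegral_withDensity_eq_lintegral_mul _ hr'.ennreal_ofReal (hg.mono hm le_rfl)]
  rfl

/-- The weight 1/r need not be bounded, so the identity is first proved for lower integrals, and
integrability of the quotient is read off from it. -/
theorem integrable_div_indicator (hm : m ≤ m0) {A : Set Ω} (hA : MeasurableSet A)
    {r : Ω → ℝ} (hr : Measurable[m] r) (hr0 : ∀ ω, 0 < r ω)
    (h : μ[A.indicator (fun _ => (1 : ℝ)) | m] =ᵐ[μ] r)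
    {f : Ω → ℝ} (hf : Measurable[m] f) (hf0 : ∀ ω, 0 ≤ f ω) (hfi : Integrable f μ) :
    Integrable (A.indicator fun ω => f ω / r ω) μ
      ∧ ∫ ω, A.indicator (fun ω => f ω / r ω) ω ∂μ = ∫ ω, f ω ∂μ := by
  have hg : Measurable[m] fun ω => f ω / r ω := hf.div hr
  have hg' : Measurable fun ω => f ω / r ω := hg.mono hm le_rfl
  have hl : ∫⁻ ω, ENNReal.ofReal (A.indicator (fun ω => f ω / r ω) ω) ∂μ
      = ∫⁻ ω, ENNReal.ofReal (f ω) ∂μ := by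
    have e : ∀ ω, ENNReal.ofReal (A.indicator (fun ω => f ω / r ω) ω)
        = A.indicator (fun ω => ENNReal.ofReal (f ω / r ω)) ω := fun ω => by
      by_cases hω : ω ∈ A <;> simp [hω]
    simp only [e]
    rw [lintegral_indicator hA, lintegral_restrict_eq_of_condExp hm hA hr (fun ω => (hr0 ω).le) h
      hg.ennreal_ofReal]
    refine lintegral_congr fun ω => ?_
    rw [← ENNReal.ofReal_mul (hr0 ω).le, mul_div_cancel₀ _ (hr0 ω).ne']
  have hn : ∀ ω, 0 ≤ A.indicator (fun ω => f ω / r ω) ω := fun ω =>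
    Set.indicator_nonneg (fun ω _ => div_nonneg (hf0 ω) (hr0 ω).le) ω
  have hmeas : AEStronglyMeasurable (A.indicator fun ω => f ω / r ω) μ :=
    (hg'.indicator hA).aestronglyMeasurable
  have hfin : ∫⁻ ω, ENNReal.ofReal (f ω) ∂μ < ⊤ := by
    have := hfi.2
    rwa [hasFiniteIntegral_iff_ofReal (Filter.Eventually.of_forall hf0)] at this
  constructor
  · refine ⟨hmeas, ?_⟩
    rw [hasFiniteIntegral_iff_ofReal (Filter.Eventually.of_forall hn), hl]
    exact hfin
  · rw [integral_eq_lintegral_of_nonneg_ae (Filter.Eventually.of_forall hn) hmeas, hl,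
      ← integral_eq_lintegral_of_nonneg_ae (Filter.Eventually.of_forall hf0) hfi.1]

theorem integrable_of_measurable_of_le {f : Ω → ℝ} (hf : Measurable f) {b : ℝ}
    (hb : ∀ ω, |f ω| ≤ b) : Integrable f μ :=
  Integrable.of_bound hf.aestronglyMeasurable b (Filter.Eventually.of_forall hb)

end CondProb

/-! ### Measurability along the game -/

section Game

variable {Ω : Type*} {mΩ : MeasurableSpace Ω} {K : ℕ} {μ : Measure Ω}
  {T : ℕ} {𝓗 : Filtration ℕ mΩ} {ℓ p : ℕ → Ω → Fin K → ℝ} {I : ℕ → Ω → Fin K} {β : ℝ}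

theorem FollowsTsallisFTRL.isPath (G : IsBanditGame μ T 𝓗 ℓ p I)
    (F : FollowsTsallisFTRL (√((1 - β) / β)) β β (162 * β / (1 - β)) T ℓ p I) (ω : Ω) :
    IsPath β T (fun t => ℓ t ω) (fun t => p t ω) (fun t => I t ω) :=
  ⟨fun t ht i => G.loss_mem t ht ω i, fun t ht => F t ht ω⟩

namespace IsBanditGame

variable (G : IsBanditGame μ T 𝓗 ℓ p I) {t : ℕ} (ht : t < T)
include G ht

theorem measurable_dist {s : ℕ} (hs : s ≤ t) (i : Fin K) :
    Measurable[𝓗 t] fun ω => p s ω i :=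
  (measurable_pi_apply i).comp
    ((G.dist_history s (hs.trans_lt ht)).mono (𝓗.mono hs) le_rfl)

theorem measurable_mass {s : ℕ} (hs : s ≤ t) (i : Fin K) :
    Measurable[𝓗 t] fun ω => mass T (fun τ => p τ ω) s i :=
  (G.measurable_dist ht hs i).max measurable_const

theorem measurable_rateSum (i : Fin K) :
    Measurable[𝓗 t] fun ω => rateSum β T (fun τ => p τ ω) t i := by
  unfold rateSum
  refine measurable_const.add (Finset.measurable_sum _ fun τ hτ => ?_)
  exact (G.measurable_mass ht (Finset.mem_range.1 hτ).le i).pow_const _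

theorem measurable_rateStep (i : Fin K) :
    Measurable[𝓗 t] fun ω => rateStep β T (fun τ => p τ ω) t i := by
  unfold rateStep
  exact ((G.measurable_mass ht le_rfl i).pow_const _).div
    ((G.measurable_rateSum ht i).add ((G.measurable_mass ht le_rfl i).pow_const _))

theorem measurable_algRate (i : Fin K) :
    Measurable[𝓗 t] fun ω => algRate β T (fun τ => p τ ω) t i := by
  simp only [algRate_eq]
  exact measurable_const.mul (G.measurable_rateSum ht i).sqrt

theorem measurable_share (h0 : 0 < β) (h1 : β < 1) (U : Finset (Fin K)) (i : Fin K) :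
    Measurable[𝓗 t] fun ω => share h0 h1 T U (fun τ => p τ ω) t i := by
  have h : ∀ i, Measurable[𝓗 t] fun ω => (algHybrid β h0 h1).icurv
      (algRate β T (fun τ => p τ ω) t) (p t ω) i := fun i => by
    unfold Hybrid.icurv Hybrid.curv
    refine measurable_const.div (Measurable.add ?_ ?_)
    · exact measurable_const.div ((G.measurable_dist ht le_rfl i).pow_const 2)
    · exact (measurable_const.mul (G.measurable_algRate ht i)).mul
        ((G.measurable_dist ht le_rfl i).pow_const _)
  unfold share
  exact (h i).div (Finset.measurable_sum _ fun j _ => h j)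

theorem measurable_sqrt_mass_mul (i : Fin K) :
    Measurable[𝓗 t] fun ω => √(mass T (fun τ => p τ ω) t i * rateStep β T (fun τ => p τ ω) t i) :=
  ((G.measurable_mass ht le_rfl i).mul (G.measurable_rateStep ht i)).sqrt

theorem measurable_stabBound (h0 : 0 < β) (h1 : β < 1) (U : Finset (Fin K)) (i : Fin K) :
    Measurable[𝓗 t] fun ω => stabBound h0 h1 T U (fun τ => p τ ω) t i := by
  unfold stabBound
  split_ifs with hi
  · refine Measurable.add (Measurable.add (Measurable.add ?_ ?_) ?_) measurable_const
    · refine (measurable_const.mul (G.measurable_share ht h0 h1 U i)).mul ?_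
      exact Finset.measurable_sum _ fun j _ =>
        measurable_const.mul (G.measurable_sqrt_mass_mul ht j)
    · refine measurable_const.mul ((G.measurable_rateStep ht i).sqrt.mul (Measurable.sqrt ?_))
      exact (G.measurable_share ht h0 h1 U i).mul
        (Finset.measurable_sum _ fun j _ => G.measurable_dist ht le_rfl j)
    · exact measurable_const.mul ((G.measurable_mass ht le_rfl i).mul (G.measurable_rateStep ht i))
  · exact measurable_const.mul (G.measurable_sqrt_mass_mul ht i)

theorem measurable_penBound (U : Finset (Fin K)) :
    Measurable[𝓗 t] fun ω => penBound β T U (fun τ => p τ ω) t := by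
  unfold penBound
  refine Measurable.add (Finset.measurable_sum _ fun i _ => ?_) (Finset.measurable_sum _ fun i _ => ?_)
  · exact measurable_const.mul (G.measurable_sqrt_mass_mul ht i)
  · exact (G.measurable_mass ht le_rfl i).mul (G.measurable_rateStep ht i)

theorem measurableSet_arm {s : ℕ} (hs : s < t) (i : Fin K) :
    MeasurableSet[𝓗 t] {ω | I s ω = i} :=
  G.arm_history t ht s hs (measurableSet_singleton i)

theorem measurable_cumEst (i : Fin K) :
    Measurable[𝓗 t] fun ω => cumEst (fun τ => ℓ τ ω) (fun τ => p τ ω) (fun τ => I τ ω) t i := by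
  unfold cumEst
  refine Finset.measurable_sum _ fun τ hτ => ?_
  have hτt := Finset.mem_range.1 hτ
  -- Only the loss of the drawn arm is known to be measurable in the history, so the estimate is
  -- rewritten in terms of it.
  have e : (fun ω => lossEst (ℓ τ ω) (p τ ω) (I τ ω) i)
      = fun ω => if I τ ω = i then ℓ τ ω (I τ ω) / p τ ω i else 0 := by
    funext ω
    unfold lossEst
    split_ifs with h
    · rw [h]
    · rfl
  rw [e]
  exact Measurable.ite (G.measurableSet_arm ht hτt i)
    ((G.obs_history t ht τ hτt).div (G.measurable_dist ht hτt.le i)) measurable_const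

/-- The shadow player uses only observed data and may therefore be pulled out of conditional
expectations given the history. -/
theorem measurable_subDist (h0 : 0 < β) (h1 : β < 1) {U : Finset (Fin K)} (hU : U.Nonempty)
    (i : Fin K) :
    Measurable[𝓗 t] fun ω =>
      subDist h0 h1 T U (fun τ => ℓ τ ω) (fun τ => p τ ω) (fun τ => I τ ω) t i := by
  unfold subDist
  exact Hybrid.measurable_pt (m := 𝓗 t) (fun ω i => algRate_nonneg i) hU
    (fun i => G.measurable_cumEst ht i) (fun i => G.measurable_algRate ht i) i

theorem measurable_loss (i : Fin K) : Measurable fun ω => ℓ t ω i :=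
  (measurable_pi_apply i).comp (G.loss_measurable t ht)

theorem integrable_loss [IsProbabilityMeasure μ] (i : Fin K) : Integrable (fun ω => ℓ t ω i) μ :=
  integrable_of_measurable_of_le (b := 1) (G.measurable_loss ht i) fun ω => by
    have := G.loss_mem t ht ω i
    rw [abs_of_nonneg this.1]; exact this.2

theorem measurable_suffered : Measurable fun ω => ℓ t ω (I t ω) := by
  have e : (fun ω => ℓ t ω (I t ω)) = fun ω => ∑ i, if I t ω = i then ℓ t ω i else 0 := by
    funext ω; simp
  rw [e]
  exact Finset.measurable_sum _ fun i _ => Measurable.ite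
    (G.arm_measurable t ht (measurableSet_singleton i)) (G.measurable_loss ht i) measurable_const

theorem integrable_suffered [IsProbabilityMeasure μ] : Integrable (fun ω => ℓ t ω (I t ω)) μ :=
  integrable_of_measurable_of_le (b := 1) (G.measurable_suffered ht) fun ω => by
    have := G.loss_mem t ht ω (I t ω)
    rw [abs_of_nonneg this.1]; exact this.2

/-- The importance-weighting identity. -/
theorem integral_div_dist [IsProbabilityMeasure μ] (hp : ∀ ω i, 0 < p t ω i) {f : Fin K → Ω → ℝ}
    (hf : ∀ i, Measurable[𝓗 t ⊔ MeasurableSpace.comap (ℓ t) inferInstance] (f i))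
    (hf0 : ∀ i ω, 0 ≤ f i ω) (hfi : ∀ i, Integrable (f i) μ) :
    Integrable (fun ω => f (I t ω) ω / p t ω (I t ω)) μ
      ∧ ∫ ω, f (I t ω) ω / p t ω (I t ω) ∂μ = ∫ ω, ∑ i, f i ω ∂μ := by
  have hm : 𝓗 t ⊔ MeasurableSpace.comap (ℓ t) inferInstance ≤ mΩ :=
    sup_le (𝓗.le t) (G.loss_measurable t ht).comap_le
  have h := fun i => integrable_div_indicator hm
    (show MeasurableSet {ω | I t ω = i} from G.arm_measurable t ht (measurableSet_singleton i))
    (((G.measurable_dist ht le_rfl i)).mono le_sup_left le_rfl) (fun ω => hp ω i) (G.draw t ht i)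
    (hf i) (hf0 i) (hfi i)
  have e : (fun ω => f (I t ω) ω / p t ω (I t ω))
      = fun ω => ∑ i, ({ω | I t ω = i} : Set Ω).indicator (fun ω => f i ω / p t ω i) ω := by
    funext ω
    simp [Set.indicator_apply]
  rw [e]
  refine ⟨integrable_finsetSum _ fun i _ => (h i).1, ?_⟩
  rw [integral_finsetSum _ fun i _ => (h i).1, integral_finsetSum _ fun i _ => hfi i]
  exact Finset.sum_congr rfl fun i _ => (h i).2

end IsBanditGame

end Game

/-! ### Uniform bounds for integrability -/

section Bounds

variable {K : ℕ} {β : ℝ} {T : ℕ} {p : ℕ → Fin K → ℝ} {t : ℕ}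
  {l : ℕ → Fin K → ℝ} {a : ℕ → Fin K} {U : Finset (Fin K)}

theorem rateStep_le_one (hT : 0 < T) (i : Fin K) : rateStep β T p t i ≤ 1 := by
  have h1 : 0 < mass T p t i ^ (1 - 2 * β) := Real.rpow_pos_of_pos (mass_pos hT i) _
  have h2 := one_le_rateSum (β := β) (p := p) (t := t) hT i
  unfold rateStep
  rw [div_le_one (by linarith)]
  linarith

theorem mass_mul_rateStep_nonneg (hT : 0 < T) (i : Fin K) :
    0 ≤ mass T p t i * rateStep β T p t i :=
  mul_nonneg (mass_pos hT i).le (rateStep_nonneg hT i)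

theorem IsPath.mass_mul_rateStep_le_one (H : IsPath β T l p a) (ht : t < T) (i : Fin K) :
    mass T p t i * rateStep β T p t i ≤ 1 :=
  mul_le_one₀ (H.mass_le_one ht i) (rateStep_nonneg (by omega) i) (rateStep_le_one (by omega) i)

theorem share_le_one (h0 : 0 < β) (h1 : β < 1) (hp : ∀ i, 0 < p t i) {i : Fin K} (hi : i ∈ U) :
    share h0 h1 T U p t i ≤ 1 := by
  rw [← sum_share (T := T) h0 h1 hp ⟨i, hi⟩]
  exact Finset.single_le_sum (f := fun i => share h0 h1 T U p t i)
    (fun j _ => share_nonneg h0 h1 hp j) hi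

theorem stabBound_nonneg (h0 : 0 < β) (h1 : β < 1) (hT : 0 < T) (hp : ∀ i, 0 < p t i)
    (i : Fin K) : 0 ≤ stabBound h0 h1 T U p t i := by
  have hk := kappa_nonneg (β := β)
  have hu := share_nonneg (T := T) (U := U) h0 h1 hp i
  have hy := mass_mul_rateStep_nonneg (β := β) (p := p) (t := t) hT i
  unfold stabBound
  split_ifs with hi
  · have : 0 ≤ ∑ j ∈ Uᶜ, 2 * kappa β * √(mass T p t j * rateStep β T p t j) :=
      Finset.sum_nonneg fun j _ => by positivity
    positivity
  · positivity

theorem penBound_nonneg (hT : 0 < T) : 0 ≤ penBound β T U p t := by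
  have hk := kappa_nonneg (β := β)
  unfold penBound
  exact add_nonneg (Finset.sum_nonneg fun j _ => by positivity)
    (Finset.sum_nonneg fun j _ => mass_mul_rateStep_nonneg hT j)

theorem IsPath.sum_sqrt_mass_le (H : IsPath β T l p a) (ht : t < T) {c : ℝ} (hc : 0 ≤ c) :
    ∑ j ∈ U, c * √(mass T p t j * rateStep β T p t j) ≤ c * K := by
  calc ∑ j ∈ U, c * √(mass T p t j * rateStep β T p t j)
      ≤ ∑ j ∈ U, c := Finset.sum_le_sum fun j _ =>
        mul_le_of_le_one_right hc (Real.sqrt_le_one.2 (H.mass_mul_rateStep_le_one ht j))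
    _ = c * U.card := by rw [Finset.sum_const, nsmul_eq_mul, mul_comm]
    _ ≤ c * K := by
        have : U.card ≤ K := by simpa using Finset.card_le_univ U
        gcongr

theorem IsPath.stabBound_le (H : IsPath β T l p a) (h0 : 0 < β) (h1 : β < 1) (ht : t < T)
    (i : Fin K) : stabBound h0 h1 T U p t i ≤ 12 * kappa β * K + 6 * kappa β + 3 := by
  have hk := kappa_nonneg (β := β)
  have hT : 0 < T := by omega
  have hT' : (1 : ℝ) ≤ T := by exact_mod_cast hT
  have hp := H.pos ht
  have hy := H.mass_mul_rateStep_le_one ht i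
  unfold stabBound
  split_ifs with hi
  · have hu1 := share_le_one (T := T) h0 h1 hp hi
    have hs := H.sum_sqrt_mass_le (U := Uᶜ) ht (c := 2 * kappa β) (by positivity)
    have hps : ∑ j ∈ Uᶜ, p t j ≤ 1 := by
      rw [← H.sum_eq ht]
      exact Finset.sum_le_univ_sum_of_nonneg fun j => (hp j).le
    have hps0 : 0 ≤ ∑ j ∈ Uᶜ, p t j := Finset.sum_nonneg fun j _ => (hp j).le
    have e1 : 6 * share h0 h1 T U p t i
        * (∑ j ∈ Uᶜ, 2 * kappa β * √(mass T p t j * rateStep β T p t j)) ≤ 6 * 1 * (2 * kappa β * K) := by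
      gcongr
    have e2 : √(rateStep β T p t i) * √(share h0 h1 T U p t i * ∑ j ∈ Uᶜ, p t j) ≤ 1 :=
      mul_le_one₀ (Real.sqrt_le_one.2 (rateStep_le_one hT i)) (Real.sqrt_nonneg _)
        (Real.sqrt_le_one.2 (mul_le_one₀ hu1 hps0 hps))
    have e3 : 6 * kappa β * (√(rateStep β T p t i) * √(share h0 h1 T U p t i * ∑ j ∈ Uᶜ, p t j))
        ≤ 6 * kappa β := mul_le_of_le_one_right (by positivity) e2
    have e4 : (1 : ℝ) / T ≤ 1 := by rw [div_le_one (by linarith)]; exact hT'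
    linarith
  · have e : 2 * kappa β * √(mass T p t i * rateStep β T p t i) ≤ 2 * kappa β :=
      mul_le_of_le_one_right (by positivity) (Real.sqrt_le_one.2 hy)
    nlinarith

theorem IsPath.penBound_le (H : IsPath β T l p a) (ht : t < T) :
    penBound β T U p t ≤ 6 * kappa β * K + K := by
  have hk := kappa_nonneg (β := β)
  unfold penBound
  refine add_le_add (H.sum_sqrt_mass_le ht (by positivity)) ?_
  calc ∑ i ∈ U, mass T p t i * rateStep β T p t i ≤ ∑ i ∈ U, (1 : ℝ) :=
        Finset.sum_le_sum fun i _ => H.mass_mul_rateStep_le_one ht i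
    _ ≤ K := by
        rw [Finset.sum_const, nsmul_eq_mul, mul_one]
        exact_mod_cast (by simpa using Finset.card_le_univ U : U.card ≤ K)

theorem sum_cumEst_eq (S : Finset (Fin K)) :
    ∑ i ∈ S, cumEst l p a T i
      = ∑ t ∈ Finset.range T, (if a t ∈ S then l t (a t) else 0) / p t (a t) := by
  unfold cumEst
  rw [Finset.sum_comm]
  refine Finset.sum_congr rfl fun t _ => ?_
  unfold lossEst
  rw [Finset.sum_ite_eq]
  split_ifs <;> simp

end Bounds

/-! ### Taking expectations -/

section Expectation

variable {Ω : Type*} {mΩ : MeasurableSpace Ω} {K : ℕ} {μ : Measure Ω} [IsProbabilityMeasure μ]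
  {T : ℕ} {𝓗 : Filtration ℕ mΩ} {ℓ p : ℕ → Ω → Fin K → ℝ} {I : ℕ → Ω → Fin K} {β : ℝ}

namespace IsBanditGame

variable (G : IsBanditGame μ T 𝓗 ℓ p I)
  (F : FollowsTsallisFTRL (√((1 - β) / β)) β β (162 * β / (1 - β)) T ℓ p I)
  (h0 : 0 < β) (h1 : β < 1) (U : Finset (Fin K))
include G

theorem integrable_mul_loss {t : ℕ} (ht : t < T) {q : Ω → ℝ} (hq : Measurable q)
    (hq0 : ∀ ω, 0 ≤ q ω) (hq1 : ∀ ω, q ω ≤ 1) (i : Fin K) :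
    Integrable (fun ω => q ω * ℓ t ω i) μ :=
  integrable_of_measurable_of_le (b := 1) (hq.mul (G.measurable_loss ht i)) fun ω => by
    have := G.loss_mem t ht ω i
    rw [abs_of_nonneg (mul_nonneg (hq0 ω) this.1)]
    exact mul_le_one₀ (hq1 ω) this.1 this.2

include F

theorem integrable_stabBound {t : ℕ} (ht : t < T) (i : Fin K) :
    Integrable (fun ω => stabBound h0 h1 T U (fun τ => p τ ω) t i) μ :=
  integrable_of_measurable_of_le ((G.measurable_stabBound ht h0 h1 U i).mono (𝓗.le t) le_rfl)
    fun ω => by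
      rw [abs_of_nonneg (stabBound_nonneg h0 h1 (by omega) ((F.isPath G ω).pos ht) i)]
      exact (F.isPath G ω).stabBound_le h0 h1 ht i

theorem integrable_penBound {t : ℕ} (ht : t < T) :
    Integrable (fun ω => penBound β T U (fun τ => p τ ω) t) μ :=
  integrable_of_measurable_of_le ((G.measurable_penBound ht U).mono (𝓗.le t) le_rfl)
    fun ω => by
      rw [abs_of_nonneg (penBound_nonneg (by omega))]
      exact (F.isPath G ω).penBound_le ht

theorem integrable_sum_roundCost :
    Integrable (fun ω => ∑ t ∈ Finset.range T, roundCost h0 h1 T U (fun τ => p τ ω) t) μ := by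
  refine integrable_finsetSum _ fun t ht => ?_
  rw [Finset.mem_range] at ht
  unfold roundCost
  exact (integrable_finsetSum _ fun i _ => G.integrable_stabBound F h0 h1 U ht i).add
    (G.integrable_penBound F U ht)

theorem integrable_sum_dist_mul (x : Fin K → ℝ) (S : Finset (Fin K)) :
    Integrable (fun ω => ∑ t ∈ Finset.range T, ∑ i ∈ S, p t ω i * x i) μ := by
  refine integrable_finsetSum _ fun t ht => integrable_finsetSum _ fun i _ => ?_
  rw [Finset.mem_range] at ht
  refine Integrable.mul_const ?_ _
  refine integrable_of_measurable_of_le (b := 1)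
    ((G.measurable_dist ht le_rfl i).mono (𝓗.le t) le_rfl) fun ω => ?_
  rw [abs_of_pos ((F.isPath G ω).pos ht i)]
  exact (F.isPath G ω).le_one ht i

theorem integral_sum_suffered_eq :
    ∫ ω, ∑ t ∈ Finset.range T, ℓ t ω (I t ω) ∂μ
      = ∫ ω, ∑ t ∈ Finset.range T, ∑ i, p t ω i * ℓ t ω i ∂μ := by
  have hq : ∀ t < T, ∀ i, Integrable (fun ω => p t ω i * ℓ t ω i) μ := fun t ht i =>
    G.integrable_mul_loss ht ((G.measurable_dist ht le_rfl i).mono (𝓗.le t) le_rfl)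
      (fun ω => ((F.isPath G ω).pos ht i).le) (fun ω => (F.isPath G ω).le_one ht i) i
  rw [integral_finsetSum _ fun t ht => G.integrable_suffered (Finset.mem_range.1 ht),
    integral_finsetSum _ fun t ht => integrable_finsetSum _ fun i _ =>
      hq t (Finset.mem_range.1 ht) i]
  refine Finset.sum_congr rfl fun t ht => ?_
  rw [Finset.mem_range] at ht
  have h := G.integral_div_dist ht (fun ω i => (F.isPath G ω).pos ht i)
    (f := fun i ω => p t ω i * ℓ t ω i)
    (fun i => ((G.measurable_dist ht le_rfl i).mono le_sup_left le_rfl).mul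
      (((measurable_pi_apply i).comp (comap_measurable (ℓ t))).mono le_sup_right le_rfl))
    (fun i ω => mul_nonneg ((F.isPath G ω).pos ht i).le (G.loss_mem t ht ω i).1) (hq t ht)
  rw [← h.2]
  refine integral_congr_ae (Filter.Eventually.of_forall fun ω => ?_)
  simp only
  rw [mul_div_cancel_left₀ _ ((F.isPath G ω).pos ht _).ne']

/-- The learner is compared with the player who only uses the arms in `U`. -/
theorem integral_sum_suffered_le (hKT : K ≤ T) (hU : U.Nonempty) :
    ∫ ω, ∑ t ∈ Finset.range T, ℓ t ω (I t ω) ∂μ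
      ≤ ∫ ω, ∑ t ∈ Finset.range T, ∑ i,
            subDist h0 h1 T U (fun τ => ℓ τ ω) (fun τ => p τ ω) (fun τ => I τ ω) t i * ℓ t ω i ∂μ
        + ∫ ω, ∑ t ∈ Finset.range T, roundCost h0 h1 T U (fun τ => p τ ω) t ∂μ
        + K / 2 + boundaryCost β T K U := by
  set q : ℕ → Ω → Fin K → ℝ := fun t ω i =>
    subDist h0 h1 T U (fun τ => ℓ τ ω) (fun τ => p τ ω) (fun τ => I τ ω) t i with hqdef
  have hT : ∀ t, t ∈ Finset.range T → t < T := fun t ht => Finset.mem_range.1 ht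
  have hq0 : ∀ t ω i, 0 ≤ q t ω i := fun t ω i => Hybrid.pt_nonneg (fun i => algRate_nonneg i) i
  have hq1 : ∀ t ω i, q t ω i ≤ 1 := fun t ω i => Hybrid.pt_le_one (fun i => algRate_nonneg i) i
  have hqm : ∀ t < T, ∀ i, Measurable[𝓗 t] fun ω => q t ω i := fun t ht i =>
    G.measurable_subDist ht h0 h1 hU i
  have hqi : ∀ t < T, ∀ i, Integrable (fun ω => q t ω i * ℓ t ω i) μ := fun t ht i =>
    G.integrable_mul_loss ht ((hqm t ht i).mono (𝓗.le t) le_rfl) (fun ω => hq0 t ω i)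
      (fun ω => hq1 t ω i) i
  -- All importance-weighted terms of a round in one nonnegative family: the shadow player's loss,
  -- the stability bound and the boundary loss estimates. One application of `integral_div_dist`
  -- then removes every weight.
  set f : ℕ → Fin K → Ω → ℝ := fun t i ω => q t ω i * ℓ t ω i
    + stabBound h0 h1 T U (fun τ => p τ ω) t i
    + 1 / (2 * T) * (if i ∈ Uᶜ then ℓ t ω i else 0) with hfdef
  have hlm : ∀ t i, Measurable[𝓗 t ⊔ MeasurableSpace.comap (ℓ t) inferInstance]
      fun ω => ℓ t ω i := fun t i =>
    ((measurable_pi_apply i).comp (comap_measurable (ℓ t))).mono le_sup_right le_rfl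
  have hfm : ∀ t < T, ∀ i, Measurable[𝓗 t ⊔ MeasurableSpace.comap (ℓ t) inferInstance] (f t i) :=
    fun t ht i => by
      refine Measurable.add (Measurable.add ?_ ?_) (measurable_const.mul ?_)
      · exact ((hqm t ht i).mono le_sup_left le_rfl).mul (hlm t i)
      · exact (G.measurable_stabBound ht h0 h1 U i).mono le_sup_left le_rfl
      · by_cases hi : i ∈ Uᶜ
        · simpa only [if_pos hi] using hlm t i
        · simp only [if_neg hi]; exact measurable_const
  have hite : ∀ t < T, ∀ i ω, (if i ∈ Uᶜ then ℓ t ω i else 0) ∈ Set.Icc (0 : ℝ) 1 :=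
    fun t ht i ω => by
      split_ifs
      · exact G.loss_mem t ht ω i
      · simp
  have hf0 : ∀ t < T, ∀ i ω, 0 ≤ f t i ω := fun t ht i ω => by
    have a1 := mul_nonneg (hq0 t ω i) (G.loss_mem t ht ω i).1
    have a2 := stabBound_nonneg (p := fun τ => p τ ω) (T := T) (U := U) h0 h1 (by omega) ((F.isPath G ω).pos ht) i
    have a3 := (hite t ht i ω).1
    have : 0 ≤ 1 / (2 * (T : ℝ)) * (if i ∈ Uᶜ then ℓ t ω i else 0) := by positivity
    exact add_nonneg (add_nonneg a1 a2) this
  have hfi : ∀ t < T, ∀ i, Integrable (f t i) μ := fun t ht i => by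
    refine ((hqi t ht i).add (G.integrable_stabBound F h0 h1 U ht i)).add (Integrable.const_mul ?_ _)
    by_cases hi : i ∈ Uᶜ
    · simpa only [if_pos hi] using G.integrable_loss ht i
    · simp only [if_neg hi]; exact integrable_const _
  have hI := fun t (ht : t < T) => G.integral_div_dist ht (fun ω i => (F.isPath G ω).pos ht i)
    (hfm t ht) (hf0 t ht) (hfi t ht)
  have hpath : ∀ ω, ∑ t ∈ Finset.range T, ℓ t ω (I t ω)
      ≤ ∑ t ∈ Finset.range T, f t (I t ω) ω / p t ω (I t ω)
        + ∑ t ∈ Finset.range T, penBound β T U (fun τ => p τ ω) t + boundaryCost β T K U := fun ω => by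
    have := (F.isPath G ω).sum_loss_le h0 h1 hKT hU
    rw [sum_cumEst_eq, Finset.mul_sum] at this
    have e : ∑ t ∈ Finset.range T, f t (I t ω) ω / p t ω (I t ω)
        = ∑ t ∈ Finset.range T, (q t ω (I t ω) * ℓ t ω (I t ω)
            + stabBound h0 h1 T U (fun τ => p τ ω) t (I t ω)) / p t ω (I t ω)
          + ∑ t ∈ Finset.range T, 1 / (2 * (T : ℝ))
            * ((if I t ω ∈ Uᶜ then ℓ t ω (I t ω) else 0) / p t ω (I t ω)) := by
      rw [← Finset.sum_add_distrib]
      refine Finset.sum_congr rfl fun t _ => ?_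
      rw [← mul_div_assoc, ← add_div]
    rw [e]
    linarith
  have hA : Integrable (fun ω => ∑ t ∈ Finset.range T, ℓ t ω (I t ω)) μ :=
    integrable_finsetSum _ fun t ht => G.integrable_suffered (hT t ht)
  have hB : Integrable (fun ω => ∑ t ∈ Finset.range T, f t (I t ω) ω / p t ω (I t ω)) μ :=
    integrable_finsetSum _ fun t ht => (hI t (hT t ht)).1
  have hP : Integrable (fun ω => ∑ t ∈ Finset.range T, penBound β T U (fun τ => p τ ω) t) μ :=
    integrable_finsetSum _ fun t ht => G.integrable_penBound F U (hT t ht)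
  have hQ : Integrable (fun ω => ∑ t ∈ Finset.range T, ∑ i, q t ω i * ℓ t ω i) μ :=
    integrable_finsetSum _ fun t ht => integrable_finsetSum _ fun i _ => hqi t (hT t ht) i
  have hR := G.integrable_sum_roundCost F h0 h1 U
  have hFs : Integrable (fun ω => ∑ t ∈ Finset.range T, ∑ i, f t i ω) μ :=
    integrable_finsetSum _ fun t ht => integrable_finsetSum _ fun i _ => hfi t (hT t ht) i
  have s1 := integral_mono (μ := μ) hA ((hB.add hP).add (integrable_const (boundaryCost β T K U))) hpath
  rw [integral_add' (hB.add hP) (integrable_const _), integral_add' hB hP, integral_const,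
    probReal_univ, one_smul] at s1
  have s2 : ∫ ω, ∑ t ∈ Finset.range T, f t (I t ω) ω / p t ω (I t ω) ∂μ
      = ∫ ω, ∑ t ∈ Finset.range T, ∑ i, f t i ω ∂μ := by
    rw [integral_finsetSum _ fun t ht => (hI t (hT t ht)).1,
      integral_finsetSum _ fun t ht => integrable_finsetSum _ fun i _ => hfi t (hT t ht) i]
    exact Finset.sum_congr rfl fun t ht => (hI t (hT t ht)).2
  have hpt : ∀ ω, ∑ t ∈ Finset.range T, ∑ i, f t i ω
        + ∑ t ∈ Finset.range T, penBound β T U (fun τ => p τ ω) t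
      ≤ ∑ t ∈ Finset.range T, ∑ i, q t ω i * ℓ t ω i
        + ∑ t ∈ Finset.range T, roundCost h0 h1 T U (fun τ => p τ ω) t + K / 2 := fun ω => by
    have : ∑ t ∈ Finset.range T, ((∑ i, f t i ω) + penBound β T U (fun τ => p τ ω) t)
        ≤ ∑ t ∈ Finset.range T, ((∑ i, q t ω i * ℓ t ω i)
          + roundCost h0 h1 T U (fun τ => p τ ω) t + K / (2 * T)) := by
      refine Finset.sum_le_sum fun t ht => ?_
      have ht' := hT t ht
      simp only [hfdef, roundCost, Finset.sum_add_distrib]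
      rw [← Finset.mul_sum]
      have : ∑ i, (if i ∈ Uᶜ then ℓ t ω i else 0) ≤ (K : ℝ) := by
        calc ∑ i, (if i ∈ Uᶜ then ℓ t ω i else 0) ≤ ∑ i : Fin K, (1 : ℝ) :=
              Finset.sum_le_sum fun i _ => (hite t ht' i ω).2
          _ = K := by simp
      have : 1 / (2 * (T : ℝ)) * ∑ i, (if i ∈ Uᶜ then ℓ t ω i else 0) ≤ K / (2 * T) := by
        rw [div_eq_mul_one_div (K : ℝ), mul_comm (K : ℝ)]
        gcongr
      linarith
    rw [Finset.sum_add_distrib, Finset.sum_add_distrib, Finset.sum_add_distrib, Finset.sum_const,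
      Finset.card_range, nsmul_eq_mul] at this
    have e : (T : ℝ) * (K / (2 * T)) ≤ K / 2 := by
      rcases Nat.eq_zero_or_pos T with h | h
      · subst h; simp; positivity
      · have : (0 : ℝ) < T := by exact_mod_cast h
        rw [show (T : ℝ) * (K / (2 * T)) = K / 2 by field_simp]
    linarith
  have s3 := integral_mono (μ := μ) (hFs.add hP) ((hQ.add hR).add (integrable_const ((K : ℝ) / 2))) hpt
  rw [integral_add' hFs hP, integral_add' (hQ.add hR) (integrable_const _), integral_add' hQ hR,
    integral_const, probReal_univ, one_smul] at s3
  linarith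

end IsBanditGame

end Expectation

/-! ### The loss of the shadow player -/

section Excess

variable {Ω : Type*} {mΩ : MeasurableSpace Ω} {μ : Measure Ω}

theorem integrable_iSup_of_finite {ι : Type*} [Finite ι] {v : ι → Ω → ℝ}
    (hm : ∀ i, Measurable (v i)) (hv : ∀ i, Integrable (v i) μ) :
    Integrable (fun ω => ⨆ i, v i ω) μ := by
  have := Fintype.ofFinite ι
  refine Integrable.mono' (integrable_finsetSum Finset.univ fun i _ => (hv i).abs)
    (Measurable.iSup hm).aestronglyMeasurable (Filter.Eventually.of_forall fun ω => ?_)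
  have hle : ∀ i, |v i ω| ≤ ∑ j, |v j ω| := fun i =>
    Finset.single_le_sum (f := fun j => |v j ω|) (fun j _ => abs_nonneg _) (Finset.mem_univ i)
  rw [Real.norm_eq_abs]
  rcases isEmpty_or_nonempty ι with h | h
  · simp
  · refine abs_le.2 ⟨?_, ciSup_le fun i => (le_abs_self _).trans (hle i)⟩
    obtain ⟨i⟩ := h
    exact (abs_le.1 (hle i)).1.trans (le_ciSup (f := fun i => v i ω) (Set.finite_range _).bddAbove i)

variable [IsProbabilityMeasure μ] {K : ℕ} {T : ℕ} {𝓗 : Filtration ℕ mΩ}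
  {ℓ p : ℕ → Ω → Fin K → ℝ} {I : ℕ → Ω → Fin K} {β : ℝ}

namespace IsBanditGame

variable (G : IsBanditGame μ T 𝓗 ℓ p I) (iStar : Fin K)
include G

theorem regret_eq : regret μ T ℓ I iStar
    = ∫ ω, ∑ t ∈ Finset.range T, ℓ t ω (I t ω) ∂μ - ∫ ω, ∑ t ∈ Finset.range T, ℓ t ω iStar ∂μ :=
  integral_sub (integrable_finsetSum _ fun _ ht => G.integrable_suffered (Finset.mem_range.1 ht))
    (integrable_finsetSum _ fun _ ht => G.integrable_loss (Finset.mem_range.1 ht) iStar)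

theorem regret_le_rounds : regret μ T ℓ I iStar ≤ T := by
  have hle : ∀ ω, ∑ t ∈ Finset.range T, ℓ t ω (I t ω) - ∑ t ∈ Finset.range T, ℓ t ω iStar
      ≤ (T : ℝ) := fun ω => by
    rw [← Finset.sum_sub_distrib]
    calc ∑ t ∈ Finset.range T, (ℓ t ω (I t ω) - ℓ t ω iStar) ≤ ∑ t ∈ Finset.range T, (1 : ℝ) :=
          Finset.sum_le_sum fun t ht => by
            have h1 := (G.loss_mem t (Finset.mem_range.1 ht) ω (I t ω)).2
            have h2 := (G.loss_mem t (Finset.mem_range.1 ht) ω iStar).1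
            linarith
      _ = T := by simp
  have := integral_mono (μ := μ)
    ((integrable_finsetSum _ fun t ht => G.integrable_suffered (Finset.mem_range.1 ht)).sub
      (integrable_finsetSum _ fun t ht => G.integrable_loss (Finset.mem_range.1 ht) iStar))
    (integrable_const (T : ℝ)) hle
  rw [integral_const, probReal_univ, one_smul] at this
  exact this

/-- A player who only uses arms of zero gap exceeds the loss of `iStar` by at most
`zeroGapExcess`. -/
theorem integral_sum_mul_loss_sub_le {Δ : Fin K → ℝ} {q : ℕ → Ω → Fin K → ℝ}
    (hq : ∀ t < T, ∀ i, Measurable[𝓗 t] fun ω => q t ω i)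
    (hq0 : ∀ t < T, ∀ ω i, 0 ≤ q t ω i) (hq1 : ∀ t < T, ∀ ω, ∑ i, q t ω i = 1)
    (hqΔ : ∀ t < T, ∀ ω i, Δ i ≠ 0 → q t ω i = 0) :
    ∫ ω, ∑ t ∈ Finset.range T, ∑ i, q t ω i * ℓ t ω i ∂μ
      - ∫ ω, ∑ t ∈ Finset.range T, ℓ t ω iStar ∂μ ≤ zeroGapExcess μ T 𝓗 ℓ iStar Δ := by
  have hT : ∀ t, t ∈ Finset.range T → t < T := fun t ht => Finset.mem_range.1 ht
  have hle1 : ∀ t < T, ∀ ω i, q t ω i ≤ 1 := fun t ht ω i => by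
    rw [← hq1 t ht ω]
    exact Finset.single_le_sum (f := fun i => q t ω i) (fun j _ => hq0 t ht ω j) (Finset.mem_univ i)
  have hqi : ∀ t < T, ∀ i, Integrable (fun ω => q t ω i * ℓ t ω i) μ := fun t ht i =>
    G.integrable_mul_loss ht ((hq t ht i).mono (𝓗.le t) le_rfl) (fun ω => hq0 t ht ω i)
      (fun ω => hle1 t ht ω i) i
  have hd : ∀ t < T, ∀ i, Integrable (fun ω => ℓ t ω i - ℓ t ω iStar) μ := fun t ht i =>
    (G.integrable_loss ht i).sub (G.integrable_loss ht iStar)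
  have hqd : ∀ t < T, ∀ i, Integrable (fun ω => q t ω i * (ℓ t ω i - ℓ t ω iStar)) μ :=
    fun t ht i => (hd t ht i).bdd_mul (c := 1)
      ((hq t ht i).mono (𝓗.le t) le_rfl).aestronglyMeasurable
      (Filter.Eventually.of_forall fun ω => by
        rw [Real.norm_eq_abs, abs_of_nonneg (hq0 t ht ω i)]; exact hle1 t ht ω i)
  -- The weights are known before the round, so they come out of the conditional expectation; a
  -- weighted average over arms of zero gap is then at most the maximum.
  have hce : ∀ t < T, ∀ i,
      μ[fun ω => q t ω i * (ℓ t ω i - ℓ t ω iStar) | 𝓗 t]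
        =ᵐ[μ] fun ω => q t ω i * (μ[fun ω' => ℓ t ω' i - ℓ t ω' iStar | 𝓗 t]) ω := fun t ht i =>
    condExp_mul_of_stronglyMeasurable_left (f := fun ω => q t ω i)
      (g := fun ω => ℓ t ω i - ℓ t ω iStar) (hq t ht i).stronglyMeasurable (hqd t ht i) (hd t ht i)
  have hce_int : ∀ t < T, ∀ i, Integrable
      (fun ω => q t ω i * (μ[fun ω' => ℓ t ω' i - ℓ t ω' iStar | 𝓗 t]) ω) μ := fun t ht i =>
    integrable_condExp.congr (hce t ht i)
  have hsup : ∀ t, Integrable (fun ω => ⨆ i : {i : Fin K // Δ i = 0},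
      (μ[fun ω' => ℓ t ω' i.1 - ℓ t ω' iStar | 𝓗 t]) ω) μ := fun t =>
    integrable_iSup_of_finite
      (fun i => (stronglyMeasurable_condExp.mono (𝓗.le t)).measurable) fun i => integrable_condExp
  have hround : ∀ t < T, ∫ ω, ∑ i, q t ω i * ℓ t ω i ∂μ - ∫ ω, ℓ t ω iStar ∂μ
      ≤ ∫ ω, ⨆ i : {i : Fin K // Δ i = 0},
          (μ[fun ω' => ℓ t ω' i.1 - ℓ t ω' iStar | 𝓗 t]) ω ∂μ := fun t ht => by
    have e : ∫ ω, ∑ i, q t ω i * ℓ t ω i ∂μ - ∫ ω, ℓ t ω iStar ∂μ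
        = ∫ ω, ∑ i, q t ω i * (μ[fun ω' => ℓ t ω' i - ℓ t ω' iStar | 𝓗 t]) ω ∂μ := by
      rw [← integral_sub (integrable_finsetSum _ fun i _ => hqi t ht i) (G.integrable_loss ht iStar)]
      have e1 : ∀ ω, ∑ i, q t ω i * ℓ t ω i - ℓ t ω iStar
          = ∑ i, q t ω i * (ℓ t ω i - ℓ t ω iStar) := fun ω => by
        simp only [mul_sub, Finset.sum_sub_distrib]
        rw [← Finset.sum_mul, hq1 t ht ω, one_mul]
      simp only [e1]
      rw [integral_finsetSum _ fun i _ => hqd t ht i,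
        integral_finsetSum _ fun i _ => hce_int t ht i]
      refine Finset.sum_congr rfl fun i _ => ?_
      rw [← integral_condExp (𝓗.le t), integral_congr_ae (hce t ht i)]
    rw [e]
    refine integral_mono (integrable_finsetSum _ fun i _ => hce_int t ht i) (hsup t) fun ω => ?_
    simp only
    rw [← one_mul (⨆ _, _), ← hq1 t ht ω, Finset.sum_mul]
    refine Finset.sum_le_sum fun i _ => ?_
    by_cases hi : Δ i = 0
    · exact mul_le_mul_of_nonneg_left
        (le_ciSup (f := fun i : {i : Fin K // Δ i = 0} =>
          (μ[fun ω' => ℓ t ω' i.1 - ℓ t ω' iStar | 𝓗 t]) ω)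
          (Set.finite_range _).bddAbove ⟨i, hi⟩) (hq0 t ht ω i)
    · rw [hqΔ t ht ω i hi, zero_mul, zero_mul]
  unfold zeroGapExcess
  rw [integral_finsetSum _ fun t _ => hsup t,
    integral_finsetSum _ fun t ht => integrable_finsetSum _ fun i _ => hqi t (hT t ht) i,
    integral_finsetSum _ fun t ht => G.integrable_loss (hT t ht) iStar, ← Finset.sum_sub_distrib]
  exact Finset.sum_le_sum fun t ht => hround t (hT t ht)

/-- A player who always plays one fixed arm of zero gap is a special case, and cannot beat the best
arm. Without such arms the supremum is over an empty type, hence 0. -/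
theorem zeroGapExcess_nonneg {iStar : Fin K} (hbest : IsBestArm μ T ℓ iStar) (Δ : Fin K → ℝ) :
    0 ≤ zeroGapExcess μ T 𝓗 ℓ iStar Δ := by
  by_cases h : ∃ i, Δ i = 0
  · obtain ⟨i, hi⟩ := h
    have := G.integral_sum_mul_loss_sub_le iStar (Δ := Δ) (q := fun _ _ j => if i = j then 1 else 0)
      (fun t _ j => measurable_const) (fun t _ ω j => by split_ifs <;> simp)
      (fun t _ ω => by simp) (fun t _ ω j hj => if_neg (by rintro rfl; exact hj hi))
    simp only [ite_mul, one_mul, zero_mul, Finset.sum_ite_eq, Finset.mem_univ, if_true] at this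
    linarith [hbest i]
  · push Not at h
    have : IsEmpty {i : Fin K // Δ i = 0} := ⟨fun i => h i.1 i.2⟩
    unfold zeroGapExcess
    simp

variable (F : FollowsTsallisFTRL (√((1 - β) / β)) β β (162 * β / (1 - β)) T ℓ p I)
  (h0 : 0 < β) (h1 : β < 1)
include F

/-- If all gaps vanish, the learner itself is a player using only arms of zero gap. -/
theorem regret_le_zeroGapExcess {Δ : Fin K → ℝ} (hΔ : ∀ i, Δ i = 0) :
    regret μ T ℓ I iStar ≤ zeroGapExcess μ T 𝓗 ℓ iStar Δ := by
  rw [G.regret_eq, G.integral_sum_suffered_eq F]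
  exact G.integral_sum_mul_loss_sub_le iStar (fun t ht i => G.measurable_dist ht le_rfl i)
    (fun t ht ω i => ((F.isPath G ω).pos ht i).le) (fun t ht ω => (F.isPath G ω).sum_eq ht)
    fun t _ ω i hi => absurd (hΔ i) hi

theorem regret_le_of_zeroGap (hKT : K ≤ T) {Δ : Fin K → ℝ} {U : Finset (Fin K)}
    (hU : U.Nonempty) (hUΔ : ∀ i ∈ U, Δ i = 0) :
    regret μ T ℓ I iStar
      ≤ zeroGapExcess μ T 𝓗 ℓ iStar Δ
        + ∫ ω, ∑ t ∈ Finset.range T, roundCost h0 h1 T U (fun τ => p τ ω) t ∂μ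
        + K / 2 + boundaryCost β T K U := by
  have e1 := G.integral_sum_suffered_le F h0 h1 U hKT hU
  have hz : ∀ t ω i, i ∉ U →
      subDist h0 h1 T U (fun τ => ℓ τ ω) (fun τ => p τ ω) (fun τ => I τ ω) t i = 0 :=
    fun t ω i hi => Hybrid.pt_of_notMem hi
  have e2 := G.integral_sum_mul_loss_sub_le iStar (Δ := Δ) (q := fun t ω i =>
      subDist h0 h1 T U (fun τ => ℓ τ ω) (fun τ => p τ ω) (fun τ => I τ ω) t i)
    (fun t ht i => G.measurable_subDist ht h0 h1 hU i)
    (fun t _ ω i => Hybrid.pt_nonneg (fun i => algRate_nonneg i) i)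
    (fun t _ ω => by
      rw [← Finset.sum_subset (Finset.subset_univ U) fun i _ hi => hz t ω i hi]
      exact Hybrid.sum_pt (fun i => algRate_nonneg i) hU)
    (fun t _ ω i hi => hz t ω i fun hiU => hi (hUΔ i hiU))
  rw [G.regret_eq]
  linarith

/-- On the support {`iStar`} the shadow player always plays `iStar`, so no excess term appears. -/
theorem regret_le_of_singleton (hKT : K ≤ T) :
    regret μ T ℓ I iStar
      ≤ ∫ ω, ∑ t ∈ Finset.range T, roundCost h0 h1 T {iStar} (fun τ => p τ ω) t ∂μ
        + K / 2 + boundaryCost β T K {iStar} := by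
  have e1 := G.integral_sum_suffered_le F h0 h1 {iStar} hKT (Finset.singleton_nonempty _)
  have e2 : ∀ t ω, ∑ i, subDist h0 h1 T {iStar} (fun τ => ℓ τ ω) (fun τ => p τ ω)
      (fun τ => I τ ω) t i * ℓ t ω i = ℓ t ω iStar := fun t ω => by
    have hs : ∑ i ∈ {iStar}, subDist h0 h1 T {iStar} (fun τ => ℓ τ ω) (fun τ => p τ ω)
        (fun τ => I τ ω) t i = 1 :=
      Hybrid.sum_pt (fun i => algRate_nonneg i) (Finset.singleton_nonempty _)
    rw [Finset.sum_singleton] at hs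
    rw [Finset.sum_eq_single iStar, hs, one_mul]
    · intro i _ hi
      rw [subDist, Hybrid.pt_of_notMem (by simpa using hi), zero_mul]
    · simp
  simp only [e2] at e1
  rw [G.regret_eq]
  linarith

end IsBanditGame

end Excess

/-! ### Simplifying the additive constants -/

section Scalars

variable {β : ℝ} (h0 : 0 < β) (h1 : β < 1)
include h0 h1

theorem kappa_sq_eq : kappa β ^ 2 = 1 / (β * (1 - β)) := kappa_sq h0 h1

theorem two_le_kappa_self : 2 ≤ kappa β := two_le_kappa h0 h1

theorem ratio_le_kappa_sq : β / (1 - β) ≤ kappa β ^ 2 := by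
  have : 0 < 1 - β := by linarith
  rw [kappa_sq_eq h0 h1, div_le_div_iff₀ this (by positivity)]
  nlinarith [mul_pos h0 this]

theorem sqrt_ratio_le_kappa_sq : √(β / (1 - β)) ≤ kappa β ^ 2 := by
  have hk := two_le_kappa_self h0 h1
  calc √(β / (1 - β)) ≤ √(kappa β ^ 2) := Real.sqrt_le_sqrt (ratio_le_kappa_sq h0 h1)
    _ = kappa β := Real.sqrt_sq (by linarith)
    _ ≤ kappa β ^ 2 := by nlinarith

/-- The boundary cost only has √(1-β) in the denominator; this weakens it to the exponent 3/2 of the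
final bound. -/
theorem sqrt_ratio_le_rpow : √(β / (1 - β)) ≤ √β / (1 - β) ^ (3 / 2 : ℝ) := by
  have h : 0 < 1 - β := by linarith
  rw [Real.sqrt_div h0.le]
  refine div_le_div_of_nonneg_left (Real.sqrt_nonneg _) (Real.rpow_pos_of_pos h _) ?_
  rw [Real.sqrt_eq_rpow]
  exact Real.rpow_le_rpow_of_exponent_ge h (by linarith) (by norm_num)

theorem boundaryCost_le {K T : ℕ} (hK : 2 ≤ K) (hKT : K ≤ T) (U : Finset (Fin K)) :
    boundaryCost β T K U ≤ 486 * (β / (1 - β)) * K * Real.log T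
      + 2 * √(β / (1 - β)) * U.card * Uᶜ.card + kappa β * K := by
  have hK' : (2 : ℝ) ≤ K := by exact_mod_cast hK
  have hT' : (2 : ℝ) ≤ T := by exact_mod_cast hK.trans hKT
  have hL : Real.log 2 ≤ Real.log T := Real.log_le_log (by norm_num) hT'
  have hL2 := two_mul_log_two_le
  have hlog : Real.log (2 * T / K) ≤ Real.log T := by
    refine Real.log_le_log (by positivity) ?_
    rw [div_le_iff₀ (by linarith), mul_comm]
    gcongr
  have hU : (U.card : ℝ) ≤ K := by exact_mod_cast (by simpa using Finset.card_le_univ U : U.card ≤ K)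
  have hV : (Uᶜ.card : ℝ) ≤ K := by
    exact_mod_cast (by simpa using Finset.card_le_univ Uᶜ : Uᶜ.card ≤ K)
  have e1 : 162 * β / (1 - β) * Uᶜ.card * Real.log (2 * T / K)
      ≤ 162 * (β / (1 - β)) * K * Real.log T := by
    rw [mul_div_assoc]
    exact mul_le_mul (by gcongr) hlog
      (Real.log_nonneg (by rw [le_div_iff₀ (by linarith)]; have : (K : ℝ) ≤ T := by exact_mod_cast hKT
                           linarith)) (by positivity)
  have e2 : 162 * β / (1 - β) * U.card ≤ 324 * (β / (1 - β)) * K * Real.log T := by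
    rw [mul_div_assoc]
    calc 162 * (β / (1 - β)) * U.card ≤ 162 * (β / (1 - β)) * K := by gcongr
      _ = 162 * (β / (1 - β)) * K * 1 := by ring
      _ ≤ 162 * (β / (1 - β)) * K * (2 * Real.log T) :=
        mul_le_mul_of_nonneg_left (by linarith) (by positivity)
      _ = _ := by ring
  unfold boundaryCost
  linarith

end Scalars

/-- The inequality log v ≤ 2√v at v = 2T/K makes K log(2T/K) of order √(KT), so no logarithm
survives. -/
theorem boundaryCost_half_le {K T : ℕ} (hK : 1 ≤ K) (hKT : K ≤ T) (i₀ : Fin K) :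
    boundaryCost (1 / 2) T K {i₀} ≤ 652 * √(K * T) := by
  have hK' : (1 : ℝ) ≤ K := by exact_mod_cast hK
  have hKT' : (K : ℝ) ≤ T := by exact_mod_cast hKT
  have hk : kappa (1 / 2) = 2 := by
    unfold kappa
    rw [show (1 / (1 / 2 * (1 - 1 / 2)) : ℝ) = 2 ^ 2 by norm_num]
    exact Real.sqrt_sq (by norm_num)
  have hV : ((({i₀} : Finset (Fin K))ᶜ).card : ℝ) ≤ K := by
    exact_mod_cast (by simpa using Finset.card_le_univ ({i₀} : Finset (Fin K))ᶜ :
      (({i₀} : Finset (Fin K))ᶜ).card ≤ K)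
  have hR : (K : ℝ) ≤ √(K * T) := Real.le_sqrt_of_sq_le (by nlinarith)
  have hx : (0 : ℝ) < 2 * T / K := div_pos (by linarith) (by linarith)
  have hx1 : (1 : ℝ) ≤ 2 * T / K := by rw [le_div_iff₀ (by linarith)]; linarith
  have hlog : Real.log (2 * T / K) ≤ 2 * √(2 * T / K) := by
    have := Real.log_le_sub_one_of_pos (Real.sqrt_pos.2 hx)
    rw [Real.log_sqrt hx.le] at this
    linarith
  have hs : (K : ℝ) * √(2 * T / K) ≤ 3 / 2 * √(K * T) := by
    have : (K : ℝ) * √(2 * T / K) = √2 * √(K * T) := by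
      rw [← Real.sqrt_mul (by norm_num), ← Real.sqrt_sq (by linarith : (0 : ℝ) ≤ K),
        ← Real.sqrt_mul (by positivity), Real.sqrt_sq (by linarith : (0 : ℝ) ≤ K)]
      congr 1
      field_simp
    rw [this]
    gcongr
    rw [Real.sqrt_le_left (by norm_num)]
    norm_num
  have e : (({i₀} : Finset (Fin K))ᶜ.card : ℝ) * Real.log (2 * T / K) ≤ 3 * √(K * T) := by
    calc _ ≤ (K : ℝ) * (2 * √(2 * T / K)) :=
          mul_le_mul hV hlog (Real.log_nonneg hx1) (by linarith)
      _ ≤ _ := by linarith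
  unfold boundaryCost
  rw [hk, show (162 * (1 / 2) / (1 - 1 / 2) : ℝ) = 162 by norm_num,
    show ((1 / 2) / (1 - 1 / 2) : ℝ) = 1 by norm_num, Real.sqrt_one, Finset.card_singleton]
  push_cast
  linarith

/-! ### Choice of the weights and self-bounding -/

section Regret

variable {Ω : Type*} {mΩ : MeasurableSpace Ω} {μ : Measure Ω} [IsProbabilityMeasure μ] {K : ℕ}
  {T : ℕ} {𝓗 : Filtration ℕ mΩ} {ℓ p : ℕ → Ω → Fin K → ℝ} {I : ℕ → Ω → Fin K} {β : ℝ}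

theorem integral_le_of_forall_le {f : Ω → ℝ} (hf : Integrable f μ) {b : ℝ} (h : ∀ ω, f ω ≤ b) :
    ∫ ω, f ω ∂μ ≤ b := by
  have := integral_mono hf (integrable_const b) h
  rwa [integral_const, probReal_univ, one_smul] at this

theorem IsPath.sum_roundCost_const_le {l p : ℕ → Fin K → ℝ} {a : ℕ → Fin K}
    (H : IsPath β T l p a) (h0 : 0 < β) (h1 : β < 1) (hT : 2 ≤ T)
    (hKT : K ≤ T) (i₀ : Fin K) {η : ℝ} (hη : 0 < η) :
    ∑ t ∈ Finset.range T, roundCost h0 h1 T {i₀} p t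
      ≤ 3 * η * T + 327 * (kappa β ^ 2 * K * Real.log T) / η + 9 * Real.log T + 1 := by
  have hKT' : (K : ℝ) ≤ T := by exact_mod_cast hKT
  have hK : (1 : ℝ) ≤ K := by exact_mod_cast i₀.pos
  have h := H.sum_roundCost_le h0 h1 hT (Finset.singleton_nonempty i₀) (η := fun _ => η)
    (fun _ _ => hη) hη
  refine h.trans ?_
  have hps : ∑ i ∈ ({i₀} : Finset (Fin K))ᶜ, ∑ t ∈ Finset.range T, p t i ≤ T := by
    rw [Finset.sum_comm]
    calc ∑ t ∈ Finset.range T, ∑ i ∈ ({i₀} : Finset (Fin K))ᶜ, p t i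
        ≤ ∑ t ∈ Finset.range T, (1 : ℝ) := Finset.sum_le_sum fun t ht => by
          rw [← H.sum_eq (Finset.mem_range.1 ht)]
          exact Finset.sum_le_univ_sum_of_nonneg fun j => (H.pos (Finset.mem_range.1 ht) j).le
      _ = T := by simp
  have hV : ((({i₀} : Finset (Fin K))ᶜ).card : ℝ) ≤ K := by
    exact_mod_cast (by simpa using Finset.card_le_univ ({i₀} : Finset (Fin K))ᶜ :
      (({i₀} : Finset (Fin K))ᶜ).card ≤ K)
  set x := kappa β ^ 2 * Real.log T / η with hx
  have hx0 : 0 ≤ x := by positivity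
  have e1 : ∀ c : ℝ, c * kappa β ^ 2 * Real.log T / η = c * x := fun c => by rw [hx]; ring
  have e2 : 327 * (kappa β ^ 2 * K * Real.log T) / η = 327 * (K * x) := by rw [hx]; ring
  rw [Finset.sum_add_distrib, ← Finset.mul_sum, Finset.sum_add_distrib, Finset.sum_const,
    Finset.sum_const, nsmul_eq_mul, nsmul_eq_mul, e1, e1, e2, Finset.card_singleton, Nat.cast_one,
    one_mul, mul_one]
  have a1 : η * (∑ i ∈ ({i₀} : Finset (Fin K))ᶜ, ∑ t ∈ Finset.range T, p t i
      + (({i₀} : Finset (Fin K))ᶜ).card) ≤ η * (T + T) :=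
    mul_le_mul_of_nonneg_left (by linarith) hη.le
  have a2 : η * ∑ i ∈ ({i₀} : Finset (Fin K))ᶜ, ∑ t ∈ Finset.range T, p t i ≤ η * T :=
    mul_le_mul_of_nonneg_left hps hη.le
  have a3 : ((({i₀} : Finset (Fin K))ᶜ).card : ℝ) * (300 * x) ≤ K * (300 * x) := by gcongr
  have a4 : x ≤ K * x := le_mul_of_one_le_left hx0 hK
  linarith

/-- The cost of the game in terms of the gaps. -/
theorem IsPath.sum_roundCost_gap_le {l p : ℕ → Fin K → ℝ} {a : ℕ → Fin K}
    (H : IsPath β T l p a) (h0 : 0 < β) (h1 : β < 1) (hT : 2 ≤ T) {U : Finset (Fin K)}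
    (hU : U.Nonempty) {Δ : Fin K → ℝ} (hΔ : ∀ i, Δ i ∈ Set.Icc (0 : ℝ) 1) {d : ℝ} (hd : 0 < d)
    (hdΔ : ∀ i ∈ Uᶜ, d ≤ Δ i) {η : ℝ} (hη : 0 < η) :
    ∑ t ∈ Finset.range T, roundCost h0 h1 T U p t
      ≤ 2 * η * ∑ t ∈ Finset.range T, ∑ i, p t i * Δ i
        + 300 * (kappa β ^ 2 * Real.log T * (∑ i ∈ Uᶜ, 1 / Δ i + U.card / d)) / η
        + K * (9 * Real.log T + 1 + η) := by
  -- The weight η Δ_i turns the mass of arm i into η p_i Δ_i, and η₀ = η d does the same for the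
  -- total outside mass because d ≤ Δ_i. Together they give the factor 2η.
  have h := H.sum_roundCost_le h0 h1 hT hU (η := fun i => η * Δ i) (η₀ := η * d)
    (fun i hi => mul_pos hη (hd.trans_le (hdΔ i hi))) (mul_pos hη hd)
  refine h.trans ?_
  set x := kappa β ^ 2 * Real.log T / η with hx
  have hp0 : ∀ i, 0 ≤ ∑ t ∈ Finset.range T, p t i := fun i =>
    Finset.sum_nonneg fun t ht => (H.pos (Finset.mem_range.1 ht) i).le
  have hV : (Uᶜ.card : ℝ) + U.card = K := by
    have := Finset.card_compl_add_card U
    rw [Fintype.card_fin] at this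
    exact_mod_cast this
  have e1 : ∑ i ∈ Uᶜ, (η * Δ i * (∑ t ∈ Finset.range T, p t i + 1)
        + 300 * kappa β ^ 2 * Real.log T / (η * Δ i))
      ≤ η * ∑ i ∈ Uᶜ, Δ i * ∑ t ∈ Finset.range T, p t i + η * Uᶜ.card
        + 300 * x * ∑ i ∈ Uᶜ, 1 / Δ i := by
    rw [Finset.mul_sum, Finset.mul_sum, mul_comm η (Uᶜ.card : ℝ), ← nsmul_eq_mul,
      ← Finset.sum_const, ← Finset.sum_add_distrib, ← Finset.sum_add_distrib]
    refine Finset.sum_le_sum fun i hi => ?_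
    have hi0 : 0 < Δ i := hd.trans_le (hdΔ i hi)
    have : 300 * kappa β ^ 2 * Real.log T / (η * Δ i) = 300 * x * (1 / Δ i) := by
      rw [hx]; field_simp
    rw [this]
    have : η * Δ i ≤ η := mul_le_of_le_one_right hη.le (hΔ i).2
    linarith
  have e2 : η * d * ∑ i ∈ Uᶜ, ∑ t ∈ Finset.range T, p t i
      ≤ η * ∑ i ∈ Uᶜ, Δ i * ∑ t ∈ Finset.range T, p t i := by
    rw [mul_assoc, Finset.mul_sum]
    exact mul_le_mul_of_nonneg_left (Finset.sum_le_sum fun i hi =>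
      mul_le_mul_of_nonneg_right (hdΔ i hi) (hp0 i)) hη.le
  have e3 : ∑ i ∈ Uᶜ, Δ i * ∑ t ∈ Finset.range T, p t i
      ≤ ∑ t ∈ Finset.range T, ∑ i, p t i * Δ i := by
    rw [Finset.sum_comm]
    simp only [Finset.mul_sum, mul_comm (p _ _)]
    exact Finset.sum_le_univ_sum_of_nonneg fun i => Finset.sum_nonneg fun t ht =>
      mul_nonneg (hΔ i).1 (H.pos (Finset.mem_range.1 ht) i).le
  have e4 : (U.card : ℝ) * (27 * kappa β ^ 2 * Real.log T / (η * d) + 9 * Real.log T + 1)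
      ≤ 300 * x * (U.card / d) + U.card * (9 * Real.log T + 1) := by
    have : 27 * kappa β ^ 2 * Real.log T / (η * d) = 27 * x * (1 / d) := by
      rw [hx]; field_simp
    rw [this]
    have : 0 ≤ U.card * (x * (1 / d)) := by positivity
    have e : 300 * x * (U.card / d) = 300 * (U.card * (x * (1 / d))) := by ring
    rw [e]
    linarith
  have e5 : 300 * (kappa β ^ 2 * Real.log T * (∑ i ∈ Uᶜ, 1 / Δ i + U.card / d)) / η
      = 300 * x * ∑ i ∈ Uᶜ, 1 / Δ i + 300 * x * (U.card / d) := by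
    rw [hx]; ring
  have e6 : (K : ℝ) * (9 * Real.log T + 1 + η)
      = Uᶜ.card * (9 * Real.log T + 1) + U.card * (9 * Real.log T + 1) + η * Uᶜ.card + η * U.card := by
    rw [← hV]; ring
  have e7 := mul_le_mul_of_nonneg_left e3 hη.le
  have e8 : 0 ≤ (Uᶜ.card : ℝ) * (9 * Real.log T + 1) := by positivity
  have e9 : 0 ≤ η * U.card := by positivity
  rw [e5, e6]
  linarith

/-- With 2η ≤ 1/2 the regret on the right is absorbed by the left. -/
theorem le_two_mul_of_le_mul_add {r A η : ℝ} (hη : η ≤ 1 / 4) (hA : 0 ≤ A)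
    (h : r ≤ 2 * η * r + A) : r ≤ 2 * A := by
  rcases le_or_gt r 0 with hr | hr
  · linarith
  · nlinarith

/-- Up to constants the optimal η is √(X/C); it is capped at 1/4, so the case C ≤ X uses 1/4. -/
theorem exists_scale {X C : ℝ} (hX : 0 < X) :
    ∃ η : ℝ, 0 < η ∧ η ≤ 1 / 4 ∧ 4 * η * C + 600 * X / η ≤ 2401 * X + 2401 * √(X * C) := by
  rcases le_or_gt C X with h | h
  · refine ⟨1 / 4, by norm_num, le_rfl, ?_⟩
    have := Real.sqrt_nonneg (X * C)
    linarith
  · have hC : 0 < C := hX.trans h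
    set s := √(X * C) with hs
    have hs0 : 0 < s := Real.sqrt_pos.2 (by positivity)
    have hs2 : s * s = X * C := Real.mul_self_sqrt (by positivity)
    have hsC : s ≤ C := by
      rw [hs, Real.sqrt_le_left hC.le]; nlinarith
    refine ⟨s / (4 * C), by positivity, ?_, ?_⟩
    · rw [div_le_iff₀ (by positivity)]; linarith
    · have e1 : 4 * (s / (4 * C)) * C = s := by field_simp
      have e2 : 600 * X / (s / (4 * C)) = 2400 * s := by
        field_simp
        nlinarith
      rw [e1, e2]
      linarith

namespace IsBanditGame

variable (G : IsBanditGame μ T 𝓗 ℓ p I)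
  (F : FollowsTsallisFTRL (√((1 - β) / β)) β β (162 * β / (1 - β)) T ℓ p I)
  (h0 : 0 < β) (h1 : β < 1) (iStar : Fin K)
include G F h0 h1

/-- With Y = κ² K log T and R = √(TY), take η = R/T. If T ≤ Y the trivial bound T on the regret
suffices; otherwise Y ≤ R, and R dominates all lower-order terms. -/
theorem regret_le_sqrt (hK : 2 ≤ K) (hKT : K ≤ T) :
    regret μ T ℓ I iStar ≤ 840 * √(1 / (β * (1 - β)) * (K * T * Real.log T)) := by
  have hT : 2 ≤ T := hK.trans hKT
  have hK' : (2 : ℝ) ≤ K := by exact_mod_cast hK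
  have hT' : (2 : ℝ) ≤ T := by exact_mod_cast hT
  have hL : Real.log 2 ≤ Real.log T := Real.log_le_log (by norm_num) hT'
  have hL2 := two_mul_log_two_le
  have hL0 : 1 ≤ 2 * Real.log T := by linarith
  have hk := two_le_kappa_self h0 h1
  have hk4 : 4 ≤ kappa β ^ 2 := by nlinarith
  set Y := kappa β ^ 2 * K * Real.log T with hY
  have hLpos : 0 < Real.log T := by linarith
  have hY0 : 0 < Y := by positivity
  have hR : 1 / (β * (1 - β)) * (K * T * Real.log T) = T * Y := by
    rw [← kappa_sq_eq h0 h1, hY]; ring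
  rw [hR]
  set R := √(T * Y)
  have hR0 : 0 < R := Real.sqrt_pos.2 (by positivity)
  have hR2 : R * R = T * Y := Real.mul_self_sqrt (by positivity)
  rcases le_or_gt (T : ℝ) Y with h | h
  · have : (T : ℝ) ≤ R := Real.le_sqrt_of_sq_le (by nlinarith)
    linarith [G.regret_le_rounds iStar]
  · have hYR : Y ≤ R := Real.le_sqrt_of_sq_le (by nlinarith)
    have hη : 0 < R / T := by positivity
    have hint := integral_le_of_forall_le (G.integrable_sum_roundCost F h0 h1 {iStar}) fun ω =>
      (F.isPath G ω).sum_roundCost_const_le h0 h1 hT hKT iStar hη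
    have e1 : 3 * (R / T) * T = 3 * R := by field_simp
    have e2 : 327 * Y / (R / T) = 327 * R := by
      field_simp
      nlinarith
    rw [← hY, e1, e2] at hint
    have hreg := G.regret_le_of_singleton iStar F h0 h1 hKT
    have hbd := boundaryCost_le h0 h1 hK hKT {iStar}
    have hV : ((({iStar} : Finset (Fin K))ᶜ).card : ℝ) ≤ K := by
      exact_mod_cast (by simpa using Finset.card_le_univ ({iStar} : Finset (Fin K))ᶜ :
        (({iStar} : Finset (Fin K))ᶜ).card ≤ K)
    have hKY : kappa β ^ 2 * K ≤ 2 * Y := by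
      have := mul_le_mul_of_nonneg_left hL0 (by positivity : 0 ≤ kappa β ^ 2 * K)
      rw [hY]; linarith
    have f1 : 486 * (β / (1 - β)) * K * Real.log T ≤ 486 * Y := by
      have := mul_le_mul_of_nonneg_right (ratio_le_kappa_sq h0 h1)
        (by positivity : 0 ≤ K * Real.log T)
      rw [hY]; linarith
    have f2 : 2 * √(β / (1 - β)) * ({iStar} : Finset (Fin K)).card
        * (({iStar} : Finset (Fin K))ᶜ).card ≤ 4 * Y := by
      rw [Finset.card_singleton, Nat.cast_one, mul_one]
      have := mul_le_mul (sqrt_ratio_le_kappa_sq h0 h1) hV (Nat.cast_nonneg _) (by positivity)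
      linarith
    have f3 : kappa β * K ≤ 2 * Y := by
      have : kappa β * K ≤ kappa β ^ 2 * K := by gcongr; nlinarith
      linarith
    have f4 : K / 2 ≤ Y := by
      have : 4 * (K : ℝ) ≤ kappa β ^ 2 * K := by gcongr
      linarith
    have f5 : Real.log T ≤ Y / 4 := by
      have : 4 * Real.log T ≤ kappa β ^ 2 * K * Real.log T := by gcongr; nlinarith
      linarith
    linarith

/-- The set U, the lower bound d and the comparison `hreg` are left free because U is {`iStar`} when
no gap is zero. Gaps are at most 1, so X dominates κ² K log T and absorbs most lower-order terms. -/
theorem regret_le_of_gap (hK : 2 ≤ K) (hKT : K ≤ T) {U : Finset (Fin K)}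
    (hU : U.Nonempty) {Δ : Fin K → ℝ} {d C D : ℝ} (hd : 0 < d) (hd1 : d ≤ 1)
    (hdΔ : ∀ i ∈ Uᶜ, d ≤ Δ i) (hC : SelfBounding μ T ℓ p I iStar Δ C) (hD : 0 ≤ D)
    (hreg : regret μ T ℓ I iStar
      ≤ D + ∫ ω, ∑ t ∈ Finset.range T, roundCost h0 h1 T U (fun τ => p τ ω) t ∂μ
        + K / 2 + boundaryCost β T K U)
    {X : ℝ} (hX : X = kappa β ^ 2 * Real.log T * (∑ i ∈ Uᶜ, 1 / Δ i + U.card / d)) :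
    regret μ T ℓ I iStar ≤ 2 * D + 2420 * X + 2401 * √(X * C)
      + 4 * √(β / (1 - β)) * K ^ 2 + 972 * (β / (1 - β)) * K * Real.log T := by
  obtain ⟨hΔ, hC0, hself⟩ := hC
  have hT : 2 ≤ T := hK.trans hKT
  have hK' : (2 : ℝ) ≤ K := by exact_mod_cast hK
  have hT' : (2 : ℝ) ≤ T := by exact_mod_cast hT
  have hL : Real.log 2 ≤ Real.log T := Real.log_le_log (by norm_num) hT'
  have hL2 := two_mul_log_two_le
  have hL0 : 1 ≤ 2 * Real.log T := by linarith
  have hk := two_le_kappa_self h0 h1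
  have hk4 : 4 ≤ kappa β ^ 2 := by nlinarith
  have hcard : (Uᶜ.card : ℝ) + U.card = K := by
    have := Finset.card_compl_add_card U
    rw [Fintype.card_fin] at this
    exact_mod_cast this
  have hG : (K : ℝ) ≤ ∑ i ∈ Uᶜ, 1 / Δ i + U.card / d := by
    rw [← hcard]
    refine add_le_add ?_ (by rw [le_div_iff₀ hd]; exact mul_le_of_le_one_right (by positivity) hd1)
    rw [← nsmul_one, ← Finset.sum_const]
    exact Finset.sum_le_sum fun i hi => by
      rw [le_div_iff₀ (hd.trans_le (hdΔ i hi)), one_mul]; exact (hΔ i).2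
  have hKX : kappa β ^ 2 * Real.log T * K ≤ X := by rw [hX]; gcongr
  have hLpos : 0 < Real.log T := by linarith
  have hX0 : 0 < X := lt_of_lt_of_le (by positivity) hKX
  obtain ⟨η, hη0, hη1, hη⟩ := exists_scale (C := C) hX0
  have hS := G.integrable_sum_dist_mul F Δ Finset.univ
  have hint : ∫ ω, ∑ t ∈ Finset.range T, roundCost h0 h1 T U (fun τ => p τ ω) t ∂μ
      ≤ 2 * η * ∫ ω, ∑ t ∈ Finset.range T, ∑ i, p t ω i * Δ i ∂μ
        + (300 * X / η + K * (9 * Real.log T + 1 + η)) := by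
    have := integral_mono (μ := μ) (G.integrable_sum_roundCost F h0 h1 U)
      ((hS.const_mul (2 * η)).add
        (integrable_const (300 * X / η + K * (9 * Real.log T + 1 + η))))
      fun ω => by
        have := (F.isPath G ω).sum_roundCost_gap_le h0 h1 hT hU hΔ hd hdΔ hη0
        rw [← hX, add_assoc] at this
        exact this
    rwa [integral_add' (hS.const_mul _) (integrable_const _), integral_const_mul, integral_const,
      probReal_univ, one_smul] at this
  have hbd := boundaryCost_le h0 h1 hK hKT U
  have f1 : 2 * √(β / (1 - β)) * U.card * Uᶜ.card ≤ 2 * √(β / (1 - β)) * K ^ 2 := by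
    rw [mul_assoc]
    gcongr
    nlinarith
  have hKL : (K : ℝ) ≤ 2 * (Real.log T * K) := by nlinarith
  have hkX : kappa β ^ 2 * K ≤ 2 * X := by
    have := mul_le_mul_of_nonneg_left hL0 (by positivity : 0 ≤ kappa β ^ 2 * K)
    linarith
  have f2 : kappa β * K ≤ 2 * X := by
    have : kappa β * K ≤ kappa β ^ 2 * K := by gcongr; nlinarith
    linarith
  have f3 : Real.log T * K ≤ X / 4 := by
    have : 4 * (Real.log T * K) ≤ kappa β ^ 2 * (Real.log T * K) := by gcongr
    linarith
  have f4 : K * (9 * Real.log T + 1 + η) + K / 2 ≤ 7 / 2 * X := by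
    have : (K : ℝ) * η ≤ K * (1 / 4) := by gcongr
    linarith
  set Reg := regret μ T ℓ I iStar
  have hsb : 2 * η * ∫ ω, ∑ t ∈ Finset.range T, ∑ i, p t ω i * Δ i ∂μ ≤ 2 * η * (Reg + C) :=
    mul_le_mul_of_nonneg_left (by linarith) (by positivity)
  have h600 : 600 * X / η = 2 * (300 * X / η) := by ring
  set A := D + 2 * η * C + 300 * X / η + 7 / 2 * X + 486 * (β / (1 - β)) * K * Real.log T
    + 2 * √(β / (1 - β)) * K ^ 2 + 2 * X with hA
  have hA0 : 0 ≤ A := by positivity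
  have hmain : Reg ≤ 2 * η * Reg + A := by
    rw [hA]; linarith
  have hRA : Reg ≤ 2 * A := le_two_mul_of_le_mul_add hη1 hA0 hmain
  rw [hA] at hRA
  linarith

end IsBanditGame

end Regret

/-! ### The complexity of the gap vector -/

section Complexity

variable {K : ℕ} {Δ : Fin K → ℝ}

theorem gapMin_le (i : Fin K) (hi : Δ i ≠ 0) : gapMin Δ ≤ Δ i :=
  ciInf_le (f := fun i : {i : Fin K // Δ i ≠ 0} => Δ i.1) (Set.finite_range _).bddBelow ⟨i, hi⟩

theorem exists_gapMin_eq (h : ∃ i, Δ i ≠ 0) : ∃ i, Δ i ≠ 0 ∧ Δ i = gapMin Δ := by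
  obtain ⟨i, hi⟩ := h
  have : Nonempty {i : Fin K // Δ i ≠ 0} := ⟨⟨i, hi⟩⟩
  obtain ⟨j, hj⟩ := exists_eq_ciInf_of_finite (f := fun i : {i : Fin K // Δ i ≠ 0} => Δ i.1)
  exact ⟨j.1, j.2, hj⟩

theorem gapMin_nonneg (hΔ : ∀ i, 0 ≤ Δ i) : 0 ≤ gapMin Δ :=
  Real.iInf_nonneg fun i => hΔ i.1

theorem instanceComplexity_nonneg (hΔ : ∀ i, 0 ≤ Δ i) : 0 ≤ instanceComplexity Δ := by
  have := gapMin_nonneg hΔ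
  exact add_nonneg (by positivity) (Finset.sum_nonneg fun i _ => one_div_nonneg.2 (hΔ i))

end Complexity

/-! ### Assembling the bounds -/

section Main

variable {Ω : Type*} {mΩ : MeasurableSpace Ω} {μ : Measure Ω} {K : ℕ}
  {T : ℕ} {𝓗 : Filtration ℕ mΩ} {ℓ p : ℕ → Ω → Fin K → ℝ} {I : ℕ → Ω → Fin K} {β : ℝ}

theorem regret_eq_zero_of_subsingleton [Subsingleton (Fin K)] (iStar : Fin K) :
    regret μ T ℓ I iStar = 0 := by
  unfold regret
  have : ∀ ω, ∑ t ∈ Finset.range T, ℓ t ω (I t ω) - ∑ t ∈ Finset.range T, ℓ t ω iStar = 0 :=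
    fun ω => sub_eq_zero.2 (Finset.sum_congr rfl fun t _ => by
      rw [Subsingleton.elim (I t ω) iStar])
  simp only [this, integral_zero]

namespace IsBanditGame

variable [IsProbabilityMeasure μ] (G : IsBanditGame μ T 𝓗 ℓ p I)
include G

theorem regret_half_le
    (F : FollowsTsallisFTRL (√((1 - 1 / 2) / (1 / 2))) (1 / 2) (1 / 2)
      (162 * (1 / 2) / (1 - 1 / 2)) T ℓ p I) (hKT : K ≤ T) (iStar : Fin K) :
    regret μ T ℓ I iStar ≤ 1653 * √(K * T) := by
  have h0 : (0 : ℝ) < 1 / 2 := by norm_num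
  have h1 : (1 / 2 : ℝ) < 1 := by norm_num
  have hK1 : 1 ≤ K := iStar.pos
  have hint := integral_le_of_forall_le (G.integrable_sum_roundCost F h0 h1 {iStar}) fun ω =>
    (F.isPath G ω).sum_roundCost_half_le h0 h1 hKT iStar
  have hreg := G.regret_le_of_singleton iStar F h0 h1 hKT
  have hbd := boundaryCost_half_le hK1 hKT iStar
  have hK' : (1 : ℝ) ≤ K := by exact_mod_cast hK1
  have hKT' : (K : ℝ) ≤ T := by exact_mod_cast hKT
  have hR : (K : ℝ) ≤ √(K * T) := Real.le_sqrt_of_sq_le (by nlinarith)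
  linarith

theorem regret_le_instanceComplexity
    (F : FollowsTsallisFTRL (√((1 - β) / β)) β β (162 * β / (1 - β)) T ℓ p I)
    (h0 : 0 < β) (h1 : β < 1) (hK : 2 ≤ K) (hKT : K ≤ T) {iStar : Fin K}
    (hbest : IsBestArm μ T ℓ iStar) {Δ : Fin K → ℝ} {C D : ℝ}
    (hC : SelfBounding μ T ℓ p I iStar Δ C) (hD : zeroGapExcess μ T 𝓗 ℓ iStar Δ ≤ D) {X : ℝ}
    (hX : X = kappa β ^ 2 * Real.log T * instanceComplexity Δ) :
    regret μ T ℓ I iStar ≤ 2 * D + 4840 * X + 4802 * √(X * C)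
      + 4 * √(β / (1 - β)) * K ^ 2 + 972 * (β / (1 - β)) * K * Real.log T := by
  have hΔ := hC.1
  have hD0 : 0 ≤ D := (G.zeroGapExcess_nonneg hbest Δ).trans hD
  have hX0 : 0 ≤ X := by
    have := instanceComplexity_nonneg fun i => (hΔ i).1
    rw [hX]; positivity
  have hs := Real.sqrt_nonneg (X * C)
  by_cases hV : ∃ i, Δ i ≠ 0
  · obtain ⟨j, hj, hjd⟩ := exists_gapMin_eq hV
    have hd : 0 < gapMin Δ := hjd ▸ lt_of_le_of_ne (hΔ j).1 (Ne.symm hj)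
    have hd1 : gapMin Δ ≤ 1 := hjd ▸ (hΔ j).2
    set U : Finset (Fin K) := Finset.univ.filter fun i => Δ i = 0 with hUdef
    have hUc : Uᶜ = Finset.univ.filter fun i => Δ i ≠ 0 := Finset.compl_filter _
    by_cases hU : U.Nonempty
    · have hreg := G.regret_le_of_zeroGap iStar F h0 h1 hKT hU
        (fun i hi => (Finset.mem_filter.1 hi).2)
      have := G.regret_le_of_gap F h0 h1 iStar hK hKT hU hd hd1
        (fun i hi => gapMin_le i (by rw [hUc] at hi; exact (Finset.mem_filter.1 hi).2)) hC hD0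
        (hreg.trans (by linarith)) (X := X)
        (by rw [hX, instanceComplexity, hUc, add_comm (_ / _)])
      linarith
    -- No gap is zero: compare with {`iStar`} and d the smallest gap. The extra 1/d is one of the
    -- terms 1/Δ_j, so the complexity at most doubles.
    · rw [Finset.not_nonempty_iff_eq_empty] at hU
      have hne : ∀ i, Δ i ≠ 0 := fun i hi => by
        have : i ∈ U := Finset.mem_filter.2 ⟨Finset.mem_univ i, hi⟩
        rw [hU] at this
        exact absurd this (Finset.notMem_empty i)
      have hIC : instanceComplexity Δ = ∑ i, 1 / Δ i := by
        rw [instanceComplexity, ← hUdef, hU, ← hUc, hU]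
        simp
      have hreg := G.regret_le_of_singleton iStar F h0 h1 hKT
      have hr := G.regret_le_of_gap F h0 h1 iStar hK hKT (Finset.singleton_nonempty iStar) hd hd1
        (fun i _ => gapMin_le i (hne i)) hC hD0 (hreg.trans (by linarith)) rfl
      rw [Finset.card_singleton, Nat.cast_one] at hr
      set X' := kappa β ^ 2 * Real.log T
        * (∑ i ∈ ({iStar} : Finset (Fin K))ᶜ, 1 / Δ i + 1 / gapMin Δ) with hX'
      have hpos : ∀ i, 0 ≤ 1 / Δ i := fun i => one_div_nonneg.2 (hΔ i).1
      have hle : X' ≤ 2 * X := by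
        have e1 : ∑ i ∈ ({iStar} : Finset (Fin K))ᶜ, 1 / Δ i ≤ ∑ i, 1 / Δ i :=
          Finset.sum_le_univ_sum_of_nonneg hpos
        have e2 : 1 / gapMin Δ ≤ ∑ i, 1 / Δ i := by
          rw [← hjd]
          exact Finset.single_le_sum (f := fun i => 1 / Δ i) (fun i _ => hpos i) (Finset.mem_univ j)
        rw [hX, hX', hIC, mul_left_comm]
        gcongr
        linarith
      have hsle : √(X' * C) ≤ 2 * √(X * C) := by
        refine Real.sqrt_le_iff.2 ⟨by positivity, ?_⟩
        rw [mul_pow, Real.sq_sqrt (mul_nonneg hX0 hC.2.1)]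
        have := mul_le_mul_of_nonneg_right hle hC.2.1
        have := mul_nonneg hX0 hC.2.1
        linarith
      linarith
  · push Not at hV
    have hreg := G.regret_le_zeroGapExcess iStar F hV
    have : 0 ≤ 4 * √(β / (1 - β)) * K ^ 2 + 972 * (β / (1 - β)) * K * Real.log T := by positivity
    linarith

end IsBanditGame

end Main

end BOBW
end

theorem theorem3 :
    ∃ c : ℝ, 0 < c ∧
      ∀ (β : ℝ), 0 < β → β < 1 →
      ∀ (K T : ℕ), K ≤ T →
      ∀ (Ω : Type*) (mΩ : MeasurableSpace Ω) (μ : Measure Ω) (_ : IsProbabilityMeasure μ)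
        (𝓗 : Filtration ℕ mΩ) (ℓ p : ℕ → Ω → Fin K → ℝ) (I : ℕ → Ω → Fin K),
        BOBW.IsBanditGame μ T 𝓗 ℓ p I →
        BOBW.FollowsTsallisFTRL (√((1 - β) / β)) β β (162 * β / (1 - β)) T ℓ p I →
        ∀ iStar : Fin K, BOBW.IsBestArm μ T ℓ iStar →
          BOBW.regret μ T ℓ I iStar ≤
              c * √(1 / (β * (1 - β)) * (K * T * Real.log T ^ (if β = 1 / 2 then 0 else 1)))
          ∧ ∀ (Δ : Fin K → ℝ) (C D : ℝ),
              BOBW.SelfBounding μ T ℓ p I iStar Δ C →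
              BOBW.zeroGapExcess μ T 𝓗 ℓ iStar Δ ≤ D →
              BOBW.regret μ T ℓ I iStar ≤
                c * (BOBW.instanceComplexity Δ * Real.log T / (β * (1 - β))
                  + √(C * BOBW.instanceComplexity Δ * Real.log T / (β * (1 - β)))
                  + D
                  + K ^ 2 * √β / (1 - β) ^ (3 / 2 : ℝ)
                  + β * K * Real.log T / (1 - β)) := by
  refine ⟨10000, by norm_num, fun β h0 h1 K T hKT Ω mΩ μ _ 𝓗 ℓ p I G F iStar hbest => ?_⟩
  have hK1 : 1 ≤ K := iStar.pos
  have hb : 0 < 1 - β := by linarith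
  constructor
  -- Two arms force T ≥ 2, so log T ≥ log 2 can absorb constants; with one arm the regret is zero.
  · rcases Nat.lt_or_ge 1 K with hK | hK
    · split_ifs with hβ
      · subst hβ
        rw [pow_zero, mul_one, show (1 / (1 / 2 * (1 - 1 / 2)) : ℝ) = 2 ^ 2 by norm_num,
          Real.sqrt_mul (by norm_num), Real.sqrt_sq (by norm_num)]
        have := G.regret_half_le F hKT iStar
        have := Real.sqrt_nonneg ((K : ℝ) * T)
        linarith
      · rw [pow_one]
        refine (G.regret_le_sqrt F h0 h1 iStar hK hKT).trans ?_
        gcongr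
        norm_num
    · obtain rfl : K = 1 := by omega
      rw [BOBW.regret_eq_zero_of_subsingleton]
      positivity
  · intro Δ C D hC hD
    have hD0 : 0 ≤ D := (G.zeroGapExcess_nonneg hbest Δ).trans hD
    have hIC := BOBW.instanceComplexity_nonneg fun i => (hC.1 i).1
    have hr1 : 0 ≤ (K : ℝ) ^ 2 * √β / (1 - β) ^ (3 / 2 : ℝ) := by positivity
    have hr2 : 0 ≤ β * K * Real.log T / (1 - β) := by positivity
    have hr3 : 0 ≤ BOBW.instanceComplexity Δ * Real.log T / (β * (1 - β)) := by positivity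
    have hr4 := Real.sqrt_nonneg (C * BOBW.instanceComplexity Δ * Real.log T / (β * (1 - β)))
    rcases Nat.lt_or_ge 1 K with hK | hK
    · have h := G.regret_le_instanceComplexity F h0 h1 hK hKT hbest hC hD rfl
      have e1 : BOBW.kappa β ^ 2 * Real.log T * BOBW.instanceComplexity Δ
          = BOBW.instanceComplexity Δ * Real.log T / (β * (1 - β)) := by
        rw [BOBW.kappa_sq_eq h0 h1]; ring
      have e2 : BOBW.instanceComplexity Δ * Real.log T / (β * (1 - β)) * C
          = C * BOBW.instanceComplexity Δ * Real.log T / (β * (1 - β)) := by ring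
      have e3 : 4 * √(β / (1 - β)) * (K : ℝ) ^ 2
          ≤ 4 * (K ^ 2 * √β / (1 - β) ^ (3 / 2 : ℝ)) := by
        rw [mul_div_assoc, mul_assoc, mul_comm _ ((K : ℝ) ^ 2)]
        gcongr
        exact BOBW.sqrt_ratio_le_rpow h0 h1
      have e4 : 972 * (β / (1 - β)) * K * Real.log T
          = 972 * (β * K * Real.log T / (1 - β)) := by ring
      rw [e1, e2, e4] at h
      linarith
    · obtain rfl : K = 1 := by omega
      rw [BOBW.regret_eq_zero_of_subsingleton]
      positivity
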